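/- **Model.** An $n$-vertex graph with vertex set $[n]$ is vertex-partitioned among $k$ players, who form a clique and compute in synchronous rounds. A player initially knows the IDs of the vertices that it hosts, and for each of them its neighbours and the players hosting these. In every round each player sends a message of at most $C\beta\log n$ bits over each of its $k-1$ links, where $C>0$ is a constant and the integer $\beta\ge 1$ is the bandwidth parameter; after receiving the messages it performs an arbitrary local computation, which may use private coins and public coins shared by all players. We assume $\kappa\log^4 n\le k\le \sqrt n/\log n$ for a constant $\kappa>0$, and $\ell\le n/(2k)$. After an initialization phase with any number of rounds, batches arrive one after the other, each consisting of at most $\ell$ edge insertions and deletions; every player learns at once the new neighbourhoods of its hosted vertices, and the algorithm then has $T$ rounds to update its output before the next batch arrives. The players' outputs *form a maximal matching* of the current graph if there is a maximal matching $M$ of it such that each player outputs exactly those edges of $M$ of which it hosts an endpoint. The *oblivious* adversary fixes the initial graph and all batches in advance, and then every vertex is assigned to a player independently and uniformly at random. The *adaptive* adversary fixes the initial graph and any balanced partition, i.e. one in which every player hosts at least $a\frac nk$ and at most $b\frac nk\log n$ vertices, for constants $0<a<1$ and $b>0$, and it observes the local memory of all players before it chooses each batch. A randomized algorithm has *update time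 $T$* against an adversary if, for a constant $\gamma>0$ and every strategy of this adversary, (i) after the initialization the outputs form a maximal matching with probability at least $1-n^{-\gamma}$, and (ii) for every batch, conditioned on the outputs having formed a maximal matching of the graph just before the batch, the outputs form a maximal matching of the new graph after $T$ rounds with probability at least $1-n^{-\gamma}$. The probability is over all coins of the players and, for the oblivious adversary, also over the random partition. **Theorem.** For all sufficiently large $n$ and all $k,\beta,\ell$ as above, every randomized algorithm with update time $T$ satisfies 1. $T=\Omega\!\left(\frac{\ell\log k}{\beta k^2\log n}\right)$, if the update time $T$ is against the oblivious adversary; 2. $T=\Omega\!\left(\frac{\ell}{\beta k\log n}\right)$, if the update time $T$ is against the adaptive adversary. The implied constants, and the threshold for $n$, depend only on $C,\gamma,\kappa$ (and in part 2 also on $a,b$); in particular not on the number of initialization rounds. -/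

import Mathlib

/-! # The `k`-clique message passing model with batch-dynamic edge updates -/

namespace KClique

/-! ## Discrete probability -/

theorem tsum_pi_prod {α : Type} : ∀ {k : ℕ} (p : Fin k → PMF α),
    ∑' f : Fin k → α, ∏ i, p i (f i) = 1
  | 0, _ => by simp
  | k + 1, p => by
    rw [← (Fin.consEquiv (fun _ : Fin (k + 1) => α)).tsum_eq, ENNReal.tsum_prod']
    simp only [Fin.consEquiv_apply, Fin.prod_univ_succ, Fin.cons_zero, Fin.cons_succ]
    simp only [ENNReal.tsum_mul_left, tsum_pi_prod (fun i : Fin k => p i.succ), mul_one,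
      PMF.tsum_coe]

/-- The joint law of independent random variables `X i` with laws `p i`, `i : Fin k`. -/
noncomputable def indep {α : Type} {k : ℕ} (p : Fin k → PMF α) : PMF (Fin k → α) :=
  ⟨fun f => ∏ i, p i (f i), by
    have h := (ENNReal.summable (f := fun f : Fin k → α => ∏ i, p i (f i))).hasSum
    rwa [tsum_pi_prod p] at h⟩

/-- The probability of the event `E` under `p`, as a real number. -/
noncomputable def prob {α : Type} (p : PMF α) (E : α → Prop) : ℝ :=
  (p.toOuterMeasure {a | E a}).toReal

/-! ## Inputs, updates and the required output -/

/-- An assignment of the vertices `Fin n` to the players `Fin k`: `P v` hosts `v`. -/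
abbrev Partition (n k : ℕ) : Type := Fin n → Fin k

/-- What a player knows of the input: the IDs of its hosted vertices and, for every hosted
vertex `v`, the neighbours of `v` together with the players that host them. -/
structure LocalInput (n k : ℕ) where
  /-- the hosted vertices -/
  hosted : Set (Fin n)
  /-- `nbr v u = some j` iff `v` is hosted here, `u` is a neighbour of `v`, and `j` hosts `u` -/
  nbr : Fin n → Fin n → Option (Fin k)

open Classical in
/-- The local input of player `i` when `G` is partitioned according to `P`. -/
noncomputable def localInput {n k : ℕ} (G : SimpleGraph (Fin n)) (P : Partition n k)
    (i : Fin k) : LocalInput n k where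
  hosted := {v | P v = i}
  nbr v u := if P v = i ∧ G.Adj v u then some (P u) else none

/-- `G'` arises from `G` by a batch of at most `ℓ` edge deletions and insertions. -/
def IsBatch {n : ℕ} (ℓ : ℕ) (G G' : SimpleGraph (Fin n)) : Prop :=
  (symmDiff G.edgeSet G'.edgeSet).ncard ≤ ℓ

/-- The players' outputs `out` form a maximal matching `M` of `G`: every player outputs exactly
those edges of `M` of which it hosts an endpoint. -/
def OutputsMaximalMatching {n k : ℕ} (G : SimpleGraph (Fin n)) (P : Partition n k)
    (out : Fin k → Set (Sym2 (Fin n))) : Prop :=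
  ∃ M : G.Subgraph, Maximal SimpleGraph.Subgraph.IsMatching M ∧
    ∀ i, out i = {e | e ∈ M.edgeSet ∧ ∃ v ∈ e, P v = i}

/-- A balanced vertex partition: every player hosts at least `lo * (n / k)` and at most
`hi * (n / k) * log n` vertices. -/
def Balanced {n k : ℕ} (lo hi : ℝ) (P : Partition n k) : Prop :=
  ∀ i, lo * ((n : ℝ) / k) ≤ ({v | P v = i}.ncard : ℝ) ∧
    ({v | P v = i}.ncard : ℝ) ≤ hi * ((n : ℝ) / k) * Real.log n

/-- Messages of at most `B` bits. -/
abbrev Message (B : ℕ) : Type := {m : List Bool // m.length ≤ B}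

/-! ## Algorithms -/

/-- A randomized dynamic algorithm for `k` players and `n`-vertex graphs in which every message
has at most `B` bits. Local computation is unrestricted. Each local computation may use fresh
private coins (it yields a probability distribution on states, and different players use
independent coins) and fresh public coins `w : Shared`, which all players see.
In a round, player `i` sends the message `msg i s j` over its link to each other player `j`;
then it receives the messages of the others and performs a local computation. -/
structure Algorithm (n k B : ℕ) where
  /-- local memory of a player -/
  State : Type
  /-- outcomes of the public coin flips that precede a local computation -/
  Shared : Type
  /-- law of the public coin flips -/
  shared : PMF Shared
  /-- local computation of a player on receipt of its initial input -/
  start : Fin k → LocalInput n k → Shared → PMF State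
  /-- local computation when a batch has arrived: the player learns its new local input -/
  learn : Fin k → State → LocalInput n k → Shared → PMF State
  /-- the message that player `i` sends to player `j` -/
  msg : (i : Fin k) → State → {j : Fin k // j ≠ i} → Message B
  /-- local computation of player `i` after it received the messages of a round -/
  next : (i : Fin k) → State → ({j : Fin k // j ≠ i} → Message B) → Shared → PMF State
  /-- the edges that a player outputs -/
  output : Fin k → State → Set (Sym2 (Fin n))
  /-- number of rounds of the initialization, which may be arbitrarily large -/
  initRounds : ℕ

namespace Algorithm

variable {n k B : ℕ} (A : Algorithm n k B)

/-- The local memories of all players. -/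
abbrev Config : Type := Fin k → A.State

/-- One synchronous round. -/
noncomputable def round (c : A.Config) : PMF A.Config :=
  A.shared.bind fun w => indep fun i =>
    A.next i (c i) (fun j => A.msg j.1 (c j.1) ⟨i, j.2.symm⟩) w

/-- `r` synchronous rounds. -/
noncomputable def rounds : ℕ → A.Config → PMF A.Config
  | 0, c => PMF.pure c
  | r + 1, c => (A.round c).bind (rounds r)

/-- The initialization on the graph `G` with partition `P`. -/
noncomputable def initial (G : SimpleGraph (Fin n)) (P : Partition n k) : PMF A.Config :=
  (A.shared.bind fun w => indep fun i => A.start i (localInput G P i) w).bind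
    (A.rounds A.initRounds)

/-- The update, in `T` rounds, after the graph has become `G`. -/
noncomputable def update (T : ℕ) (G : SimpleGraph (Fin n)) (P : Partition n k)
    (c : A.Config) : PMF A.Config :=
  (A.shared.bind fun w => indep fun i => A.learn i (c i) (localInput G P i) w).bind
    (A.rounds T)

/-- A strategy for choosing the graphs. Its argument is the list of all configurations observed
so far (the most recent first), at the end of the initialization and of each of the updates:
`σ []` is the initial graph, and `σ h` the graph after `h.length` batches. -/
abbrev Strategy : Type := List A.Config → SimpleGraph (Fin n)

/-- Every batch that `σ` issues has at most `ℓ` edge updates. -/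
def IsStrategy (ℓ : ℕ) (σ : A.Strategy) : Prop :=
  ∀ (c : A.Config) (h : List A.Config), IsBatch ℓ (σ h) (σ (c :: h))

/-- The situation after the initialization or after an update. -/
structure Stage where
  /-- the vertex partition -/
  part : Partition n k
  /-- the current configuration -/
  conf : A.Config
  /-- the earlier configurations (the most recent first) that the adversary has observed -/
  past : List A.Config

/-- The outputs form a maximal matching of the current graph. -/
def Good (σ : A.Strategy) (s : A.Stage) : Prop :=
  OutputsMaximalMatching (σ s.past) s.part (fun i => A.output i (s.conf i))

/-- The next batch arrives and the algorithm performs its update. -/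
noncomputable def step (T : ℕ) (σ : A.Strategy) (s : A.Stage) : PMF A.Stage :=
  (A.update T (σ (s.conf :: s.past)) s.part s.conf).map
    fun c => ⟨s.part, c, s.conf :: s.past⟩

/-- The law of the situation after `t` batches, for a vertex partition with law `π`. -/
noncomputable def run (T : ℕ) (π : PMF (Partition n k)) (σ : A.Strategy) : ℕ → PMF A.Stage
  | 0 => π.bind fun P => (A.initial (σ []) P).map fun c => ⟨P, c, []⟩
  | t + 1 => (run T π σ t).bind (A.step T σ)

/-- The joint law of the situations after `t` and after `t + 1` batches. -/
noncomputable def runPair (T : ℕ) (π : PMF (Partition n k)) (σ : A.Strategy) (t : ℕ) :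
    PMF (A.Stage × A.Stage) :=
  (A.run T π σ t).bind fun s => (A.step T σ s).map fun s' => (s, s')

/-- With probability at least `1 - ε` the algorithm initially constructs a maximal matching and,
after each batch, conditioned on the outputs having formed a maximal matching of the graph prior
to this batch, with probability at least `1 - ε` the outputs form a maximal matching of the new
graph after `T` rounds. (A player that finishes earlier idles.) -/
def Maintains (T : ℕ) (ε : ℝ) (π : PMF (Partition n k)) (σ : A.Strategy) : Prop :=
  1 - ε ≤ prob (A.run T π σ 0) (A.Good σ) ∧
  ∀ t, (1 - ε) * prob (A.run T π σ t) (A.Good σ) ≤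
    prob (A.runPair T π σ t) (fun s => A.Good σ s.1 ∧ A.Good σ s.2)

/-- Update time `T` with error probability `ε` against the oblivious adversary: uniformly random
vertex partition, and the sequence of graphs is fixed in advance. -/
def UpdatesOblivious [NeZero k] (T ℓ : ℕ) (ε : ℝ) : Prop :=
  ∀ G : ℕ → SimpleGraph (Fin n), (∀ t, IsBatch ℓ (G t) (G (t + 1))) →
    A.Maintains T ε (PMF.uniformOfFintype (Partition n k)) (fun h => G h.length)

/-- Update time `T` with error probability `ε` against the adaptive adversary: it fixes any
balanced vertex partition and observes the local memory of all players before each batch. -/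
def UpdatesAdaptive (T ℓ : ℕ) (ε lo hi : ℝ) : Prop :=
  ∀ P : Partition n k, Balanced lo hi P → ∀ σ : A.Strategy, A.IsStrategy ℓ σ →
    A.Maintains T ε (PMF.pure P) σ

end Algorithm

/-- The parameter range: bandwidth parameter `β ≥ 1`, number of players between
`κ * log ^ 4 n` and `√n / log n`, and batch size at most `n / (2 * k)`. -/
def Admissible (κ : ℝ) (n k β ℓ : ℕ) : Prop :=
  1 ≤ β ∧ κ * Real.log n ^ 4 ≤ (k : ℝ) ∧ (k : ℝ) ≤ Real.sqrt n / Real.log n ∧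
    (ℓ : ℝ) ≤ (n : ℝ) / (2 * k)

end KClique

/-!
Both bounds rest on the same gadget: a path `u – a – b`. A maximal matching matches `a` to exactly
one of the leaves `u` and `b` as long as an edge of the gadget is present
(`OutputsMaximalMatching.gadget`), so the hosts of `u` and `b` must agree on which one it is; if
one of the edges is deleted, the other one must be matched, and the deletion is seen only by the
hosts of its endpoints. Since an algorithm is tested against a known finite distribution of
inputs, its coins can be fixed without decreasing the number of inputs on which it succeeds
(`Algorithm.exists_fixed_success`). The state of a player then is a function of what it saw of the
input and of the messages it received, and each player receives at most `(B + 1) * (k - 1) * T`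
bits in an update.

*Adaptive adversary.* The partition can be chosen such that, in `ℓ` gadgets, all left leaves lie
with one player and all right leaves with another one. In each gadget a single batch deletes the
left edge, the right edge, or nothing. Given the messages of the two players, the set `Z` of
gadgets matched on the left is a function of the left deletions, and also of the right deletions.
It contains all right deletions and no left deletion. If `Z` is small, then for given left
deletions only `2 ^ |Z|` sets of right deletions are possible, and if `Z` is large, the complement
of `Z` is small. So the players succeed on few of the `3 ^ ℓ` inputs (`card_success_le`).

*Oblivious adversary.* There are `ℓ` rows and `s` columns of gadgets, `s` a small power of `k`. The
right leaf of each gadget is chosen at random from `s` vertices; column by column, one batch each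
inserts the right edges. A last batch deletes, in each row, one of the two edges of one random
gadget. Under a random partition almost all gadgets are good, that is, their vertices and potential
right leaves have different hosts. The point is that the host of the left leaf knows little about
where the right leaf is.

Colour the players at random with `2 ^ l` colours. The players of colour `0` are so few that all
their late messages fit into a small part of `ℓ` bits, and in a good gadget the left host cannot
arrange that the right host avoids the colour `0`. So the outputs that the left host `i` gives for
its gadgets are sampled by the players of colour `0` at positions unpredictable to `i`, while these
outputs are one of few possible sequences, as they are determined by the late messages and by the
few deletions that `i` sees. Weighted majority prediction of the outputs from the samples
makes few mistakes on the samples, hence, by a supermartingale inequality, few mistakes at all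
(`pow_mistakes_le_potential`, `Execution.card_wrong_guesses_le`). The exceptions are the gadgets
where the early messages have told `i` too much about the right leaf; they are few by the chain rule
for the entropy and Chebyshev's inequality (`sum_card_skewed_le`). So, outside few excluded gadgets,
the outputs after the deletions are predicted by what the players of colour `0` know, and these
see none of the deletions there.

Consider a deletion pattern on which the algorithm succeeds. If the prediction is wrong in few of
the selected gadgets, then the columns and a short code determine the pattern, which saves a
constant fraction of a bit per row (`card_few_surprises_le`). Otherwise many rows select one of the few
gadgets where the prediction is wrong. For a suitable set `W` of players, a constant fraction
of these rows is such that `W` determines the output of the gadget, but sees nothing of the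
deletion. So the wrongly predicted gadgets are known without the selection in these rows, which
saves a constant fraction of `log₂ s` bits in each of them (`card_many_surprises_le`). In both cases
there are few such patterns (`Execution.sum_card_success_lt`).
-/

set_option linter.unusedSectionVars false

namespace KClique

open scoped ENNReal

/-! ### Expectations and fixing the coins -/

/-- The expectation of a nonnegative function under a discrete law. -/
noncomputable def ev {α : Type} (p : PMF α) (f : α → ℝ≥0∞) : ℝ≥0∞ := ∑' x, p x * f x

section Expectation

variable {α β : Type}

theorem ev_pure (a : α) (f : α → ℝ≥0∞) : ev (PMF.pure a) f = f a := by
  unfold ev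
  rw [tsum_eq_single a]
  · simp
  · intro b hb
    simp [PMF.pure_apply, hb]

theorem ev_bind (p : PMF α) (q : α → PMF β) (f : β → ℝ≥0∞) :
    ev (p.bind q) f = ev p fun a => ev (q a) f := by
  simp only [ev, PMF.bind_apply, ← ENNReal.tsum_mul_right, ← ENNReal.tsum_mul_left]
  rw [ENNReal.tsum_comm]
  simp only [mul_assoc]

theorem ev_map (p : PMF α) (g : α → β) (f : β → ℝ≥0∞) :
    ev (p.map g) f = ev p fun a => f (g a) := by
  rw [← PMF.bind_pure_comp, ev_bind]
  simp [ev_pure]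

theorem ev_mono (p : PMF α) {f g : α → ℝ≥0∞} (h : ∀ x, f x ≤ g x) : ev p f ≤ ev p g :=
  ENNReal.tsum_le_tsum fun x => mul_le_mul' le_rfl (h x)

theorem ev_le_one (p : PMF α) {f : α → ℝ≥0∞} (h : ∀ x, f x ≤ 1) : ev p f ≤ 1 := by
  calc ev p f ≤ ev p fun _ => 1 := ev_mono p h
    _ = 1 := by simp [ev, PMF.tsum_coe]

theorem ev_sum {Ω : Type} (s : Finset Ω) (p : PMF α) (f : Ω → α → ℝ≥0∞) :
    ev p (fun x => ∑ ω ∈ s, f ω x) = ∑ ω ∈ s, ev p (f ω) := by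
  simp only [ev, Finset.mul_sum]
  exact Summable.tsum_finsetSum fun _ _ => ENNReal.summable

/-- Some outcome is at least as good as the average. -/
theorem exists_ev_le (p : PMF α) (f : α → ℝ≥0∞) {C : ℝ≥0∞} (hC : C ≠ ⊤) (hf : ∀ x, f x ≤ C) :
    ∃ x, ev p f ≤ f x := by
  by_contra! h
  obtain ⟨i, hi⟩ := p.support_nonempty
  have hi' : p i ≠ 0 := (PMF.mem_support_iff p i).1 hi
  have hE : ev p f ≤ C := by
    calc ev p f ≤ ev p fun _ => C := ev_mono p hf
      _ = C := by simp [ev, ENNReal.tsum_mul_right, PMF.tsum_coe]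
  have hE' : ev p f ≠ ⊤ := ne_top_of_le_ne_top hC hE
  have : ev p f < ∑' x, p x * ev p f := by
    refine ENNReal.tsum_lt_tsum (i := i) hE' (fun x => mul_le_mul' le_rfl (h x).le) ?_
    exact ENNReal.mul_lt_mul_right hi' (PMF.apply_ne_top p i) (h i)
  rw [ENNReal.tsum_mul_right, PMF.tsum_coe, one_mul] at this
  exact lt_irrefl _ this

theorem ev_indep_succ {k : ℕ} (p : Fin (k + 1) → PMF α) (V : (Fin (k + 1) → α) → ℝ≥0∞) :
    ev (indep p) V = ev (p 0) fun x => ev (indep fun i => p i.succ) fun f => V (Fin.cons x f) := by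
  unfold ev
  rw [← (Fin.consEquiv (fun _ : Fin (k + 1) => α)).tsum_eq, ENNReal.tsum_prod']
  refine tsum_congr fun x => ?_
  rw [← ENNReal.tsum_mul_left]
  refine tsum_congr fun f => ?_
  change (∏ i, p i ((Fin.cons x f : Fin (k + 1) → α) i)) * _ = _ * ((∏ i, p i.succ (f i)) * _)
  simp [Fin.prod_univ_succ, mul_assoc, Fin.consEquiv]

end Expectation

/-- Among the outcomes of a coin there is one for every class of a partition of `Ω` such that
these outcomes do at least as well, on average over `Ω`, as the coin. -/
theorem exists_choice {Ω α : Type} [Fintype Ω] (p : Ω → PMF α) (f : Ω → α → ℝ≥0∞)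
    (hf : ∀ ω x, f ω x ≤ 1) :
    ∃ g : Ω → α, (∀ ω ω', p ω = p ω' → g ω = g ω') ∧
      ∑ ω, ev (p ω) (f ω) ≤ ∑ ω, f ω (g ω) := by
  classical
  have key : ∀ a : PMF α, ∃ x, ev a (fun y => ∑ ω with p ω = a, f ω y) ≤ ∑ ω with p ω = a, f ω x :=
    fun a => exists_ev_le a _ (C := ∑ ω with p ω = a, 1) (by simp)
      (fun x => Finset.sum_le_sum fun ω _ => hf ω x)
  choose g hg using key
  refine ⟨fun ω => g (p ω), fun ω ω' h => congrArg g h, ?_⟩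
  rw [← Finset.sum_fiberwise_of_maps_to (g := p) (t := Finset.univ.image p) (by simp),
    ← Finset.sum_fiberwise_of_maps_to (s := Finset.univ) (g := p) (t := Finset.univ.image p)
      (f := fun ω => f ω (g (p ω))) (by simp)]
  refine Finset.sum_le_sum fun a _ => ?_
  calc ∑ ω with p ω = a, ev (p ω) (f ω) = ∑ ω with p ω = a, ev a (f ω) :=
        Finset.sum_congr rfl fun ω h => by rw [(Finset.mem_filter.1 h).2]
    _ ≤ ∑ ω with p ω = a, f ω (g a) := by rw [← ev_sum]; exact hg a
    _ = ∑ ω with p ω = a, f ω (g (p ω)) :=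
        Finset.sum_congr rfl fun ω h => by rw [(Finset.mem_filter.1 h).2]

/-- Private coins can be fixed: one outcome for each player and each of its laws. -/
theorem exists_choice_indep {Ω α : Type} [Fintype Ω] : ∀ {k : ℕ} (p : Ω → Fin k → PMF α)
    (V : Ω → (Fin k → α) → ℝ≥0∞), (∀ ω x, V ω x ≤ 1) →
    ∃ g : Ω → Fin k → α, (∀ i ω ω', p ω i = p ω' i → g ω i = g ω' i) ∧
      ∑ ω, ev (indep (p ω)) (V ω) ≤ ∑ ω, V ω (g ω)
  | 0, p, V, hV => by
    refine ⟨fun _ => Fin.elim0, fun i => i.elim0, Finset.sum_le_sum fun ω _ => ?_⟩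
    obtain ⟨x, hx⟩ := exists_ev_le (indep (p ω)) (V ω) ENNReal.one_ne_top (hV ω)
    rwa [Subsingleton.elim x Fin.elim0] at hx
  | k + 1, p, V, hV => by
    obtain ⟨g₀, hg₀, h₀⟩ := exists_choice (fun ω => p ω 0)
      (fun ω x => ev (indep fun i => p ω i.succ) fun f => V ω (Fin.cons x f))
      (fun ω x => ev_le_one _ fun f => hV ω _)
    obtain ⟨g₁, hg₁, h₁⟩ := exists_choice_indep (fun ω (i : Fin k) => p ω i.succ)
      (fun ω f => V ω (Fin.cons (g₀ ω) f)) (fun ω f => hV ω _)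
    refine ⟨fun ω => Fin.cons (g₀ ω) (g₁ ω), fun i ω ω' h => ?_, ?_⟩
    · refine Fin.cases (fun h => ?_) (fun i h => ?_) i h
      · simpa using hg₀ ω ω' h
      · simpa using hg₁ i ω ω' h
    · simp only [ev_indep_succ]
      exact h₀.trans h₁

namespace Algorithm

variable {n k B : ℕ} (A : Algorithm n k B)

/-- The messages that player `i` receives in a round that starts in configuration `c`. -/
def received (c : A.Config) (i : Fin k) : {j : Fin k // j ≠ i} → Message B :=
  fun j => A.msg j.1 (c j.1) ⟨i, j.2.symm⟩

/-- All messages that player `i` receives in `T` rounds. -/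
abbrev Transcript (k B T : ℕ) (i : Fin k) : Type :=
  Fin T → {j : Fin k // j ≠ i} → Message B

/-- All coins of one local computation can be fixed. -/
theorem exists_fixed_step {Ω : Type} [Fintype Ω]
    (K : Ω → Fin k → A.Shared → PMF A.State) (V : Ω → A.Config → ℝ≥0∞) (hV : ∀ ω c, V ω c ≤ 1) :
    ∃ c' : Ω → A.Config, (∀ i ω ω', K ω i = K ω' i → c' ω i = c' ω' i) ∧
      ∑ ω, ev (A.shared.bind fun w => indep fun i => K ω i w) (V ω) ≤ ∑ ω, V ω (c' ω) := by
  -- the public coins are fixed to one outcome for all inputs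
  obtain ⟨w, hw⟩ := exists_ev_le A.shared
    (fun w => ∑ ω, ev (indep fun i => K ω i w) (V ω)) (C := ∑ _ω : Ω, 1) (by simp)
    (fun w => Finset.sum_le_sum fun ω _ => ev_le_one _ (hV ω))
  obtain ⟨c', hc', h⟩ := exists_choice_indep (fun ω i => K ω i w) V hV
  refine ⟨c', fun i ω ω' h => hc' i ω ω' (by rw [h]), ?_⟩
  simp only [ev_bind]
  rw [← ev_sum]
  exact hw.trans h

/-- All coins of `T` rounds can be fixed; `m ω i` are the messages that player `i` receives. -/
theorem exists_fixed_rounds {Ω : Type} [Fintype Ω] (T : ℕ) : ∀ (c : Ω → A.Config)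
    (V : Ω → A.Config → ℝ≥0∞), (∀ ω c, V ω c ≤ 1) →
    ∃ (c' : Ω → A.Config) (m : Ω → (i : Fin k) → Transcript k B T i),
      (∀ i ω ω', c ω i = c ω' i → m ω i = m ω' i → c' ω i = c' ω' i) ∧
      (∀ ω ω', c ω = c ω' → m ω = m ω') ∧
      ∑ ω, ev (A.rounds T (c ω)) (V ω) ≤ ∑ ω, V ω (c' ω) := by
  induction T with
  | zero =>
    intro c V _
    exact ⟨c, fun _ _ => Fin.elim0, fun i ω ω' h _ => h, fun _ _ _ => rfl,
      by simp [rounds, ev_pure]⟩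
  | succ T ih =>
    intro c V hV
    obtain ⟨c₁, hc₁, h₁⟩ := A.exists_fixed_step
      (fun ω i => A.next i (c ω i) (A.received (c ω) i))
      (fun ω c => ev (A.rounds T c) (V ω)) (fun ω c => ev_le_one _ (hV ω))
    obtain ⟨c', m, hm, hm', h₂⟩ := ih c₁ V hV
    refine ⟨c', fun ω i => Fin.cons (A.received (c ω) i) (m ω i), fun i ω ω' h h' => ?_,
      fun ω ω' h => ?_, ?_⟩
    · obtain ⟨h3, h4⟩ := Fin.cons_inj.1 h'
      exact hm i ω ω' (hc₁ i ω ω' (by simp only [h, h3])) h4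
    · have h3 : c₁ ω = c₁ ω' := funext fun i => hc₁ i ω ω' (by simp only [h])
      simp only [h, hm' ω ω' h3]
    · refine le_trans (le_of_eq ?_) (h₁.trans h₂)
      refine Finset.sum_congr rfl fun ω _ => ?_
      rw [rounds, ev_bind]
      rfl

/-- All coins of an update can be fixed. Afterwards the memory of a player is determined by its
previous memory, its new local input and the messages that it receives. -/
theorem exists_fixed_update {Ω : Type} [Fintype Ω] (T : ℕ) (G : Ω → SimpleGraph (Fin n))
    (P : Partition n k) (c : Ω → A.Config) (V : Ω → A.Config → ℝ≥0∞) (hV : ∀ ω c, V ω c ≤ 1) :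
    ∃ (c' : Ω → A.Config) (m : Ω → (i : Fin k) → Transcript k B T i),
      (∀ i ω ω', c ω i = c ω' i → localInput (G ω) P i = localInput (G ω') P i →
        m ω i = m ω' i → c' ω i = c' ω' i) ∧
      (∀ ω ω', c ω = c ω' → G ω = G ω' → m ω = m ω') ∧
      ∑ ω, ev (A.update T (G ω) P (c ω)) (V ω) ≤ ∑ ω, V ω (c' ω) := by
  obtain ⟨c₁, hc₁, h₁⟩ := A.exists_fixed_step
    (fun ω i => A.learn i (c ω i) (localInput (G ω) P i))
    (fun ω c => ev (A.rounds T c) (V ω)) (fun ω c => ev_le_one _ (hV ω))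
  obtain ⟨c', m, hm, hm', h₂⟩ := A.exists_fixed_rounds T c₁ V hV
  refine ⟨c', m, fun i ω ω' h h' h'' => hm i ω ω' (hc₁ i ω ω' (by simp only [h, h'])) h'',
    fun ω ω' h h' => hm' ω ω' (funext fun i => hc₁ i ω ω' (by simp only [h, h'])), ?_⟩
  refine le_trans (le_of_eq ?_) (h₁.trans h₂)
  refine Finset.sum_congr rfl fun ω _ => ?_
  rw [update, ev_bind]

/-- The law of the configuration after `t` batches, for a fixed partition and a fixed sequence
of graphs. -/
noncomputable def confLaw (T : ℕ) (P : Partition n k) (G : ℕ → SimpleGraph (Fin n)) :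
    ℕ → PMF A.Config
  | 0 => A.initial (G 0) P
  | t + 1 => (confLaw T P G t).bind (A.update T (G (t + 1)) P)

/-- Derandomization: for finitely many sequences of graphs with the same initial graph, all coins
can be fixed. Afterwards the memory of a player is determined by its local inputs and by the
messages `m ω τ i` that it received during the updates `τ`, and these messages do not depend on
later batches. -/
theorem exists_fixed_run {Ω : Type} [Fintype Ω] (T : ℕ) (P : Partition n k)
    (G : Ω → ℕ → SimpleGraph (Fin n)) (G₀ : SimpleGraph (Fin n)) (hG : ∀ ω, G ω 0 = G₀) (t : ℕ) :
    ∀ (V : Ω → A.Config → ℝ≥0∞), (∀ ω c, V ω c ≤ 1) →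
    ∃ (c : Ω → A.Config) (m : Ω → ℕ → (i : Fin k) → Transcript k B T i),
      (∀ i ω ω',
        (∀ τ < t, localInput (G ω (τ + 1)) P i = localInput (G ω' (τ + 1)) P i) →
        (∀ τ < t, m ω τ i = m ω' τ i) → c ω i = c ω' i) ∧
      (∀ ω ω', ∀ τ < t, (∀ τ' ≤ τ, G ω (τ' + 1) = G ω' (τ' + 1)) → m ω τ = m ω' τ) ∧
      ∑ ω, ev (A.confLaw T P (G ω) t) (V ω) ≤ ∑ ω, V ω (c ω) := by
  induction t with
  | zero =>
    intro V hV
    obtain ⟨c, hc⟩ := exists_ev_le (A.initial G₀ P) (fun c => ∑ ω, V ω c) (C := ∑ _ω : Ω, 1)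
      (by simp) (fun c => Finset.sum_le_sum fun ω _ => hV ω c)
    refine ⟨fun _ => c, fun _ _ _ _ _ => ⟨[], Nat.zero_le _⟩, fun _ _ _ _ _ => rfl,
      fun _ _ _ _ _ => rfl, ?_⟩
    simpa [confLaw, hG, ev_sum] using hc
  | succ t ih =>
    intro V hV
    obtain ⟨c₁, m₁, hc₁, hm₁, h₁⟩ := ih
      (fun ω c => ev (A.update T (G ω (t + 1)) P c) (V ω)) (fun ω c => ev_le_one _ (hV ω))
    obtain ⟨c', m, hm, hm', h₂⟩ := A.exists_fixed_update T (fun ω => G ω (t + 1)) P c₁ V hV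
    refine ⟨c', fun ω τ i => if τ = t then m ω i else m₁ ω τ i, fun i ω ω' h h' => ?_,
      fun ω ω' τ hτ h => ?_, ?_⟩
    · refine hm i ω ω' (hc₁ i ω ω' (fun τ hτ => h τ (by omega)) fun τ hτ => ?_)
        (h t (by omega)) (by simpa using h' t (by omega))
      simpa [hτ.ne] using h' τ (by omega)
    · rcases Nat.lt_succ_iff_lt_or_eq.1 hτ with hτ | rfl
      · simp only [hτ.ne, if_false]
        exact hm₁ ω ω' τ hτ h
      · simp only [if_true]
        exact hm' ω ω' (funext fun i => hc₁ i ω ω' (fun τ' hτ' => by rw [h τ' hτ'.le])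
          fun τ' hτ' => by rw [hm₁ ω ω' τ' hτ' fun τ'' h'' => h τ'' (h''.trans hτ'.le)])
          (h τ le_rfl)
    · simp only [confLaw, ev_bind]
      exact h₁.trans h₂

/-! ### The success probability after several batches -/

theorem prob_eq_ev {α : Type} (p : PMF α) (E : α → Prop) :
    p.toOuterMeasure {a | E a} = ev p ({a | E a}.indicator 1) := by
  rw [PMF.toOuterMeasure_apply, ev]
  refine tsum_congr fun x => ?_
  by_cases h : E x <;> simp [h]

theorem indicator_le_one {α : Type} (s : Set α) (x : α) : s.indicator (1 : α → ℝ≥0∞) x ≤ 1 := by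
  by_cases h : x ∈ s <;> simp [h]

theorem ev_run_oblivious (T : ℕ) (π : PMF (Partition n k)) (G : ℕ → SimpleGraph (Fin n)) (t : ℕ) :
    ∀ (V : Partition n k → A.Config → ℕ → ℝ≥0∞),
    ev (A.run T π (fun h => G h.length) t) (fun s => V s.part s.conf s.past.length) =
      ev π fun P => ev (A.confLaw T P G t) fun c => V P c t := by
  induction t with
  | zero =>
    intro V
    simp [run, confLaw, ev_bind, ev_map]
  | succ t ih =>
    intro V
    simp only [run, confLaw, ev_bind, step, ev_map, List.length_cons]
    exact ih (fun P c l => ev (A.update T (G (l + 1)) P c) fun c => V P c (l + 1))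

theorem prob_good_succ_ge {T : ℕ} {ε : ℝ} {π : PMF (Partition n k)} {σ : A.Strategy}
    (h : A.Maintains T ε π σ) (t : ℕ) :
    (1 - ε) * prob (A.run T π σ t) (A.Good σ) ≤ prob (A.run T π σ (t + 1)) (A.Good σ) := by
  refine (h.2 t).trans (ENNReal.toReal_mono ?_ ?_)
  · rw [prob_eq_ev]
    exact ne_top_of_le_ne_top ENNReal.one_ne_top (ev_le_one _ (indicator_le_one _))
  · rw [prob_eq_ev, prob_eq_ev, runPair, run, ev_bind, ev_bind]
    refine ev_mono _ fun s => ?_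
    rw [ev_map]
    refine ev_mono _ fun s' => ?_
    by_cases h1 : A.Good σ s <;> by_cases h2 : A.Good σ s' <;> simp [h1, h2]

theorem prob_good_ge {T : ℕ} {ε : ℝ} (hε : ε ≤ 1) {π : PMF (Partition n k)} {σ : A.Strategy}
    (h : A.Maintains T ε π σ) (t : ℕ) :
    1 - (t + 1) * ε ≤ prob (A.run T π σ t) (A.Good σ) := by
  have key : (1 - ε) ^ (t + 1) ≤ prob (A.run T π σ t) (A.Good σ) := by
    induction t with
    | zero => simpa using h.1
    | succ t ih =>
      calc (1 - ε) ^ (t + 1 + 1) = (1 - ε) * (1 - ε) ^ (t + 1) := by ring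
        _ ≤ (1 - ε) * prob (A.run T π σ t) (A.Good σ) :=
          mul_le_mul_of_nonneg_left ih (by linarith)
        _ ≤ _ := A.prob_good_succ_ge h t
  refine le_trans ?_ key
  have := one_add_mul_le_pow (a := -ε) (by linarith) (t + 1)
  push_cast at this
  rw [show 1 - ε = 1 + -ε by ring]
  linarith

/-- The probability that, after `t` batches, the outputs form a maximal matching. -/
noncomputable def successProb (T : ℕ) (P : Partition n k) (G : ℕ → SimpleGraph (Fin n)) (t : ℕ) :
    ℝ≥0∞ :=
  ev (A.confLaw T P G t)
    ({c | OutputsMaximalMatching (G t) P fun i => A.output i (c i)}.indicator 1)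

theorem successProb_le_one (T : ℕ) (P : Partition n k) (G : ℕ → SimpleGraph (Fin n)) (t : ℕ) :
    A.successProb T P G t ≤ 1 := ev_le_one _ (indicator_le_one _)

theorem ev_successProb_ge {T : ℕ} {ε : ℝ} (hε : ε ≤ 1) {π : PMF (Partition n k)}
    {G : ℕ → SimpleGraph (Fin n)} (h : A.Maintains T ε π fun h => G h.length) (t : ℕ) :
    ENNReal.ofReal (1 - (t + 1) * ε) ≤ ev π fun P => A.successProb T P G t := by
  have h1 := A.prob_good_ge hε h t
  rw [prob] at h1
  rw [ENNReal.ofReal_le_iff_le_toReal]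
  · refine h1.trans (le_of_eq ?_)
    congr 1
    rw [prob_eq_ev]
    exact A.ev_run_oblivious T π G t fun P c l =>
      {c | OutputsMaximalMatching (G l) P fun i => A.output i (c i)}.indicator 1 c
  · exact ne_top_of_le_ne_top ENNReal.one_ne_top
      (ev_le_one _ fun P => A.successProb_le_one T P G t)

open Classical in
/-- Derandomization, counting form: the number of inputs on which the derandomized algorithm
succeeds is at least the sum of the success probabilities. -/
theorem exists_fixed_success {Ω : Type} [Fintype Ω] (T : ℕ) (P : Partition n k)
    (G : Ω → ℕ → SimpleGraph (Fin n)) (G₀ : SimpleGraph (Fin n)) (hG : ∀ ω, G ω 0 = G₀) (t : ℕ) :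
    ∃ (c : Ω → A.Config) (m : Ω → ℕ → (i : Fin k) → Transcript k B T i),
      (∀ i ω ω',
        (∀ τ < t, localInput (G ω (τ + 1)) P i = localInput (G ω' (τ + 1)) P i) →
        (∀ τ < t, m ω τ i = m ω' τ i) → c ω i = c ω' i) ∧
      (∀ ω ω', ∀ τ < t, (∀ τ' ≤ τ, G ω (τ' + 1) = G ω' (τ' + 1)) → m ω τ = m ω' τ) ∧
      ∑ ω, A.successProb T P (G ω) t ≤
        (Finset.univ.filter fun ω =>
          OutputsMaximalMatching (G ω t) P fun i => A.output i (c ω i)).card := by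
  obtain ⟨c, m, h1, h1', h2⟩ := A.exists_fixed_run T P G G₀ hG t
    (fun ω => {c | OutputsMaximalMatching (G ω t) P fun i => A.output i (c i)}.indicator 1)
    (fun ω c => indicator_le_one _ c)
  refine ⟨c, m, h1, h1', h2.trans (le_of_eq ?_)⟩
  rw [Finset.card_filter]
  push_cast
  refine Finset.sum_congr rfl fun ω _ => ?_
  by_cases h : OutputsMaximalMatching (G ω t) P fun i => A.output i (c ω i) <;> simp [h]

instance (B : ℕ) : Finite (Message B) := by
  have : Message B = {m : List Bool // m.length ≤ B} := rfl
  exact (List.finite_length_le Bool B).to_subtype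

theorem card_message_le (B : ℕ) : Nat.card (Message B) ≤ 2 ^ (B + 1) := by
  have hs : Function.Surjective
      fun x : (i : Fin (B + 1)) × (Fin i → Bool) => (⟨List.ofFn x.2, by
        simpa using Nat.le_of_lt_succ x.1.2⟩ : Message B) := fun m =>
    ⟨⟨⟨m.1.length, Nat.lt_succ_of_le m.2⟩, m.1.get⟩, Subtype.ext (by simp)⟩
  refine (Nat.card_le_card_of_surjective _ hs).trans ?_
  rw [Nat.card_eq_fintype_card, Fintype.card_sigma]
  simp only [Fintype.card_fun, Fintype.card_bool, Fintype.card_fin]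
  rw [Fin.sum_univ_eq_sum_range fun i => 2 ^ i]
  have : ∀ N : ℕ, ∑ i ∈ Finset.range N, 2 ^ i + 1 = 2 ^ N := fun N => by
    induction N with
    | zero => simp
    | succ N ih => rw [Finset.sum_range_succ, pow_succ]; omega
  have := this (B + 1)
  omega

theorem card_transcript_le (k B T : ℕ) (i : Fin k) :
    Nat.card (Transcript k B T i) ≤ 2 ^ ((B + 1) * (k - 1) * T) := by
  classical
  rw [Nat.card_fun, Nat.card_fun]
  have h1 : Nat.card {j : Fin k // j ≠ i} = k - 1 := by
    rw [Nat.card_eq_fintype_card, Fintype.card_subtype_compl]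
    simp
  rw [h1, Nat.card_fin, ← pow_mul]
  calc _ ≤ (2 ^ (B + 1)) ^ ((k - 1) * T) := Nat.pow_le_pow_left (card_message_le B) _
    _ = _ := by rw [← pow_mul, mul_assoc]

end Algorithm

/-! ### Gadget graphs -/

section Gadget

variable {n k : ℕ} {Γ X : Type}

/-- The vertices of the gadgets: a gadget `g` has a left leaf `e (g, none)`, a centre
`e (g, some none)` and a pool of potential right leaves `e (g, some (some x))`. -/
abbrev GadgetVertices (n : ℕ) (Γ X : Type) : Type := Γ × Option (Option X) ↪ Fin n

namespace GadgetVertices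

variable (e : GadgetVertices n Γ X)

/-- The left leaf of a gadget. -/
def left (g : Γ) : Fin n := e (g, none)

/-- The centre of a gadget. -/
def center (g : Γ) : Fin n := e (g, some none)

/-- The potential right leaves of a gadget. -/
def right (g : Γ) (x : X) : Fin n := e (g, some (some x))

/-- The graph in which the centre of `g` is adjacent to its left leaf if `L g`, and to the right
leaf `x` if `R g x`. -/
def graph (L : Γ → Prop) (R : Γ → X → Prop) : SimpleGraph (Fin n) :=
  SimpleGraph.fromEdgeSet ({d | ∃ g, L g ∧ d = s(e.left g, e.center g)} ∪
    {d | ∃ g x, R g x ∧ d = s(e.center g, e.right g x)})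

variable {e} {L L' : Γ → Prop} {R R' : Γ → X → Prop}

theorem graph_adj {v w : Fin n} : (e.graph L R).Adj v w ↔
    (∃ g, L g ∧ s(v, w) = s(e.left g, e.center g)) ∨
      ∃ g x, R g x ∧ s(v, w) = s(e.center g, e.right g x) := by
  rw [graph, SimpleGraph.fromEdgeSet_adj]
  refine ⟨fun h => h.1, fun h => ⟨h, ?_⟩⟩
  rintro rfl
  rcases h with ⟨g, -, h⟩ | ⟨g, x, -, h⟩ <;>
  · simp only [Sym2.eq_iff, left, center, right] at h
    rcases h with ⟨h1, h2⟩ | ⟨h1, h2⟩ <;> simpa using e.injective (h1.symm.trans h2)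

theorem mem_edgeSet_graph {d : Sym2 (Fin n)} : d ∈ (e.graph L R).edgeSet ↔
    (∃ g, L g ∧ d = s(e.left g, e.center g)) ∨
      ∃ g x, R g x ∧ d = s(e.center g, e.right g x) := by
  induction d with | _ v w => rw [SimpleGraph.mem_edgeSet, graph_adj]

theorem graph_adj_left {g : Γ} {w : Fin n} :
    (e.graph L R).Adj (e.left g) w ↔ L g ∧ w = e.center g := by
  rw [graph_adj]
  simp only [Sym2.eq_iff, left, center, right, e.injective.eq_iff]
  constructor
  · rintro (⟨g', h, h1 | h1⟩ | ⟨g', x, h, h1 | h1⟩) <;> simp_all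
  · rintro ⟨h, rfl⟩
    exact Or.inl ⟨g, h, by simp⟩

theorem graph_adj_right {g : Γ} {x : X} {w : Fin n} :
    (e.graph L R).Adj (e.right g x) w ↔ R g x ∧ w = e.center g := by
  rw [graph_adj]
  simp only [Sym2.eq_iff, left, center, right, e.injective.eq_iff]
  constructor
  · rintro (⟨g', h, h1 | h1⟩ | ⟨g', x, h, h1 | h1⟩) <;> simp_all
  · rintro ⟨h, rfl⟩
    exact Or.inr ⟨g, x, h, by simp⟩

theorem graph_adj_center {g : Γ} {w : Fin n} :
    (e.graph L R).Adj (e.center g) w ↔ (L g ∧ w = e.left g) ∨ ∃ x, R g x ∧ w = e.right g x := by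
  rw [graph_adj]
  simp only [Sym2.eq_iff, left, center, right, e.injective.eq_iff]
  constructor
  · rintro (⟨g', h, h1 | h1⟩ | ⟨g', x, h, h1 | h1⟩)
    · simp_all
    · simp_all
    · obtain ⟨h1, h2⟩ := h1
      simp only [Prod.mk.injEq, and_true] at h1
      subst h1
      exact Or.inr ⟨x, h, h2⟩
    · simp_all
  · rintro (⟨h, rfl⟩ | ⟨x, h, rfl⟩)
    · exact Or.inl ⟨g, h, by simp⟩
    · exact Or.inr ⟨g, x, h, by simp⟩

/-- A bound on the number of edges in which two gadget graphs differ. -/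
theorem isBatch_graph {ℓ : ℕ} (f : Fin ℓ → Sym2 (Fin n))
    (hL : ∀ g, ¬(L g ↔ L' g) → ∃ r, f r = s(e.left g, e.center g))
    (hR : ∀ g x, ¬(R g x ↔ R' g x) → ∃ r, f r = s(e.center g, e.right g x)) :
    IsBatch ℓ (e.graph L R) (e.graph L' R') := by
  have hsub : symmDiff (e.graph L R).edgeSet (e.graph L' R').edgeSet ⊆ Set.range f := by
    intro d hd
    rw [Set.mem_symmDiff, mem_edgeSet_graph, mem_edgeSet_graph] at hd
    by_contra hf
    have hL' : ∀ g, d = s(e.left g, e.center g) → (L g ↔ L' g) := fun g hg => by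
      by_contra h
      exact hf (hg ▸ hL g h)
    have hR' : ∀ g x, d = s(e.center g, e.right g x) → (R g x ↔ R' g x) := fun g x hg => by
      by_contra h
      exact hf (hg ▸ hR g x h)
    rcases hd with ⟨⟨g, h, h1⟩ | ⟨g, x, h, h1⟩, h2⟩ | ⟨⟨g, h, h1⟩ | ⟨g, x, h, h1⟩, h2⟩
    · exact h2 (Or.inl ⟨g, (hL' g h1).1 h, h1⟩)
    · exact h2 (Or.inr ⟨g, x, (hR' g x h1).1 h, h1⟩)
    · exact h2 (Or.inl ⟨g, (hL' g h1).2 h, h1⟩)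
    · exact h2 (Or.inr ⟨g, x, (hR' g x h1).2 h, h1⟩)
  calc (symmDiff (e.graph L R).edgeSet (e.graph L' R').edgeSet).ncard
      ≤ (Set.range f).ncard := Set.ncard_le_ncard hsub (Set.finite_range f)
    _ ≤ ℓ := by
      rw [← Set.image_univ]
      refine (Set.ncard_image_le Set.finite_univ).trans ?_
      simp [Set.ncard_univ]

/-- What a player sees of a gadget graph. -/
theorem localInput_graph_eq {P : Partition n k} {i : Fin k}
    (hL : ∀ g, P (e.left g) = i ∨ P (e.center g) = i → (L g ↔ L' g))
    (hR : ∀ g x, P (e.center g) = i ∨ P (e.right g x) = i → (R g x ↔ R' g x)) :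
    localInput (e.graph L R) P i = localInput (e.graph L' R') P i := by
  have key : ∀ v w, (P v = i ∧ (e.graph L R).Adj v w) ↔ (P v = i ∧ (e.graph L' R').Adj v w) := by
    intro v w
    refine and_congr_right fun hv => ?_
    rw [graph_adj, graph_adj]
    refine or_congr (exists_congr fun g => and_congr_left fun h => hL g ?_)
      (exists_congr fun g => exists_congr fun x => and_congr_left fun h => hR g x ?_)
    · rcases Sym2.eq_iff.1 h with ⟨rfl, -⟩ | ⟨rfl, -⟩ <;> simp [hv]
    · rcases Sym2.eq_iff.1 h with ⟨rfl, -⟩ | ⟨rfl, -⟩ <;> simp [hv]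
  unfold localInput
  congr 1
  funext v w
  classical exact if_congr (key v w) rfl rfl

end GadgetVertices

theorem mem_verts_of_maximal {V : Type} {G : SimpleGraph V} {M : G.Subgraph}
    (hM : Maximal SimpleGraph.Subgraph.IsMatching M) {v w : V} (h : G.Adj v w) :
    v ∈ M.verts ∨ w ∈ M.verts := by
  by_contra! hvw
  have hm : (M ⊔ G.subgraphOfAdj h).IsMatching := by
    refine hM.1.sup (SimpleGraph.Subgraph.IsMatching.subgraphOfAdj h) ?_
    rw [hM.1.support_eq_verts, (SimpleGraph.Subgraph.IsMatching.subgraphOfAdj h).support_eq_verts]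
    rw [Set.disjoint_right]
    intro x hx
    simp only [SimpleGraph.subgraphOfAdj_verts, Set.mem_insert_iff, Set.mem_singleton_iff] at hx
    rcases hx with rfl | rfl
    · exact hvw.1
    · exact hvw.2
  have hle := hM.2 hm le_sup_left
  exact hvw.1 (hle.1 (by simp))

/-- If at least one of the two edges of a gadget is present, then exactly one of its leaves is
matched, along an edge that is present. -/
theorem OutputsMaximalMatching.gadget {e : GadgetVertices n Γ X} {L : Γ → Prop}
    {R : Γ → X → Prop} {P : Partition n k} {out : Fin k → Set (Sym2 (Fin n))}
    (h : OutputsMaximalMatching (e.graph L R) P out) {g : Γ} {x : X}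
    (hx : ∀ y, R g y → y = x) (hon : L g ∨ R g x) :
    (s(e.left g, e.center g) ∈ out (P (e.left g)) ↔
      ¬s(e.center g, e.right g x) ∈ out (P (e.right g x))) ∧
    (s(e.left g, e.center g) ∈ out (P (e.left g)) → L g) ∧
    (s(e.center g, e.right g x) ∈ out (P (e.right g x)) → R g x) := by
  obtain ⟨M, hM, ho⟩ := h
  have h1 : s(e.left g, e.center g) ∈ out (P (e.left g)) ↔ M.Adj (e.center g) (e.left g) := by
    rw [ho, M.adj_comm]
    simp
  have h2 : s(e.center g, e.right g x) ∈ out (P (e.right g x)) ↔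
      M.Adj (e.center g) (e.right g x) := by
    rw [ho]
    simp
  have hne : e.left g ≠ e.right g x := by
    simp [GadgetVertices.left, GadgetVertices.right]
  rw [h1, h2]
  refine ⟨⟨fun ha hb => hne ?_, fun hb => ?_⟩, fun ha => ?_, fun hb => ?_⟩
  · obtain ⟨w, -, hw⟩ := hM.1 (M.edge_vert ha)
    exact (hw _ ha).trans (hw _ hb).symm
  · by_contra ha
    have hc : e.center g ∉ M.verts := fun hc => by
      obtain ⟨w, hw, -⟩ := hM.1 hc
      rcases GadgetVertices.graph_adj_center.1 (M.adj_sub hw) with ⟨-, rfl⟩ | ⟨y, hy, rfl⟩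
      · exact ha hw
      · exact hb (hx y hy ▸ hw)
    rcases hon with hl | hr
    · rcases mem_verts_of_maximal hM
        (GadgetVertices.graph_adj_center.2 (Or.inl ⟨hl, rfl⟩)) with h3 | h3
      · exact hc h3
      · obtain ⟨w, hw, -⟩ := hM.1 h3
        obtain ⟨-, rfl⟩ := GadgetVertices.graph_adj_left.1 (M.adj_sub hw)
        exact hc (M.edge_vert hw.symm)
    · rcases mem_verts_of_maximal hM
        (GadgetVertices.graph_adj_center.2 (Or.inr ⟨x, hr, rfl⟩)) with h3 | h3
      · exact hc h3
      · obtain ⟨w, hw, -⟩ := hM.1 h3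
        obtain ⟨-, rfl⟩ := GadgetVertices.graph_adj_right.1 (M.adj_sub hw)
        exact hc (M.edge_vert hw.symm)
  · exact (GadgetVertices.graph_adj_left.1 (M.adj_sub ha).symm).1
  · exact (GadgetVertices.graph_adj_right.1 (M.adj_sub hb).symm).1

end Gadget

/-! ### One batch against two players -/

/-- For given deletions on the side `b`, the set `Z` is determined, and the deletions on the other
side form a subset of it. -/
theorem card_le_of_small_side {q : ℕ} (S : Finset (Fin q → Option Bool))
    (Z : (Fin q → Option Bool) → Finset (Fin q)) (b : Bool)
    (hZ : ∀ ω ∈ S, ∀ g, ω g = some (!b) → g ∈ Z ω) (hc : ∀ ω ∈ S, (Z ω).card ≤ q / 2)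
    (hd : ∀ ω ∈ S, ∀ ω' ∈ S, (∀ g, ω g = some b ↔ ω' g = some b) → Z ω = Z ω') :
    S.card ≤ 2 ^ q * 2 ^ (q / 2) := by
  classical
  let f : (Fin q → Option Bool) → Finset (Fin q) := fun ω => {g | ω g = some b}
  have h1 : S.card ≤ 2 ^ (q / 2) * (S.image f).card := by
    refine Finset.card_le_mul_card_image S _ fun a ha => ?_
    obtain ⟨ω₀, hω₀, rfl⟩ := Finset.mem_image.1 ha
    have hf : ∀ ω, f ω = f ω₀ → ∀ g, ω g = some b ↔ ω₀ g = some b := fun ω h g => by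
      simpa [f] using Finset.ext_iff.1 h g
    calc _ ≤ ((Z ω₀).powerset).card := by
          refine Finset.card_le_card_of_injOn
            (fun ω => ({g | ω g = some (!b)} : Finset (Fin q))) ?_ ?_
          · intro ω hω
            obtain ⟨hω, hω'⟩ := Finset.mem_filter.1 hω
            rw [Finset.mem_coe, Finset.mem_powerset]
            intro g hg
            rw [← hd ω hω ω₀ hω₀ (hf ω hω')]
            exact hZ ω hω g (Finset.mem_filter.1 hg).2
          · intro ω hω ω' hω' h
            have h1 := hf ω (Finset.mem_filter.1 hω).2
            have h2 := hf ω' (Finset.mem_filter.1 hω').2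
            funext g
            have h3 : ω g = some (!b) ↔ ω' g = some (!b) := by
              simpa using Finset.ext_iff.1 h g
            have h4 := (h1 g).trans (h2 g).symm
            cases b <;> rcases h5 : ω g with _ | _ | _ <;> rcases h6 : ω' g with _ | _ | _ <;>
              simp_all
      _ ≤ 2 ^ (q / 2) := by
          rw [Finset.card_powerset]
          exact Nat.pow_le_pow_right (by norm_num) (hc ω₀ hω₀)
  calc S.card ≤ 2 ^ (q / 2) * (S.image f).card := h1
    _ ≤ 2 ^ (q / 2) * 2 ^ q := by
      refine Nat.mul_le_mul_left _ ((Finset.card_le_univ _).trans ?_)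
      simp
    _ = _ := mul_comm _ _

/-- Let `q` gadgets be distributed over two players. The inputs `ω` on which the players succeed
are few if the outputs `Z ω` (the gadgets whose left leaf is matched) are determined by the own
deletions and by one of few messages, separately for the left and for the right player. -/
theorem card_success_le {q : ℕ} {M₁ M₂ : Type} [Finite M₁] [Finite M₂]
    (S : Finset (Fin q → Option Bool)) (Z : (Fin q → Option Bool) → Finset (Fin q))
    (m₁ : (Fin q → Option Bool) → M₁) (m₂ : (Fin q → Option Bool) → M₂)
    (hZt : ∀ ω ∈ S, ∀ g, ω g = some true → g ∈ Z ω)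
    (hZf : ∀ ω ∈ S, ∀ g, ω g = some false → g ∉ Z ω)
    (h₁ : ∀ ω ∈ S, ∀ ω' ∈ S, m₁ ω = m₁ ω' → (∀ g, ω g = some false ↔ ω' g = some false) →
      Z ω = Z ω')
    (h₂ : ∀ ω ∈ S, ∀ ω' ∈ S, m₂ ω = m₂ ω' → (∀ g, ω g = some true ↔ ω' g = some true) →
      Z ω = Z ω') :
    S.card ≤ 2 * (2 ^ q * 2 ^ (q / 2)) * (Nat.card M₁ * Nat.card M₂) := by
  classical
  have := Fintype.ofFinite M₁
  have := Fintype.ofFinite M₂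
  have h3 : S.card ≤ 2 * (2 ^ q * 2 ^ (q / 2)) * (S.image fun ω => (m₁ ω, m₂ ω)).card := by
    refine Finset.card_le_mul_card_image S _ fun a _ => ?_
    set S' := {ω ∈ S | (m₁ ω, m₂ ω) = a} with hS'
    have hm : ∀ ω ∈ S', ω ∈ S ∧ m₁ ω = a.1 ∧ m₂ ω = a.2 := fun ω hω => by
      obtain ⟨h, h'⟩ := Finset.mem_filter.1 hω
      exact ⟨h, congrArg Prod.fst h', congrArg Prod.snd h'⟩
    -- either `Z` or its complement has at most `q / 2` elements
    rw [← Finset.card_filter_add_card_filter_not (s := S') (fun ω => (Z ω).card ≤ q / 2), two_mul]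
    refine add_le_add ?_ ?_
    · refine card_le_of_small_side _ Z false ?_ ?_ ?_
      · intro ω hω g hg
        exact hZt ω (hm ω (Finset.mem_filter.1 hω).1).1 g hg
      · intro ω hω
        exact (Finset.mem_filter.1 hω).2
      · intro ω hω ω' hω' h
        have h3 := hm ω (Finset.mem_filter.1 hω).1
        have h4 := hm ω' (Finset.mem_filter.1 hω').1
        exact h₁ ω h3.1 ω' h4.1 (h3.2.1.trans h4.2.1.symm) h
    · refine card_le_of_small_side _ (fun ω => (Z ω)ᶜ) true ?_ ?_ ?_
      · intro ω hω g hg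
        rw [Finset.mem_compl]
        exact hZf ω (hm ω (Finset.mem_filter.1 hω).1).1 g hg
      · intro ω hω
        have := (Finset.mem_filter.1 hω).2
        rw [Finset.card_compl, Fintype.card_fin]
        omega
      · intro ω hω ω' hω' h
        have h3 := hm ω (Finset.mem_filter.1 hω).1
        have h4 := hm ω' (Finset.mem_filter.1 hω').1
        simp only [h₂ ω h3.1 ω' h4.1 (h3.2.2.trans h4.2.2.symm) h]
  refine h3.trans (Nat.mul_le_mul_left _ ((Finset.card_le_univ _).trans ?_))
  simp [Nat.card_eq_fintype_card]

theorem IsBatch.mono {n ℓ ℓ' : ℕ} {G G' : SimpleGraph (Fin n)} (h : IsBatch ℓ G G')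
    (hℓ : ℓ ≤ ℓ') : IsBatch ℓ' G G' := le_trans h hℓ

namespace GadgetVertices

variable {n q : ℕ} (e : GadgetVertices n (Fin q) Unit)

/-- Initially all edges of all gadgets are present. One batch deletes the left edge of `g` if
`ω g = some false`, and the right edge if `ω g = some true`. -/
def deletion (ω : Fin q → Option Bool) (t : ℕ) : SimpleGraph (Fin n) :=
  e.graph (fun g => t ≠ 0 → ω g ≠ some false) (fun g _ => t ≠ 0 → ω g ≠ some true)

theorem isBatch_deletion (ω : Fin q → Option Bool) (t : ℕ) :
    IsBatch q (e.deletion ω t) (e.deletion ω (t + 1)) := by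
  classical
  refine isBatch_graph (fun g => if ω g = some false then s(e.left g, e.center g) else
    s(e.center g, e.right g ())) (fun g hg => ⟨g, ?_⟩) fun g x hg => ⟨g, ?_⟩
  · by_cases h : ω g = some false <;> simp_all
  · by_cases h : ω g = some true <;> simp_all

end GadgetVertices

namespace Algorithm

variable {n k B q : ℕ} (A : Algorithm n k B)

/-- Derandomization for one batch of deletions in gadgets whose left leaves are hosted by `i₁`,
whose right leaves by `i₂`, and whose centres by other players. -/
theorem exists_single_batch (T : ℕ) (P : Partition n k) (e : GadgetVertices n (Fin q) Unit)
    {i₁ i₂ : Fin k} (hi : i₁ ≠ i₂) (h₁ : ∀ g, P (e.left g) = i₁) (h₂ : ∀ g, P (e.right g ()) = i₂)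
    (h₃ : ∀ g, P (e.center g) ≠ i₁ ∧ P (e.center g) ≠ i₂) :
    ∃ (S : Finset (Fin q → Option Bool)) (Z : (Fin q → Option Bool) → Finset (Fin q))
      (m₁ : (Fin q → Option Bool) → Transcript k B T i₁)
      (m₂ : (Fin q → Option Bool) → Transcript k B T i₂),
      (∀ ω ∈ S, ∀ g, ω g = some true → g ∈ Z ω) ∧
      (∀ ω ∈ S, ∀ g, ω g = some false → g ∉ Z ω) ∧
      (∀ ω ∈ S, ∀ ω' ∈ S, m₁ ω = m₁ ω' → (∀ g, ω g = some false ↔ ω' g = some false) →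
        Z ω = Z ω') ∧
      (∀ ω ∈ S, ∀ ω' ∈ S, m₂ ω = m₂ ω' → (∀ g, ω g = some true ↔ ω' g = some true) →
        Z ω = Z ω') ∧
      ∑ ω, A.successProb T P (e.deletion ω) 1 ≤ S.card := by
  classical
  obtain ⟨c, m, hc, -, hS⟩ := A.exists_fixed_success T P (fun ω => e.deletion ω)
    (e.graph (fun _ => True) fun _ _ => True) (fun ω => by simp [GadgetVertices.deletion]) 1
  have key : ∀ ω, OutputsMaximalMatching (e.deletion ω 1) P (fun i => A.output i (c ω i)) → ∀ g,
      (s(e.left g, e.center g) ∈ A.output i₁ (c ω i₁) ↔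
        ¬s(e.center g, e.right g ()) ∈ A.output i₂ (c ω i₂)) ∧
      (s(e.left g, e.center g) ∈ A.output i₁ (c ω i₁) → ω g ≠ some false) ∧
      (s(e.center g, e.right g ()) ∈ A.output i₂ (c ω i₂) → ω g ≠ some true) := by
    intro ω h g
    have := OutputsMaximalMatching.gadget h (g := g) (x := ()) (fun _ _ => rfl)
      (by by_cases h : ω g = some false <;> simp [h])
    simpa [h₁, h₂] using this
  refine ⟨_, fun ω => {g | s(e.left g, e.center g) ∈ A.output i₁ (c ω i₁)}, fun ω => m ω 0 i₁,
    fun ω => m ω 0 i₂, ?_, ?_, ?_, ?_, hS⟩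
  · intro ω hω g hg
    obtain ⟨k1, -, k3⟩ := key ω (Finset.mem_filter.1 hω).2 g
    rw [Finset.mem_filter]
    exact ⟨Finset.mem_univ _, k1.2 fun h => k3 h hg⟩
  · intro ω hω g hg h
    exact (key ω (Finset.mem_filter.1 hω).2 g).2.1 (Finset.mem_filter.1 h).2 hg
  · intro ω _ ω' _ hm h
    have : c ω i₁ = c ω' i₁ := by
      refine hc i₁ ω ω' (fun τ hτ => ?_) (fun τ hτ => ?_)
      · refine GadgetVertices.localInput_graph_eq (fun g _ => by simp [h]) fun g x hx => ?_
        rcases hx with hx | hx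
        · exact absurd hx (h₃ g).1
        · exact absurd (hx.symm.trans (h₂ g)) hi
      · rwa [Nat.lt_one_iff.1 hτ]
    simp only [this]
  · intro ω hω ω' hω' hm h
    have : c ω i₂ = c ω' i₂ := by
      refine hc i₂ ω ω' (fun τ hτ => ?_) (fun τ hτ => ?_)
      · refine GadgetVertices.localInput_graph_eq (fun g hg => ?_) fun g x _ => by simp [h]
        rcases hg with hg | hg
        · exact absurd ((h₁ g).symm.trans hg) hi
        · exact absurd hg (h₃ g).2
      · rwa [Nat.lt_one_iff.1 hτ]
    ext g
    have k1 := (key ω (Finset.mem_filter.1 hω).2 g).1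
    have k2 := (key ω' (Finset.mem_filter.1 hω').2 g).1
    simp [k1, k2, this]

theorem sum_successProb_single_le (T : ℕ) (P : Partition n k)
    (e : GadgetVertices n (Fin q) Unit)
    {i₁ i₂ : Fin k} (hi : i₁ ≠ i₂) (h₁ : ∀ g, P (e.left g) = i₁) (h₂ : ∀ g, P (e.right g ()) = i₂)
    (h₃ : ∀ g, P (e.center g) ≠ i₁ ∧ P (e.center g) ≠ i₂) :
    ∑ ω, A.successProb T P (e.deletion ω) 1 ≤
      ((2 * (2 ^ q * 2 ^ (q / 2)) * (2 ^ ((B + 1) * (k - 1) * T)) ^ 2 : ℕ) : ℝ≥0∞) := by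
  obtain ⟨S, Z, m₁, m₂, ht, hf, hm₁, hm₂, hS⟩ := A.exists_single_batch T P e hi h₁ h₂ h₃
  refine hS.trans (Nat.cast_le.2 ((card_success_le S Z m₁ m₂ ht hf hm₁ hm₂).trans ?_))
  refine Nat.mul_le_mul_left _ ?_
  rw [sq]
  exact Nat.mul_le_mul (card_transcript_le k B T i₁) (card_transcript_le k B T i₂)

/-- Without communication, one of the three possible batches for a single gadget goes wrong. -/
theorem sum_successProb_zero_le (P : Partition n k) (e : GadgetVertices n (Fin 1) Unit)
    {i₁ i₂ : Fin k} (hi : i₁ ≠ i₂) (h₁ : ∀ g, P (e.left g) = i₁) (h₂ : ∀ g, P (e.right g ()) = i₂)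
    (h₃ : ∀ g, P (e.center g) ≠ i₁ ∧ P (e.center g) ≠ i₂) :
    ∑ ω, A.successProb 0 P (e.deletion ω) 1 ≤ 2 := by
  obtain ⟨S, Z, m₁, m₂, ht, hf, hm₁, hm₂, hS⟩ := A.exists_single_batch 0 P e hi h₁ h₂ h₃
  refine hS.trans (by
    rw [← Nat.cast_two, Nat.cast_le]
    by_contra! h
    have hu : S = Finset.univ := by
      rw [← Finset.card_eq_iff_eq_univ]
      refine le_antisymm (Finset.card_le_univ _) ?_
      have : Fintype.card (Fin 1 → Option Bool) = 3 := by simp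
      omega
    subst hu
    -- the left host does not notice a right deletion, nor the right host a left one, so the output
    -- without deletions would have to agree with the two contradictory other outputs
    have e1 := hm₁ (fun _ => none) (by simp) (fun _ => some true) (by simp)
      (Subsingleton.elim _ _) (by simp)
    have e2 := hm₂ (fun _ => none) (by simp) (fun _ => some false) (by simp)
      (Subsingleton.elim _ _) (by simp)
    have e3 := ht (fun _ => some true) (by simp) 0 rfl
    have e4 := hf (fun _ => some false) (by simp) 0 rfl
    rw [← e1] at e3
    rw [← e2] at e4
    exact e4 e3)

end Algorithm

open Filter

/-! ### The lower bound against the adaptive adversary -/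

/-- The exponential rates: `3 ^ q` exceeds `2 ^ (3 * q / 2)`, as `9 > 8`, unless `4 ^ b` makes up for
it; the constant comes from `(9 / 8) ^ 60 > 1000`. -/
theorem le_of_counting {q b : ℕ} (hb : 1 ≤ b)
    (h : 9 * 3 ^ q ≤ 10 * (2 * (2 ^ q * 2 ^ (q / 2)) * (2 ^ b) ^ 2)) : q ≤ 60 * b := by
  by_contra! hq
  obtain ⟨r', rfl⟩ := Nat.exists_eq_add_of_le hq.le
  have h1 : (9 * 3 ^ (60 * b + r')) ^ 2 ≤ 400 * (8 ^ (60 * b + r') * 16 ^ b) := by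
    calc (9 * 3 ^ (60 * b + r')) ^ 2
        ≤ (10 * (2 * (2 ^ (60 * b + r') * 2 ^ ((60 * b + r') / 2)) * (2 ^ b) ^ 2)) ^ 2 :=
          Nat.pow_le_pow_left h 2
      _ = 400 * ((4 ^ (60 * b + r') * 2 ^ (2 * ((60 * b + r') / 2))) * 16 ^ b) := by
          rw [show (4 : ℕ) = 2 ^ 2 by norm_num, show (16 : ℕ) = 2 ^ 4 by norm_num]
          simp only [← pow_mul, mul_pow]
          ring
      _ ≤ 400 * ((4 ^ (60 * b + r') * 2 ^ (60 * b + r')) * 16 ^ b) := by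
          gcongr
          · norm_num
          · omega
      _ = _ := by rw [← mul_pow]; norm_num
  have h2 : 1000 ^ b * 8 ^ (60 * b) ≤ 9 ^ (60 * b) := by
    rw [pow_mul, pow_mul, ← mul_pow]
    exact Nat.pow_le_pow_left (by norm_num) b
  have h3 : 8 ^ r' ≤ 9 ^ r' := Nat.pow_le_pow_left (by norm_num) _
  have h4 : 16 ^ b * 60 ≤ 1000 ^ b := by
    calc 16 ^ b * 60 ≤ 16 ^ b * 60 ^ b := by
          gcongr
          exact Nat.le_self_pow (by omega) 60
      _ = 960 ^ b := by rw [← mul_pow]; norm_num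
      _ ≤ 1000 ^ b := Nat.pow_le_pow_left (by norm_num) b
  have h5 : 81 * (16 ^ b * 60 * 8 ^ (60 * b) * 8 ^ r') ≤ 400 * (8 ^ (60 * b + r') * 16 ^ b) := by
    calc 81 * (16 ^ b * 60 * 8 ^ (60 * b) * 8 ^ r')
        ≤ 81 * (1000 ^ b * 8 ^ (60 * b) * 9 ^ r') := by gcongr
      _ ≤ 81 * (9 ^ (60 * b) * 9 ^ r') := by gcongr
      _ = (9 * 3 ^ (60 * b + r')) ^ 2 := by
          rw [← pow_add, mul_pow, ← pow_mul, mul_comm (60 * b + r') 2, pow_mul]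
          norm_num
      _ ≤ _ := h1
  rw [pow_add] at h5
  have h6 : 0 < 16 ^ b * 8 ^ (60 * b) * 8 ^ r' := by positivity
  nlinarith

section Cyclic

variable {n k : ℕ}

/-- The partition that deals the vertices out to the players in turn. -/
def cyclicPartition (n k : ℕ) [NeZero k] : Partition n k := fun v => Fin.ofNat k v

theorem ncard_cyclicPartition [NeZero k] (i : Fin k) :
    n / k ≤ {v | cyclicPartition n k v = i}.ncard ∧
      {v | cyclicPartition n k v = i}.ncard ≤ n / k + 1 := by
  have hk : 0 < k := Nat.pos_of_ne_zero (NeZero.ne k)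
  have hi := i.2
  have hmem : ∀ v : Fin n, cyclicPartition n k v = i ↔ (v : ℕ) % k = i := fun v => by
    simp [cyclicPartition, Fin.ext_iff]
  constructor
  · have hlt : ∀ j : Fin (n / k), (j : ℕ) * k + i < n := fun j => by
      have h1 : ((j : ℕ) + 1) * k ≤ n / k * k := Nat.mul_le_mul_right k j.2
      have h2 := Nat.div_mul_le_self n k
      rw [add_mul, one_mul] at h1
      omega
    have hinj : Function.Injective fun j : Fin (n / k) => (⟨j * k + i, hlt j⟩ : Fin n) := by
      intro j j' h
      have h' : (j : ℕ) * k + i = j' * k + i := by simpa using h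
      exact Fin.ext (Nat.eq_of_mul_eq_mul_right hk (by omega))
    calc n / k = (Set.range fun j : Fin (n / k) => (⟨j * k + i, hlt j⟩ : Fin n)).ncard := by
          rw [Set.ncard_range_of_injective hinj, Nat.card_fin]
      _ ≤ _ := by
          refine Set.ncard_le_ncard ?_ (Set.toFinite _)
          rintro _ ⟨j, rfl⟩
          rw [Set.mem_ofPred_eq, hmem]
          simp [Nat.add_mod, Nat.mod_eq_of_lt hi]
  · have : ({v | cyclicPartition n k v = i}).ncard ≤ (Set.univ : Set (Fin (n / k + 1))).ncard := by
      refine Set.ncard_le_ncard_of_injOn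
        (fun v : Fin n => (⟨v / k, Nat.lt_succ_of_le (Nat.div_le_div_right v.2.le)⟩ :
          Fin (n / k + 1))) (fun _ _ => Set.mem_univ _) ?_ (Set.toFinite _)
      intro v hv w hw h
      rw [Set.mem_ofPred_eq, hmem] at hv hw
      have h' : (v : ℕ) / k = w / k := by simpa using h
      have h1 := Nat.div_add_mod v k
      have h2 := Nat.div_add_mod w k
      rw [hv, h'] at h1
      rw [hw] at h2
      exact Fin.ext (h1.symm.trans h2)
    simpa [Set.ncard_univ] using this

/-- Gadgets whose left leaves, centres and right leaves are hosted by players `0`, `1`, `2`. -/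
def cyclicGadgets {q : ℕ} (hk : 3 ≤ k) (hq : q * k ≤ n) : GadgetVertices n (Fin q) Unit where
  toFun x := ⟨x.1 * k + x.2.elim 0 (fun y => y.elim 1 fun _ => 2), by
    have h1 : ((x.1 : ℕ) + 1) * k ≤ q * k := Nat.mul_le_mul_right k x.1.2
    rw [add_mul, one_mul] at h1
    rcases x with ⟨g, _ | _ | _⟩ <;> simp at h1 ⊢ <;> omega⟩
  inj' := by
    have hmod : ∀ a c : ℕ, c < 3 → (a * k + c) % k = c ∧ (a * k + c) / k = a := fun a c hc => by
      rw [mul_comm, Nat.mul_add_mod, Nat.mul_add_div (by omega), Nat.mod_eq_of_lt (by omega),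
        Nat.div_eq_of_lt (by omega)]
      exact ⟨rfl, rfl⟩
    rintro ⟨g, y⟩ ⟨g', y'⟩ h
    have h' : (g : ℕ) * k + y.elim 0 (fun y => y.elim 1 fun _ => 2) =
        g' * k + y'.elim 0 (fun y => y.elim 1 fun _ => 2) := by simpa using h
    have hlt : ∀ y : Option (Option Unit), y.elim 0 (fun y => y.elim 1 fun _ => 2) < 3 := by
      rintro (_ | _ | _) <;> simp
    have h1 := hmod g _ (hlt y)
    have h2 := hmod g' _ (hlt y')
    rw [h'] at h1
    have h3 := h1.1.symm.trans h2.1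
    have h4 : g = g' := Fin.ext (h1.2.symm.trans h2.2)
    subst h4
    rcases y with _ | _ | _ <;> rcases y' with _ | _ | _ <;> simp_all

theorem cyclicGadgets_host {q : ℕ} [NeZero k] (hk : 3 ≤ k) (hq : q * k ≤ n) (g : Fin q) :
    cyclicPartition n k ((cyclicGadgets hk hq).left g) = ⟨0, by omega⟩ ∧
    cyclicPartition n k ((cyclicGadgets hk hq).center g) = ⟨1, by omega⟩ ∧
    cyclicPartition n k ((cyclicGadgets hk hq).right g ()) = ⟨2, by omega⟩ := by
  have key : ∀ c < k, (g * k + c) % k = c := fun c hc => by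
    rw [mul_comm, Nat.mul_add_mod, Nat.mod_eq_of_lt hc]
  exact ⟨Fin.ext (key 0 (by omega)), Fin.ext (key 1 (by omega)), Fin.ext (key 2 (by omega))⟩

end Cyclic

theorem message_bits_le {C L : ℝ} {β : ℕ} (hC : 0 < C) (hβ : 1 ≤ β) (hL : 1 ≤ L) :
    (⌊C * β * L⌋₊ : ℝ) + 1 ≤ (C + 1) * β * L := by
  have hβ' : (1 : ℝ) ≤ β := by exact_mod_cast hβ
  have h1 : (⌊C * β * L⌋₊ : ℝ) ≤ C * β * L := Nat.floor_le (by positivity)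
  have h2 : 1 ≤ β * L := by nlinarith
  nlinarith

namespace Algorithm

variable {n k B : ℕ} (A : Algorithm n k B)

theorem UpdatesAdaptive.successProb_ge [NeZero k] {T ℓ : ℕ} {ε lo hi : ℝ} (hε : ε ≤ 1 / 20)
    (h : A.UpdatesAdaptive T ℓ ε lo hi) (hP : Balanced lo hi (cyclicPartition n k))
    {G : ℕ → SimpleGraph (Fin n)} (hG : ∀ t, IsBatch ℓ (G t) (G (t + 1))) :
    ENNReal.ofReal (9 / 10) ≤ A.successProb T (cyclicPartition n k) G 1 := by
  have h1 := h _ hP (fun h => G h.length) (fun c h => by simpa using hG h.length)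
  have h2 := A.ev_successProb_ge (by linarith) h1 1
  rw [ev_pure] at h2
  refine le_trans (ENNReal.ofReal_le_ofReal ?_) h2
  push_cast
  linarith

end Algorithm

theorem balanced_cyclicPartition {n k : ℕ} [NeZero k] {lo hi : ℝ}
    (h1 : 1 ≤ (1 - lo) * ((n : ℝ) / k)) (h2 : 1 ≤ (n : ℝ) / k) (h3 : 2 ≤ hi * Real.log n) :
    Balanced lo hi (cyclicPartition n k) := by
  intro i
  obtain ⟨h4, h5⟩ := ncard_cyclicPartition (n := n) i
  have h4' : ((n / k : ℕ) : ℝ) ≤ ({v | cyclicPartition n k v = i}.ncard : ℝ) := by exact_mod_cast h4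
  have h5' : ({v | cyclicPartition n k v = i}.ncard : ℝ) ≤ ((n / k : ℕ) : ℝ) + 1 := by
    exact_mod_cast h5
  have h6 : (n : ℝ) / k < ((n / k : ℕ) : ℝ) + 1 := by
    rw [← Nat.floor_div_eq_div (K := ℝ)]
    exact Nat.lt_floor_add_one _
  have h7 : ((n / k : ℕ) : ℝ) ≤ (n : ℝ) / k := Nat.cast_div_le
  constructor
  · linarith
  · nlinarith

/-- A batch that makes use of the whole budget `ℓ` requires, up to constants, `ℓ` bits of messages for
one of two players. The case `T = 0` is separate since `le_of_counting` needs a positive number of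
bits. -/
theorem exists_adaptive_bound (C γ κ lo hi : ℝ) (hC : 0 < C) (hγ : 0 < γ) (hκ : 0 < κ)
    (hlo : lo < 1) (hhi : 0 < hi) :
    ∃ c : ℝ, 0 < c ∧ ∃ n₀ : ℕ, ∀ n : ℕ, n₀ ≤ n → ∀ (k : ℕ) [NeZero k] (β ℓ T : ℕ),
      Admissible κ n k β ℓ →
      ∀ A : Algorithm n k ⌊C * β * Real.log n⌋₊,
        A.UpdatesAdaptive T ℓ ((n : ℝ) ^ (-γ)) lo hi →
        c * (ℓ / (β * (k : ℝ) * Real.log n)) ≤ (T : ℝ) := by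
  have hlog : Tendsto (fun n : ℕ => Real.log n) atTop atTop :=
    Real.tendsto_log_atTop.comp tendsto_natCast_atTop_atTop
  have hε : ∀ᶠ n : ℕ in atTop, (n : ℝ) ^ (-γ) ≤ 1 / 20 :=
    ((tendsto_rpow_neg_atTop hγ).comp tendsto_natCast_atTop_atTop).eventually_le_const (by norm_num)
  have h1 : ∀ᶠ n : ℕ in atTop, 1 / (1 - lo) ≤ Real.log n := hlog.eventually_ge_atTop _
  have h2 : ∀ᶠ n : ℕ in atTop, max 1 (3 / κ) ≤ Real.log n := hlog.eventually_ge_atTop _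
  have h3 : ∀ᶠ n : ℕ in atTop, 2 / hi ≤ Real.log n := hlog.eventually_ge_atTop _
  obtain ⟨n₀, hn₀⟩ := eventually_atTop.1 (hε.and (h1.and (h2.and (h3.and (eventually_ge_atTop 1)))))
  refine ⟨1 / (60 * (C + 1)), by positivity, n₀, fun n hn k _ β ℓ T hadm => ?_⟩
  obtain ⟨hε, h1, h2, h3, hn1⟩ := hn₀ n hn
  obtain ⟨hβ, hk, hk', hℓ⟩ := hadm
  have hL1 : 1 ≤ Real.log n := (le_max_left _ _).trans h2
  have hL2 : 3 / κ ≤ Real.log n := (le_max_right _ _).trans h2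
  have hk3 : 3 ≤ k := by
    have h4 : Real.log n ≤ Real.log n ^ 4 := le_self_pow₀ hL1 (by norm_num)
    have h5 : 3 ≤ κ * Real.log n := by rwa [div_le_iff₀' hκ] at hL2
    have : (3 : ℝ) ≤ k := by nlinarith
    exact_mod_cast this
  have hk0 : (0 : ℝ) < k := by exact_mod_cast (by omega : 0 < k)
  have hβ0 : (0 : ℝ) < β := by exact_mod_cast hβ
  have hnk : Real.log n ≤ (n : ℝ) / k := by
    rw [le_div_iff₀ (by linarith)] at hk'
    rw [le_div_iff₀ hk0]
    have h5 : Real.sqrt n ≤ n := by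
      rw [Real.sqrt_le_iff]
      have : (1 : ℝ) ≤ n := by exact_mod_cast hn1
      exact ⟨by linarith, by nlinarith⟩
    linarith
  have hbal : Balanced lo hi (cyclicPartition n k) := by
    refine balanced_cyclicPartition ?_ (hL1.trans hnk) ?_
    · have : 1 / (1 - lo) ≤ (n : ℝ) / k := h1.trans hnk
      rwa [div_le_iff₀' (by linarith)] at this
    · rwa [div_le_iff₀' hhi] at h3
  have hℓk : ℓ * k ≤ n := by
    rw [le_div_iff₀ (by positivity)] at hℓ
    have : (ℓ : ℝ) * k ≤ n := by nlinarith [mul_nonneg (Nat.cast_nonneg (α := ℝ) ℓ) hk0.le]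
    exact_mod_cast this
  generalize hB : ⌊C * β * Real.log n⌋₊ = B
  intro A hA
  rcases Nat.eq_zero_or_pos ℓ with rfl | hℓ0
  · simp
  rcases Nat.eq_zero_or_pos T with rfl | hT
  · exfalso
    have hk1 : 1 * k ≤ n := (Nat.mul_le_mul_right k hℓ0).trans hℓk
    let e := cyclicGadgets (q := 1) hk3 hk1
    have hh := cyclicGadgets_host (q := 1) hk3 hk1
    have h5 := A.sum_successProb_zero_le (cyclicPartition n k) e
      (i₁ := ⟨0, by omega⟩) (i₂ := ⟨2, by omega⟩) (by simp) (fun g => (hh g).1)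
      (fun g => (hh g).2.2) (fun g => by rw [(hh g).2.1]; simp)
    have h6 : ∑ _ω : Fin 1 → Option Bool, ENNReal.ofReal (9 / 10) ≤ 2 :=
      (Finset.sum_le_sum fun ω _ => hA.successProb_ge A hε hbal fun t =>
        (e.isBatch_deletion ω t).mono hℓ0).trans h5
    rw [← ENNReal.ofReal_sum_of_nonneg (fun _ _ => by norm_num),
      ENNReal.ofReal_le_iff_le_toReal (by norm_num)] at h6
    norm_num at h6
  · let e := cyclicGadgets hk3 hℓk
    have hh := cyclicGadgets_host hk3 hℓk
    have h5 := A.sum_successProb_single_le T (cyclicPartition n k) e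
      (i₁ := ⟨0, by omega⟩) (i₂ := ⟨2, by omega⟩) (by simp) (fun g => (hh g).1)
      (fun g => (hh g).2.2) (fun g => by rw [(hh g).2.1]; simp)
    have h6 := (Finset.sum_le_sum fun ω (_ : ω ∈ Finset.univ) =>
      hA.successProb_ge A hε hbal fun t => e.isBatch_deletion ω t).trans h5
    rw [← ENNReal.ofReal_sum_of_nonneg (fun _ _ => by norm_num),
      ENNReal.ofReal_le_iff_le_toReal (by finiteness), ENNReal.toReal_natCast] at h6
    have h7 : 9 * 3 ^ ℓ ≤
        10 * (2 * (2 ^ ℓ * 2 ^ (ℓ / 2)) * (2 ^ ((B + 1) * (k - 1) * T)) ^ 2) := by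
      simp only [Finset.sum_const, Finset.card_univ, Fintype.card_fun, Fintype.card_option,
        Fintype.card_bool, Fintype.card_fin, nsmul_eq_mul] at h6
      have : (9 * 3 ^ ℓ : ℝ) ≤
          ((10 * (2 * (2 ^ ℓ * 2 ^ (ℓ / 2)) * (2 ^ ((B + 1) * (k - 1) * T)) ^ 2) : ℕ) : ℝ) := by
        push_cast at h6 ⊢
        norm_num at h6 ⊢
        linarith
      exact_mod_cast this
    have h8 := le_of_counting (Nat.mul_pos (Nat.mul_pos (by omega) (by omega)) hT) h7
    have h9 : (ℓ : ℝ) ≤ 60 * (((C + 1) * β * Real.log n) * k * T) := by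
      calc (ℓ : ℝ) ≤ ((60 * ((B + 1) * (k - 1) * T) : ℕ) : ℝ) := by exact_mod_cast h8
        _ = 60 * (((B : ℝ) + 1) * ((k - 1 : ℕ) : ℝ) * T) := by push_cast; ring
        _ ≤ _ := by
          have := message_bits_le hC hβ hL1
          rw [hB] at this
          have h10 : ((k - 1 : ℕ) : ℝ) ≤ k := by exact_mod_cast Nat.sub_le k 1
          gcongr
    rw [div_mul_div_comm, one_mul, div_le_iff₀ (by positivity)]
    linarith

/-! ### Online prediction from a random set of coordinates -/

section Martingale

theorem sum_mul_le_of_fiber {α β : Type} [DecidableEq β] (A : Finset α) (κ : α → β) (F g : α → ℝ)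
    (hF : ∀ x ∈ A, 0 ≤ F x) (hFκ : ∀ x ∈ A, ∀ y ∈ A, κ x = κ y → F x = F y)
    (hg : ∀ x ∈ A, ∑ y ∈ A with κ y = κ x, g y ≤ ((A.filter fun y => κ y = κ x).card : ℝ)) :
    ∑ x ∈ A, g x * F x ≤ ∑ x ∈ A, F x := by
  rw [← Finset.sum_fiberwise_of_maps_to (s := A) (t := A.image κ) (g := κ)
      (fun x hx => Finset.mem_image_of_mem κ hx),
    ← Finset.sum_fiberwise_of_maps_to (s := A) (t := A.image κ) (g := κ) (f := F)
      (fun x hx => Finset.mem_image_of_mem κ hx)]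
  refine Finset.sum_le_sum fun b hb => ?_
  obtain ⟨x, hx, rfl⟩ := Finset.mem_image.1 hb
  have h1 : ∀ y ∈ A.filter fun y => κ y = κ x, F y = F x := fun y hy =>
    hFκ y (Finset.mem_filter.1 hy).1 x hx (Finset.mem_filter.1 hy).2
  rw [Finset.sum_congr rfl fun y hy => by rw [h1 y hy], Finset.sum_congr rfl h1,
    ← Finset.sum_mul, Finset.sum_const, nsmul_eq_mul]
  exact mul_le_mul_of_nonneg_right (hg x hx) (hF x hx)

variable {ι X : Type} [Fintype ι] [LinearOrder ι] [Fintype X] [DecidableEq X]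

/-- The sequences in `A` that agree with `π` before `i`. -/
def prefixClass (A : Finset (ι → X)) (i : ι) (π : ι → X) : Finset (ι → X) :=
  {ρ ∈ A | ∀ j < i, ρ j = π j}

theorem mem_prefixClass {A : Finset (ι → X)} {i : ι} {π ρ : ι → X} :
    ρ ∈ prefixClass A i π ↔ ρ ∈ A ∧ ∀ j < i, ρ j = π j := by
  simp [prefixClass]

theorem prefixClass_congr {A : Finset (ι → X)} {i : ι} {π ρ : ι → X} (h : ∀ j < i, ρ j = π j) :
    prefixClass A i ρ = prefixClass A i π := by
  ext σ
  rw [mem_prefixClass, mem_prefixClass]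
  exact and_congr_right fun _ => forall₂_congr fun j hj => by rw [h j hj]

theorem sum_mul_le_of_prefixClass (A : Finset (ι → X)) (i : ι) (F g : (ι → X) → ℝ)
    (hF : ∀ π, 0 ≤ F π) (hFi : ∀ π ρ, (∀ j < i, π j = ρ j) → F π = F ρ)
    (hg : ∀ π ∈ A, ∑ ρ ∈ prefixClass A i π, g ρ ≤ ((prefixClass A i π).card : ℝ)) :
    ∑ π ∈ A, g π * F π ≤ ∑ π ∈ A, F π := by
  classical
  have key : ∀ π ρ : ι → X, ((fun j => if j < i then some (ρ j) else none) =
      fun j => if j < i then some (π j) else none) ↔ ∀ j < i, ρ j = π j := by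
    intro π ρ
    rw [funext_iff]
    refine forall_congr' fun j => ?_
    by_cases hj : j < i <;> simp [hj]
  refine sum_mul_le_of_fiber A (fun π j => if j < i then some (π j) else none) F g
    (fun π _ => hF π) (fun π _ ρ _ h => hFi π ρ ((key ρ π).1 h)) fun π hπ => ?_
  have : (A.filter fun ρ => (fun j => if j < i then some (ρ j) else none) =
      fun j => if j < i then some (π j) else none) = prefixClass A i π := by
    ext ρ
    rw [Finset.mem_filter, mem_prefixClass, key]
  rw [this]
  exact hg π hπ

/-- A supermartingale inequality for the uniform distribution on a set `A` of sequences: a product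
of adapted nonnegative factors, each of conditional mean at most `1`, has mean at most `1`. -/
theorem sum_prod_le_card (A : Finset (ι → X)) (f : ι → (ι → X) → ℝ) (h0 : ∀ i π, 0 ≤ f i π)
    (had : ∀ i π ρ, (∀ j ≤ i, π j = ρ j) → f i π = f i ρ)
    (hs : ∀ i, ∀ π ∈ A, ∑ ρ ∈ prefixClass A i π, f i ρ ≤ ((prefixClass A i π).card : ℝ)) :
    ∑ π ∈ A, ∏ j, f j π ≤ A.card := by
  have key : ∀ s : Finset ι, ∑ π ∈ A, ∏ j ∈ s, f j π ≤ A.card := by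
    intro s
    induction s using Finset.induction_on_max with
    | empty => simp
    | insert a s ha ih =>
      have has : a ∉ s := fun h => lt_irrefl _ (ha a h)
      refine le_trans ?_ ih
      simp only [Finset.prod_insert has]
      refine sum_mul_le_of_prefixClass A a (fun π => ∏ j ∈ s, f j π) (f a)
        (fun π => Finset.prod_nonneg fun j _ => h0 j π) (fun π ρ h => ?_) (hs a)
      exact Finset.prod_congr rfl fun j hj => had j π ρ fun i hi => h i (hi.trans_lt (ha j hj))
  exact key Finset.univ

end Martingale

section Predictor

variable {ι X Pl Hyp : Type} [Fintype ι] [LinearOrder ι] [Fintype X] [DecidableEq X] [Fintype Hyp]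
  {w : ℕ} [NeZero w]

/-- Coordinate `i` is revealed: the player that hosts the `π i`-th candidate has colour `0`. -/
def Revealed (J : ι → X → Pl) (c : Pl → Fin w) (π : ι → X) (i : ι) : Prop := c (J i (π i)) = 0

instance (J : ι → X → Pl) (c : Pl → Fin w) (π : ι → X) (i : ι) : Decidable (Revealed J c π i) :=
  inferInstanceAs (Decidable (_ = _))

/-- The weight of the hypotheses that agree with `z` on the revealed coordinates before `i`, and
have the value `b` at `i`. -/
def vote (J : ι → X → Pl) (c : Pl → Fin w) (wt : Hyp → ℝ) (ζ : Hyp → ι → Bool) (z : ι → Bool)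
    (π : ι → X) (i : ι) (b : Bool) : ℝ :=
  ∑ a with (∀ j < i, Revealed J c π j → ζ a j = z j) ∧ ζ a i = b, wt a

/-- The weighted majority prediction of `z i`, given `z` on the revealed coordinates before `i`. -/
noncomputable def predict (J : ι → X → Pl) (c : Pl → Fin w) (wt : Hyp → ℝ) (ζ : Hyp → ι → Bool)
    (z : ι → Bool) (π : ι → X) (i : ι) : Bool :=
  decide (vote J c wt ζ z π i false ≤ vote J c wt ζ z π i true)

theorem predict_congr {J : ι → X → Pl} {c : Pl → Fin w} {wt : Hyp → ℝ} {ζ : Hyp → ι → Bool}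
    {z z' : ι → Bool} {π π' : ι → X} {i : ι}
    (h : ∀ j < i, Revealed J c π j ↔ Revealed J c π' j)
    (hz : ∀ j < i, Revealed J c π j → z j = z' j) :
    predict J c wt ζ z π i = predict J c wt ζ z' π' i := by
  have : ∀ b, vote J c wt ζ z π i b = vote J c wt ζ z' π' i b := fun b => by
    unfold vote
    congr 1
    ext a
    simp only [Finset.mem_filter, Finset.mem_univ, true_and]
    refine and_congr_left fun _ => forall₂_congr fun j hj => ?_
    rw [← h j hj]
    exact forall_congr' fun hr => by rw [hz j hj hr]
  simp only [predict, this]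

/-- Every mistake of the weighted majority predictor on a revealed coordinate halves the weight of
the hypotheses that are still consistent. -/
theorem weight_le_half_pow (J : ι → X → Pl) (c : Pl → Fin w) (wt : Hyp → ℝ) (hwt : ∀ a, 0 ≤ wt a)
    (hwt1 : ∑ a, wt a ≤ 1) (ζ : Hyp → ι → Bool) (π : ι → X) (a : Hyp) :
    wt a ≤ (1 / 2) ^ (Finset.univ.filter fun i =>
      Revealed J c π i ∧ ζ a i ≠ predict J c wt ζ (ζ a) π i).card := by
  have key : ∀ s : Finset ι, (∀ i ∈ s, ∀ j < i, j ∈ s) →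
      ∑ a' with ∀ j ∈ s, Revealed J c π j → ζ a' j = ζ a j, wt a' ≤
        (1 / 2) ^ (s.filter fun i =>
          Revealed J c π i ∧ ζ a i ≠ predict J c wt ζ (ζ a) π i).card := by
    intro s
    induction s using Finset.induction_on_max with
    | empty => simpa using hwt1
    | insert i s hi ih =>
      intro hs
      have his : i ∉ s := fun h => lt_irrefl _ (hi i h)
      have hlt : ∀ j, j ∈ s ↔ j < i := fun j => ⟨hi j, fun hj =>
        (Finset.mem_insert.1 (hs i (Finset.mem_insert_self i s) j hj)).resolve_left hj.ne⟩
      have ih' := ih fun j hj j' hj' => (hlt j').2 (hj'.trans ((hlt j).1 hj))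
      rw [Finset.filter_insert]
      by_cases hm : Revealed J c π i ∧ ζ a i ≠ predict J c wt ζ (ζ a) π i
      · rw [if_pos hm, Finset.card_insert_of_notMem (by simp [his]), pow_succ]
        have hsplit : ∑ a' with ∀ j ∈ s, Revealed J c π j → ζ a' j = ζ a j, wt a' =
            vote J c wt ζ (ζ a) π i (ζ a i) + vote J c wt ζ (ζ a) π i (!ζ a i) := by
          unfold vote
          rw [← Finset.sum_filter_add_sum_filter_not _ (fun a' => ζ a' i = ζ a i),
            Finset.filter_filter, Finset.filter_filter]
          congr 1 <;> refine Finset.sum_congr (Finset.filter_congr fun a' _ => ?_) fun _ _ => rfl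
          · simp only [hlt]
          · simp only [hlt, Bool.eq_not]
        have hle : vote J c wt ζ (ζ a) π i (ζ a i) ≤ vote J c wt ζ (ζ a) π i (!ζ a i) := by
          have := hm.2
          unfold predict at this
          cases h : ζ a i
          · rw [h] at this
            simpa using this
          · rw [h] at this
            simpa using le_of_lt (by simpa using this)
        have hins : ∑ a' with ∀ j ∈ insert i s, Revealed J c π j → ζ a' j = ζ a j, wt a' =
            vote J c wt ζ (ζ a) π i (ζ a i) := by
          unfold vote
          refine Finset.sum_congr (Finset.filter_congr fun a' _ => ?_) fun _ _ => rfl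
          simp only [Finset.forall_mem_insert, hlt, hm.1, true_imp_iff]
          exact and_comm
        rw [hins]
        linarith
      · rw [if_neg hm]
        refine le_trans (Finset.sum_le_sum_of_subset_of_nonneg ?_ fun a' _ _ => hwt a') ih'
        intro a' ha'
        simp only [Finset.mem_filter, Finset.mem_univ, true_and, Finset.forall_mem_insert] at ha' ⊢
        exact ha'.2
  refine le_trans ?_ (key Finset.univ fun _ _ _ _ => Finset.mem_univ _)
  exact Finset.single_le_sum (f := wt) (fun a' _ => hwt a') (by simp)

/-- Coordinate `i` is skewed: in the class of the sequences in `A` that agree with `π` before `i`,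
it is revealed with less than half the probability `1 / w` of a colour. -/
def Skewed (J : ι → X → Pl) (c : Pl → Fin w) (A : Finset (ι → X)) (π : ι → X) (i : ι) : Prop :=
  2 * w * ((prefixClass A i π).filter fun ρ => Revealed J c ρ i).card < (prefixClass A i π).card

instance (J : ι → X → Pl) (c : Pl → Fin w) (A : Finset (ι → X)) (π : ι → X) (i : ι) :
    Decidable (Skewed J c A π i) := inferInstanceAs (Decidable (_ < _))

/-- The potential of a hypothesis `z` changes by this factor at coordinate `i`. A mistake is paid for
by `1 / 2` if the coordinate is revealed, and gains `1 / (4 * w)` if it is not. As a coordinate that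
is not skewed is revealed with probability at least `1 / (2 * w)`, the conditional mean is at
most `1`. -/
noncomputable def factor (J : ι → X → Pl) (c : Pl → Fin w) (wt : Hyp → ℝ) (ζ : Hyp → ι → Bool)
    (A : Finset (ι → X)) (z : ι → Bool) (i : ι) (π : ι → X) : ℝ :=
  if z i = predict J c wt ζ z π i then 1 else
    if Revealed J c π i then 1 / 2 else
      if Skewed J c A π i then 1 else 1 + 1 / (4 * w)

variable {J : ι → X → Pl} {c : Pl → Fin w} {wt : Hyp → ℝ} {ζ : Hyp → ι → Bool}
  {A : Finset (ι → X)} {z : ι → Bool}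

theorem factor_nonneg (i : ι) (π : ι → X) : 0 ≤ factor J c wt ζ A z i π := by
  unfold factor
  split_ifs <;> positivity

/-- For a fixed hypothesis the potential is a supermartingale. -/
theorem sum_prod_factor_le : ∑ π ∈ A, ∏ i, factor J c wt ζ A z i π ≤ A.card := by
  have hw : (0 : ℝ) < w := by exact_mod_cast Nat.pos_of_ne_zero (NeZero.ne w)
  have hpred : ∀ i (π ρ : ι → X), (∀ j < i, π j = ρ j) →
      predict J c wt ζ z π i = predict J c wt ζ z ρ i := fun i π ρ h =>
    predict_congr (fun j hj => by simp only [Revealed, h j hj]) fun _ _ _ => rfl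
  have hskew : ∀ i (π ρ : ι → X), (∀ j < i, π j = ρ j) →
      (Skewed J c A π i ↔ Skewed J c A ρ i) := fun i π ρ h => by
    simp only [Skewed, prefixClass_congr h]
  refine sum_prod_le_card A _ factor_nonneg (fun i π ρ h => ?_) fun i π hπ => ?_
  · have h1 := hskew i π ρ fun j hj => h j hj.le
    have h2 : Revealed J c π i ↔ Revealed J c ρ i := by rw [Revealed, Revealed, h i le_rfl]
    rw [factor, factor, hpred i π ρ fun j hj => h j hj.le]
    simp only [h1, h2]
  · set K := prefixClass A i π with hK
    have hKmem : ∀ ρ ∈ K, ∀ j < i, ρ j = π j := fun ρ hρ => (mem_prefixClass.1 hρ).2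
    by_cases hm : z i = predict J c wt ζ z π i
    · rw [Finset.sum_congr rfl (g := fun _ => (1 : ℝ)) fun ρ hρ => by
        rw [factor, if_pos (by rw [hm, hpred i ρ π (hKmem ρ hρ)])]]
      simp
    · have hfac : ∀ ρ ∈ K, factor J c wt ζ A z i ρ = if Revealed J c ρ i then 1 / 2 else
          if Skewed J c A π i then 1 else 1 + 1 / (4 * (w : ℝ)) := fun ρ hρ => by
        have h1 := hskew i ρ π (hKmem ρ hρ)
        rw [factor, if_neg (by rwa [hpred i ρ π (hKmem ρ hρ)])]
        simp only [h1]
      rw [Finset.sum_congr rfl hfac, Finset.sum_ite, Finset.sum_const, Finset.sum_const,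
        nsmul_eq_mul, nsmul_eq_mul]
      have hcard := Finset.card_filter_add_card_filter_not (s := K) (fun ρ => Revealed J c ρ i)
      have hcard' : ((K.filter fun ρ => Revealed J c ρ i).card : ℝ) +
          (K.filter fun ρ => ¬Revealed J c ρ i).card = K.card := by exact_mod_cast hcard
      by_cases hsk : Skewed J c A π i
      · rw [if_pos hsk]
        have : (0 : ℝ) ≤ (K.filter fun ρ => Revealed J c ρ i).card := Nat.cast_nonneg _
        linarith
      · rw [if_neg hsk]
        have h2 : (K.card : ℝ) ≤ 2 * w * (K.filter fun ρ => Revealed J c ρ i).card := by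
          have := not_lt.1 hsk
          exact_mod_cast this
        have h3 : ((K.filter fun ρ => ¬Revealed J c ρ i).card : ℝ) * (1 / (4 * w)) ≤
            (K.filter fun ρ => Revealed J c ρ i).card / 2 := by
          rw [mul_one_div, div_le_div_iff₀ (by positivity) (by norm_num)]
          have : (0 : ℝ) ≤ (K.filter fun ρ => Revealed J c ρ i).card := Nat.cast_nonneg _
          nlinarith
        linarith

end Predictor

section Potential

variable {ι X Pl Hyp M : Type} [Fintype ι] [LinearOrder ι] [Fintype X] [DecidableEq X]
  [Fintype Hyp] [DecidableEq M] {w : ℕ} [NeZero w]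

/-- The sequences with message `μ`. -/
def fiber (m : (ι → X) → M) (μ : M) : Finset (ι → X) := {ρ | m ρ = μ}

/-- The total potential of all hypotheses. -/
noncomputable def potential (J : ι → X → Pl) (m : (ι → X) → M) (wt : Hyp → ℝ)
    (ζ : M → Hyp → ι → Bool) (c : Pl → Fin w) (π : ι → X) : ℝ :=
  ∑ a, wt a * ∏ i, factor J c wt (ζ (m π)) (fiber m (m π)) (ζ (m π) a) i π

variable {J : ι → X → Pl} {m : (ι → X) → M} {wt : Hyp → ℝ} {ζ : M → Hyp → ι → Bool}
  {c : Pl → Fin w}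

theorem potential_nonneg (hwt : ∀ a, 0 ≤ wt a) (π : ι → X) : 0 ≤ potential J m wt ζ c π :=
  Finset.sum_nonneg fun a _ => mul_nonneg (hwt a) (Finset.prod_nonneg fun i _ => factor_nonneg i π)

theorem sum_potential_le (hwt : ∀ a, 0 ≤ wt a) (hwt1 : ∑ a, wt a ≤ 1) :
    ∑ π, potential J m wt ζ c π ≤ Fintype.card (ι → X) := by
  rw [← Finset.sum_fiberwise_of_maps_to (s := Finset.univ) (g := m) (t := Finset.univ.image m)
    (by simp)]
  have h1 : ∀ μ ∈ (Finset.univ : Finset (ι → X)).image m,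
      ∑ π with m π = μ, potential J m wt ζ c π ≤ ((fiber m μ).card : ℝ) := by
    intro μ _
    calc ∑ π with m π = μ, potential J m wt ζ c π
        = ∑ π ∈ fiber m μ, ∑ a, wt a * ∏ i, factor J c wt (ζ μ) (fiber m μ) (ζ μ a) i π := by
          refine Finset.sum_congr rfl fun π hπ => ?_
          rw [← (Finset.mem_filter.1 hπ).2]
          rfl
      _ = ∑ a, wt a * ∑ π ∈ fiber m μ, ∏ i, factor J c wt (ζ μ) (fiber m μ) (ζ μ a) i π := by
          rw [Finset.sum_comm]
          simp only [Finset.mul_sum]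
      _ ≤ ∑ a, wt a * (fiber m μ).card :=
          Finset.sum_le_sum fun a _ => mul_le_mul_of_nonneg_left sum_prod_factor_le (hwt a)
      _ ≤ (fiber m μ).card := by
          rw [← Finset.sum_mul]
          exact mul_le_of_le_one_left (Nat.cast_nonneg _) hwt1
  refine (Finset.sum_le_sum h1).trans (le_of_eq ?_)
  rw [← Nat.cast_sum, ← Finset.card_univ,
    Finset.card_eq_sum_card_fiberwise (f := m) (t := Finset.univ.image m) (by simp)]
  rfl

/-- Outside the skewed coordinates a hypothesis of large weight is predicted well: the mistakes on
revealed coordinates reduce the potential by no more than its weight `wt a`, by `weight_le_half_pow`,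
so that the other mistakes make the potential large. -/
theorem pow_mistakes_le_potential (hwt : ∀ a, 0 ≤ wt a) (hwt1 : ∑ a, wt a ≤ 1) (π : ι → X)
    (a : Hyp) :
    wt a ^ 2 * (1 + 1 / (4 * w)) ^ (Finset.univ.filter fun i =>
      ¬Revealed J c π i ∧ ¬Skewed J c (fiber m (m π)) π i ∧
        ζ (m π) a i ≠ predict J c wt (ζ (m π)) (ζ (m π) a) π i).card ≤
      potential J m wt ζ c π := by
  have h1 := weight_le_half_pow J c wt hwt hwt1 (ζ (m π)) π a
  have h2 : ∏ i, factor J c wt (ζ (m π)) (fiber m (m π)) (ζ (m π) a) i π =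
      (1 / 2) ^ (Finset.univ.filter fun i =>
        Revealed J c π i ∧ ζ (m π) a i ≠ predict J c wt (ζ (m π)) (ζ (m π) a) π i).card *
      (1 + 1 / (4 * (w : ℝ))) ^ (Finset.univ.filter fun i =>
        ¬Revealed J c π i ∧ ¬Skewed J c (fiber m (m π)) π i ∧
          ζ (m π) a i ≠ predict J c wt (ζ (m π)) (ζ (m π) a) π i).card := by
    rw [← Finset.prod_const, ← Finset.prod_const, Finset.prod_filter, Finset.prod_filter,
      ← Finset.prod_mul_distrib]
    refine Finset.prod_congr rfl fun i _ => ?_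
    unfold factor
    by_cases h3 : ζ (m π) a i = predict J c wt (ζ (m π)) (ζ (m π) a) π i <;>
    by_cases h4 : Revealed J c π i <;>
    by_cases h5 : Skewed J c (fiber m (m π)) π i <;> simp [h3, h4, h5]
  calc _ ≤ wt a * ∏ i, factor J c wt (ζ (m π)) (fiber m (m π)) (ζ (m π) a) i π := by
        rw [h2, sq, mul_assoc]
        have := hwt a
        gcongr
    _ ≤ _ := Finset.single_le_sum
        (f := fun a => wt a * ∏ i, factor J c wt (ζ (m π)) (fiber m (m π)) (ζ (m π) a) i π)
        (fun a _ => mul_nonneg (hwt a) (Finset.prod_nonneg fun i _ => factor_nonneg i π))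
        (Finset.mem_univ a)

end Potential

/-! ### Random colours rarely skew a coordinate -/

section Chebyshev

variable {X Pl : Type} [Fintype X] [DecidableEq X] [Fintype Pl] [DecidableEq Pl] {w : ℕ} [NeZero w]

/-- A factor that depends on the colour of `a` only can be averaged separately. -/
theorem card_mul_sum_colour (a : Pl) (f : Fin w → ℝ) (g : (Pl → Fin w) → ℝ)
    (hg : ∀ c d, g (c + Pi.single a d) = g c) :
    w * ∑ c, f (c a) * g c = (∑ d, f d) * ∑ c, g c := by
  have h1 : ∀ d : Fin w, ∑ c : Pl → Fin w, f (c a) * g c = ∑ c, f (c a + d) * g c := fun d => by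
    rw [← Equiv.sum_comp (Equiv.addRight (Pi.single a d : Pl → Fin w))]
    refine Finset.sum_congr rfl fun c _ => ?_
    simp [hg]
  have h2 : ∀ x : Fin w, ∑ d, f (x + d) = ∑ d, f d := fun x => Equiv.sum_comp (Equiv.addLeft x) f
  calc w * ∑ c : Pl → Fin w, f (c a) * g c
      = ∑ d : Fin w, ∑ c : Pl → Fin w, f (c a + d) * g c := by
        rw [← Finset.sum_congr rfl fun d _ => h1 d]
        simp
    _ = ∑ c, (∑ d, f (c a + d)) * g c := by
        rw [Finset.sum_comm]
        simp only [Finset.sum_mul]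
    _ = _ := by simp only [h2, Finset.mul_sum]

/-- The centred indicator function of the colour `0`. -/
noncomputable def centred (w : ℕ) [NeZero w] (d : Fin w) : ℝ := (if d = 0 then 1 else 0) - 1 / w

theorem sum_centred : ∑ d, centred w d = 0 := by
  have hw : (w : ℝ) ≠ 0 := by exact_mod_cast NeZero.ne w
  simp [centred, hw]

theorem sum_centred_sq_le : ∑ d, centred w d * centred w d ≤ 1 := by
  have hw : (w : ℝ) ≠ 0 := by exact_mod_cast NeZero.ne w
  have hw' : (0 : ℝ) < 1 / w := by
    have := Nat.pos_of_ne_zero (NeZero.ne w)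
    positivity
  have h1 : ∀ d : Fin w, centred w d * centred w d =
      (if d = 0 then 1 else 0) - 1 / w * centred w d - 1 / w * (if d = 0 then 1 else 0) :=
    fun d => by
      unfold centred
      split_ifs <;> ring
  rw [Finset.sum_congr rfl fun d _ => h1 d, Finset.sum_sub_distrib, Finset.sum_sub_distrib,
    ← Finset.mul_sum, ← Finset.mul_sum, sum_centred]
  simp only [Finset.sum_ite_eq', Finset.mem_univ, if_true]
  linarith

/-- The variance of the total weight of the elements that get the colour `0`. -/
theorem sum_centred_weight_sq_le (j : X → Pl) (hj : Function.Injective j) (v : X → ℝ) :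
    w * ∑ c : Pl → Fin w, (∑ x, v x * centred w (c (j x))) ^ 2 ≤
      Fintype.card (Pl → Fin w) * ∑ x, v x ^ 2 := by
  have h1 : ∀ x y, w * ∑ c : Pl → Fin w, centred w (c (j x)) * centred w (c (j y)) ≤
      if x = y then (Fintype.card (Pl → Fin w) : ℝ) else 0 := by
    intro x y
    split_ifs with hxy
    · subst hxy
      have := card_mul_sum_colour (j x) (fun d => centred w d * centred w d) (fun _ => 1)
        fun _ _ => rfl
      simp only [mul_one] at this
      rw [this]
      simp only [Finset.sum_const, Finset.card_univ, nsmul_eq_mul, mul_one]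
      exact mul_le_of_le_one_left (Nat.cast_nonneg _) sum_centred_sq_le
    · have hne : j y ≠ j x := fun h => hxy (hj h).symm
      rw [card_mul_sum_colour (j x) (centred w) (fun c => centred w (c (j y)))
        (fun c d => by simp [hne]), sum_centred, zero_mul]
  have h2 : ∀ x y, v x * v y * (w * ∑ c : Pl → Fin w, centred w (c (j x)) * centred w (c (j y))) ≤
      if x = y then Fintype.card (Pl → Fin w) * v x ^ 2 else 0 := by
    intro x y
    split_ifs with hxy
    · subst hxy
      have := h1 x x
      rw [if_pos rfl] at this
      nlinarith [mul_le_mul_of_nonneg_left this (mul_self_nonneg (v x))]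
    · have hne : j y ≠ j x := fun h => hxy (hj h).symm
      rw [card_mul_sum_colour (j x) (centred w) (fun c => centred w (c (j y)))
        (fun c d => by simp [hne]), sum_centred, zero_mul, mul_zero]
  calc w * ∑ c : Pl → Fin w, (∑ x, v x * centred w (c (j x))) ^ 2
      = ∑ x, ∑ y, v x * v y *
          (w * ∑ c : Pl → Fin w, centred w (c (j x)) * centred w (c (j y))) := by
        simp only [sq, Fintype.sum_mul_sum]
        rw [Finset.sum_comm, Finset.mul_sum]
        refine Finset.sum_congr rfl fun x _ => ?_
        rw [Finset.sum_comm, Finset.mul_sum]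
        refine Finset.sum_congr rfl fun y _ => ?_
        rw [mul_left_comm, Finset.mul_sum _ _ (v x * v y)]
        congr 1
        refine Finset.sum_congr rfl fun c _ => ?_
        ring
    _ ≤ ∑ x, ∑ y, if x = y then Fintype.card (Pl → Fin w) * v x ^ 2 else 0 :=
        Finset.sum_le_sum fun x _ => Finset.sum_le_sum fun y _ => h2 x y
    _ = _ := by simp [Finset.mul_sum]

/-- If no large part of the mass `n` of `v` sits on values of mass at least `n / q`, then for most
colourings the colour `0` gets at least half of its share. -/
theorem card_skewed_le (j : X → Pl) (hj : Function.Injective j) (v : X → ℝ) (hv : ∀ x, 0 ≤ v x)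
    {n q : ℝ} (hn : ∑ x, v x = n) (hn0 : 0 < n) (hq : 0 < q) :
    n * (Finset.univ.filter fun c : Pl → Fin w =>
        2 * w * ∑ x with c (j x) = 0, v x < n).card ≤
      Fintype.card (Pl → Fin w) * (4 * ∑ x with n ≤ q * v x, v x + n * (16 * w / q)) := by
  have hw : (0 : ℝ) < w := by exact_mod_cast Nat.pos_of_ne_zero (NeZero.ne w)
  set S := Finset.univ.filter fun c : Pl → Fin w => 2 * w * ∑ x with c (j x) = 0, v x < n with hS
  have hScard : (S.card : ℝ) ≤ Fintype.card (Pl → Fin w) := by exact_mod_cast Finset.card_le_univ S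
  have hC0 : (0 : ℝ) ≤ Fintype.card (Pl → Fin w) := Nat.cast_nonneg _
  rcases le_or_gt (n / 4) (∑ x with n ≤ q * v x, v x) with hbig | hbig
  · -- the first term on the right makes the bound trivial
    have h1 : n * S.card ≤ Fintype.card (Pl → Fin w) * n := by nlinarith
    have h2 : 0 ≤ n * (16 * w / q) := by positivity
    nlinarith
  · -- Chebyshev's inequality for the light values only, which have small variance
    set v' : X → ℝ := fun x => if n ≤ q * v x then 0 else v x with hv'
    have hv'0 : ∀ x, 0 ≤ v' x := fun x => by
      simp only [hv']
      split_ifs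
      exacts [le_rfl, hv x]
    have hsum : 3 * n / 4 ≤ ∑ x, v' x := by
      have h1 := Finset.sum_filter_add_sum_filter_not Finset.univ (fun x => n ≤ q * v x) v
      have h2 : ∑ x, v' x = ∑ x with ¬n ≤ q * v x, v x := by
        rw [Finset.sum_filter]
        refine Finset.sum_congr rfl fun x _ => ?_
        simp only [hv']
        split_ifs <;> simp_all
      rw [h2]
      linarith
    have hsq : ∑ x, v' x ^ 2 ≤ n * (n / q) := by
      rw [← hn, Finset.sum_mul, hn]
      refine Finset.sum_le_sum fun x _ => ?_
      simp only [hv']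
      split_ifs with h
      · rw [zero_pow two_ne_zero]
        exact mul_nonneg (hv x) (by positivity)
      · rw [sq]
        refine mul_le_mul_of_nonneg_left ?_ (hv x)
        rw [le_div_iff₀ hq]
        linarith
    have hdev : ∀ c ∈ S, (n / (4 * w)) ^ 2 ≤ (∑ x, v' x * centred w (c (j x))) ^ 2 := by
      intro c hc
      have hc' : 2 * w * ∑ x with c (j x) = 0, v x < n := (Finset.mem_filter.1 hc).2
      have h1 : ∑ x, v' x * centred w (c (j x)) ≤ -(n / (4 * w)) := by
        have h2 : ∑ x, v' x * centred w (c (j x)) ≤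
            ∑ x with c (j x) = 0, v x - (1 / w) * ∑ x, v' x := by
          rw [Finset.sum_filter, Finset.mul_sum, ← Finset.sum_sub_distrib]
          refine Finset.sum_le_sum fun x _ => ?_
          have : v' x ≤ v x := by
            simp only [hv']
            split_ifs
            exacts [hv x, le_rfl]
          unfold centred
          split_ifs <;> linarith
        have h3 : ∑ x with c (j x) = 0, v x < n / (2 * w) := by
          rw [lt_div_iff₀ (by positivity)]
          linarith
        have h4 : (1 / w) * (3 * n / 4) ≤ (1 / w) * ∑ x, v' x := by gcongr
        have h5 : n / (2 * w) - (1 / w) * (3 * n / 4) = -(n / (4 * w)) := by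
          field_simp
          norm_num
        linarith
      have h2 : 0 ≤ n / (4 * w) := by positivity
      nlinarith
    have hcheb := sum_centred_weight_sq_le (w := w) j hj v'
    have h1 : (S.card : ℝ) * (n / (4 * w)) ^ 2 ≤
        ∑ c : Pl → Fin w, (∑ x, v' x * centred w (c (j x))) ^ 2 := by
      rw [← nsmul_eq_mul, ← Finset.sum_const]
      exact (Finset.sum_le_sum hdev).trans
        (Finset.sum_le_sum_of_subset_of_nonneg (Finset.subset_univ _) fun _ _ _ => sq_nonneg _)
    have h2 : w * ((S.card : ℝ) * (n / (4 * w)) ^ 2) ≤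
        Fintype.card (Pl → Fin w) * (n * (n / q)) :=
      (mul_le_mul_of_nonneg_left h1 hw.le).trans
        (hcheb.trans (mul_le_mul_of_nonneg_left hsq hC0))
    have h3 : n * S.card ≤ Fintype.card (Pl → Fin w) * (n * (16 * w / q)) := by
      have e1 : w * ((S.card : ℝ) * (n / (4 * w)) ^ 2) = (n * S.card) * (n / (16 * w)) := by
        field_simp
        norm_num
      have e2 : Fintype.card (Pl → Fin w) * (n * (n / q)) =
          (Fintype.card (Pl → Fin w) * (n * (16 * w / q))) * (n / (16 * w)) := by
        field_simp
      rw [e1, e2] at h2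
      exact le_of_mul_le_mul_right h2 (by positivity)
    have h4 : 0 ≤ ∑ x with n ≤ q * v x, v x := Finset.sum_nonneg fun x _ => hv x
    nlinarith

end Chebyshev

section Likely

variable {ι X : Type} [Fintype ι] [LinearOrder ι] [Fintype X] [DecidableEq X]

/-- The sequences in `A` that agree with `π` before `i` and have the value `x` at `i`. -/
def valueClass (A : Finset (ι → X)) (i : ι) (π : ι → X) (x : X) : Finset (ι → X) :=
  {ρ ∈ prefixClass A i π | ρ i = x}

/-- The value of `π` at `i` has conditional probability at least `1 / q`. -/
def Likely (A : Finset (ι → X)) (q : ℕ) (π : ι → X) (i : ι) : Prop :=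
  (prefixClass A i π).card ≤ q * (valueClass A i π (π i)).card

instance (A : Finset (ι → X)) (q : ℕ) (π : ι → X) (i : ι) : Decidable (Likely A q π i) :=
  inferInstanceAs (Decidable (_ ≤ _))

/-- The chain rule for the uniform distribution on `A`. -/
theorem prod_ratio_eq_card {A : Finset (ι → X)} {π : ι → X} (hπ : π ∈ A) :
    ∏ i, ((prefixClass A i π).card : ℝ) / (valueClass A i π (π i)).card = A.card := by
  have key : ∀ s : Finset ι, (∀ i ∈ s, ∀ j < i, j ∈ s) →
      (∏ i ∈ s, ((prefixClass A i π).card : ℝ) / (valueClass A i π (π i)).card) *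
        (A.filter fun ρ => ∀ j ∈ s, ρ j = π j).card = A.card := by
    intro s
    induction s using Finset.induction_on_max with
    | empty => simp
    | insert i s hi ih =>
      intro hs
      have his : i ∉ s := fun h => lt_irrefl _ (hi i h)
      have hlt : ∀ j, j ∈ s ↔ j < i := fun j => ⟨hi j, fun hj =>
        (Finset.mem_insert.1 (hs i (Finset.mem_insert_self i s) j hj)).resolve_left hj.ne⟩
      have ih' := ih fun j hj j' hj' => (hlt j').2 (hj'.trans ((hlt j).1 hj))
      have h1 : (A.filter fun ρ => ∀ j ∈ s, ρ j = π j) = prefixClass A i π := by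
        ext ρ
        rw [mem_prefixClass, Finset.mem_filter]
        simp only [hlt]
      have h2 : (A.filter fun ρ => ∀ j ∈ insert i s, ρ j = π j) = valueClass A i π (π i) := by
        ext ρ
        rw [valueClass, Finset.mem_filter, Finset.mem_filter, mem_prefixClass]
        simp only [Finset.forall_mem_insert, hlt]
        tauto
      have h3 : ((valueClass A i π (π i)).card : ℝ) ≠ 0 := by
        have : π ∈ valueClass A i π (π i) :=
          Finset.mem_filter.2 ⟨mem_prefixClass.2 ⟨hπ, fun _ _ => rfl⟩, rfl⟩
        exact_mod_cast (Finset.card_pos.2 ⟨π, this⟩).ne'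
      rw [h1] at ih'
      rw [Finset.prod_insert his, h2, ← ih', mul_right_comm, div_mul_cancel₀ _ h3, mul_comm]
  have h := key Finset.univ fun _ _ _ _ => Finset.mem_univ _
  have h1 : (A.filter fun ρ => ∀ j ∈ Finset.univ, ρ j = π j) = {π} := by
    ext ρ
    rw [Finset.mem_filter, Finset.mem_singleton]
    refine ⟨fun h => funext fun j => h.2 j (Finset.mem_univ j), ?_⟩
    rintro rfl
    exact ⟨hπ, fun _ _ => rfl⟩
  rwa [h1, Finset.card_singleton, Nat.cast_one, mul_one] at h

theorem card_eq_sum_valueClass (A : Finset (ι → X)) (i : ι) (π : ι → X) :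
    ∑ x, (valueClass A i π x).card = (prefixClass A i π).card :=
  (Finset.card_eq_sum_card_fiberwise (f := fun ρ : ι → X => ρ i) (t := Finset.univ)
    (fun _ _ => Finset.mem_coe.2 (Finset.mem_univ _))).symm

/-- In a set of sequences, likely values are rare on average, unless the set is small: the average of
`q ^ N`, for the number `N` of likely values, is at most `(2 * q ^ 2) ^ |ι| / |A|`. -/
theorem sum_pow_likely_le (A : Finset (ι → X)) {q : ℕ} (hq : 0 < q) (hX : Fintype.card X ≤ q ^ 2) :
    ∑ π ∈ A, (q : ℝ) ^ (Finset.univ.filter fun i => Likely A q π i).card ≤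
      (2 * (q : ℝ) ^ 2) ^ Fintype.card ι := by
  have hq' : (0 : ℝ) < q := by exact_mod_cast hq
  rcases A.eq_empty_or_nonempty with rfl | hA
  · simp only [Finset.sum_empty]
    positivity
  have hsup := sum_prod_le_card A
    (fun i π => ((prefixClass A i π).card : ℝ) / (valueClass A i π (π i)).card *
      ((if Likely A q π i then (q : ℝ) else 1) / (2 * (q : ℝ) ^ 2))) ?_ ?_ ?_
  · have h1 : ∀ π ∈ A, ∏ i, ((prefixClass A i π).card : ℝ) / (valueClass A i π (π i)).card *
        ((if Likely A q π i then (q : ℝ) else 1) / (2 * (q : ℝ) ^ 2)) =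
        A.card * ((q : ℝ) ^ (Finset.univ.filter fun i => Likely A q π i).card /
          (2 * (q : ℝ) ^ 2) ^ Fintype.card ι) := by
      intro π hπ
      rw [Finset.prod_mul_distrib, prod_ratio_eq_card hπ, Finset.prod_div_distrib,
        Finset.prod_const, Finset.card_univ, Finset.prod_ite, Finset.prod_const_one,
        Finset.prod_const, mul_one]
    rw [Finset.sum_congr rfl h1, ← Finset.mul_sum, ← Finset.sum_div] at hsup
    have hA' : (0 : ℝ) < A.card := by exact_mod_cast hA.card_pos
    have h2 := (le_div_iff₀' hA').2 hsup
    rw [div_self hA'.ne', div_le_one (by positivity)] at h2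
    exact h2
  · intro i π
    split_ifs <;> positivity
  · intro i π ρ h
    have h1 : prefixClass A i π = prefixClass A i ρ := prefixClass_congr fun j hj => h j hj.le
    have h2 : Likely A q π i ↔ Likely A q ρ i := by
      rw [Likely, Likely, valueClass, valueClass, h1, h i le_rfl]
    simp only [h2, valueClass, h1, h i le_rfl]
  · intro i π hπ
    set K := prefixClass A i π with hK
    have hKpos : 0 < K.card := Finset.card_pos.2 ⟨π, mem_prefixClass.2 ⟨hπ, fun _ _ => rfl⟩⟩
    have hcls : ∀ ρ ∈ K, prefixClass A i ρ = K := fun ρ hρ =>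
      prefixClass_congr (mem_prefixClass.1 hρ).2
    set v : X → ℕ := fun x => (valueClass A i π x).card with hv
    have hsum : ∑ x, v x = K.card := card_eq_sum_valueClass A i π
    have hval : ∀ ρ ∈ K, ((prefixClass A i ρ).card : ℝ) / (valueClass A i ρ (ρ i)).card *
        ((if Likely A q ρ i then (q : ℝ) else 1) / (2 * (q : ℝ) ^ 2)) =
        (K.card : ℝ) / v (ρ i) * ((if K.card ≤ q * v (ρ i) then (q : ℝ) else 1) /
          (2 * (q : ℝ) ^ 2)) := by
      intro ρ hρ
      have h1 : valueClass A i ρ (ρ i) = valueClass A i π (ρ i) := by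
        rw [valueClass, valueClass, hcls ρ hρ]
      simp only [Likely, hcls ρ hρ, h1, hv]
    rw [Finset.sum_congr rfl hval, ← Finset.sum_fiberwise_of_maps_to (s := K) (t := Finset.univ)
      (g := fun ρ => ρ i) (fun _ _ => Finset.mem_univ _)]
    -- an inequality only, as a value that does not occur has `v x = 0` and division by zero is zero
    have hx : ∀ x, ∑ ρ ∈ K with ρ i = x, (K.card : ℝ) / v (ρ i) *
        ((if K.card ≤ q * v (ρ i) then (q : ℝ) else 1) / (2 * (q : ℝ) ^ 2)) ≤
        K.card * ((if K.card ≤ q * v x then (q : ℝ) else 1) / (2 * (q : ℝ) ^ 2)) := by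
      intro x
      rw [Finset.sum_congr rfl (g := fun _ => (K.card : ℝ) / v x *
        ((if K.card ≤ q * v x then (q : ℝ) else 1) / (2 * (q : ℝ) ^ 2))) fun ρ hρ => by
          rw [(Finset.mem_filter.1 hρ).2], Finset.sum_const, nsmul_eq_mul, ← mul_assoc]
      refine mul_le_mul_of_nonneg_right ?_ (by split_ifs <;> positivity)
      change (v x : ℝ) * ((K.card : ℝ) / v x) ≤ K.card
      rcases Nat.eq_zero_or_pos (v x) with h0 | h0
      · simp [h0]
      · have : (v x : ℝ) ≠ 0 := by exact_mod_cast h0.ne'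
        rw [mul_div_cancel₀ _ this]
    refine (Finset.sum_le_sum fun x _ => hx x).trans ?_
    rw [← Finset.mul_sum, ← Finset.sum_div]
    refine mul_le_of_le_one_right (Nat.cast_nonneg _) ?_
    rw [div_le_one (by positivity), Finset.sum_ite, Finset.sum_const, Finset.sum_const,
      nsmul_eq_mul, nsmul_eq_mul, mul_one]
    have h3 : (Finset.univ.filter fun x => K.card ≤ q * v x).card ≤ q := by
      have : (Finset.univ.filter fun x => K.card ≤ q * v x).card * K.card ≤ q * K.card := by
        rw [← smul_eq_mul, ← Finset.sum_const, ← hsum, Finset.mul_sum, hsum]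
        exact (Finset.sum_le_sum fun x hx => (Finset.mem_filter.1 hx).2).trans
          (Finset.sum_le_sum_of_subset (Finset.subset_univ _))
      exact Nat.le_of_mul_le_mul_right this hKpos
    have h4 : (Finset.univ.filter fun x => ¬K.card ≤ q * v x).card ≤ q ^ 2 :=
      (Finset.card_le_univ _).trans hX
    have h3' : ((Finset.univ.filter fun x => K.card ≤ q * v x).card : ℝ) ≤ q := by exact_mod_cast h3
    have h4' : ((Finset.univ.filter fun x => ¬K.card ≤ q * v x).card : ℝ) ≤ (q : ℝ) ^ 2 := by
      exact_mod_cast h4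
    nlinarith

variable {M : Type} [Fintype M] [DecidableEq M]

/-- If the message `m π` is short, then on average few values of `π` become likely once the
message is known. -/
theorem sum_card_likely_le (m : (ι → X) → M) {q τ : ℕ} (hq : 2 ≤ q)
    (hX : Fintype.card X = q ^ 2) (hτ : Fintype.card M * 2 ^ Fintype.card ι ≤ q ^ τ) :
    ∑ π, (Finset.univ.filter fun i => Likely (fiber m (m π)) q π i).card ≤
      Fintype.card (ι → X) * (τ + 1) := by
  set N : (ι → X) → ℕ := fun π => (Finset.univ.filter fun i => Likely (fiber m (m π)) q π i).card
    with hN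
  have hq0 : 0 < q := by omega
  have h1 : ∑ π, q ^ N π ≤ Fintype.card (ι → X) * q ^ τ := by
    have h2 : ∑ π, (q : ℝ) ^ N π ≤ Fintype.card M * (2 * (q : ℝ) ^ 2) ^ Fintype.card ι := by
      rw [← Finset.sum_fiberwise_of_maps_to (s := Finset.univ) (g := m) (t := Finset.univ)
        (by simp)]
      refine (Finset.sum_le_sum (g := fun _ => (2 * (q : ℝ) ^ 2) ^ Fintype.card ι)
        fun μ _ => ?_).trans (by simp)
      refine le_trans (le_of_eq ?_) (sum_pow_likely_le (fiber m μ) hq0 hX.le)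
      refine Finset.sum_congr rfl fun π hπ => ?_
      have : m π = μ := (Finset.mem_filter.1 hπ).2
      simp only [hN, this]
    have h3 : Fintype.card M * (2 * q ^ 2) ^ Fintype.card ι ≤ Fintype.card (ι → X) * q ^ τ := by
      calc Fintype.card M * (2 * q ^ 2) ^ Fintype.card ι
          = Fintype.card (ι → X) * (Fintype.card M * 2 ^ Fintype.card ι) := by
            rw [mul_pow, Fintype.card_fun, hX]
            ring
        _ ≤ _ := Nat.mul_le_mul_left _ hτ
    have h4 : ∑ π, q ^ N π ≤ Fintype.card M * (2 * q ^ 2) ^ Fintype.card ι := by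
      exact_mod_cast h2
    exact h4.trans h3
  have h2 : ∀ π, N π * q ^ τ ≤ τ * q ^ τ + q ^ N π := by
    intro π
    rcases le_or_gt (N π) τ with h | h
    · exact (Nat.mul_le_mul_right _ h).trans (Nat.le_add_right _ _)
    · obtain ⟨d, hd⟩ := Nat.exists_eq_add_of_le h.le
      rw [hd, add_mul, pow_add, mul_comm (q ^ τ)]
      exact Nat.add_le_add_left
        (Nat.mul_le_mul_right _ (Nat.lt_pow_self (by omega : 1 < q)).le) _
  have h3 : (∑ π, N π) * q ^ τ ≤ (Fintype.card (ι → X) * (τ + 1)) * q ^ τ := by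
    rw [Finset.sum_mul]
    refine (Finset.sum_le_sum fun π _ => h2 π).trans ?_
    rw [Finset.sum_add_distrib, Finset.sum_const, smul_eq_mul, Finset.card_univ]
    calc _ ≤ Fintype.card (ι → X) * (τ * q ^ τ) + Fintype.card (ι → X) * q ^ τ := by gcongr
      _ = _ := by ring
  exact Nat.le_of_mul_le_mul_right h3 (by positivity)

end Likely

section Skew

variable {ι X Pl M : Type} [Fintype ι] [LinearOrder ι] [Fintype X] [DecidableEq X]
  [Fintype Pl] [DecidableEq Pl] [Fintype M] [DecidableEq M] {w : ℕ} [NeZero w]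

theorem sum_le_sum_of_prefixClass (A : Finset (ι → X)) (i : ι) (g h : (ι → X) → ℝ)
    (hgh : ∀ π ∈ A, ∑ ρ ∈ prefixClass A i π, g ρ ≤ ∑ ρ ∈ prefixClass A i π, h ρ) :
    ∑ π ∈ A, g π ≤ ∑ π ∈ A, h π := by
  have := sum_mul_le_of_prefixClass A i (fun _ => 1) (fun π => 1 + g π - h π)
    (fun _ => zero_le_one) (fun _ _ _ => rfl) fun π hπ => by
      rw [Finset.sum_sub_distrib, Finset.sum_add_distrib]
      have := hgh π hπ
      simp only [Finset.sum_const, nsmul_eq_mul, mul_one]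
      linarith
  simp only [mul_one, Finset.sum_sub_distrib, Finset.sum_add_distrib] at this
  linarith

/-- Averaged over the colours, coordinate `i` is skewed only where `π i` is likely, up to a small
error. -/
theorem sum_card_skewed_coordinate_le (J : ι → X → Pl) (A : Finset (ι → X)) (i : ι)
    (hJ : Function.Injective (J i)) {q : ℕ} (hq : 0 < q) :
    ∑ π ∈ A, ((Finset.univ.filter fun c : Pl → Fin w => Skewed J c A π i).card : ℝ) ≤
      ∑ π ∈ A, (Fintype.card (Pl → Fin w) : ℝ) *
        (4 * (if Likely A q π i then 1 else 0) + 16 * w / q) := by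
  refine sum_le_sum_of_prefixClass A i _ _ fun π hπ => ?_
  set K := prefixClass A i π with hK
  have hKpos : 0 < K.card := Finset.card_pos.2 ⟨π, mem_prefixClass.2 ⟨hπ, fun _ _ => rfl⟩⟩
  have hcls : ∀ ρ ∈ K, prefixClass A i ρ = K := fun ρ hρ =>
    prefixClass_congr (mem_prefixClass.1 hρ).2
  set v : X → ℝ := fun x => ((valueClass A i π x).card : ℝ) with hv
  have hsum : ∑ x, v x = K.card := by
    simp only [hv]
    exact_mod_cast card_eq_sum_valueClass A i π
  -- sums over the class are weighted sums over the values at `i`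
  have hvalues : ∀ p : X → Prop, ∀ [DecidablePred p],
      ((K.filter fun ρ => p (ρ i)).card : ℝ) = ∑ x with p x, v x := by
    intro p _
    rw [Finset.card_eq_sum_card_fiberwise (f := fun ρ => ρ i) (t := Finset.univ.filter p)
      (fun ρ hρ => by simpa using (Finset.mem_filter.1 hρ).2)]
    push_cast
    refine Finset.sum_congr rfl fun x hx => ?_
    simp only [hv, valueClass, Finset.filter_filter]
    congr 2
    ext ρ
    have := (Finset.mem_filter.1 hx).2
    constructor
    · rintro h
      rw [Finset.mem_filter] at h ⊢
      exact ⟨h.1, h.2.2⟩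
    · rintro h
      rw [Finset.mem_filter] at h ⊢
      exact ⟨h.1, h.2 ▸ this, h.2⟩
  have hmain := card_skewed_le (w := w) (J i) hJ v (fun x => Nat.cast_nonneg _) (q := q) hsum
    (by exact_mod_cast hKpos) (by exact_mod_cast hq)
  have h1 : ∀ c : Pl → Fin w, Skewed J c A π i ↔
      2 * w * ∑ x with c (J i x) = 0, v x < (K.card : ℝ) := fun c => by
    rw [← hvalues fun x => c (J i x) = 0]
    unfold Skewed
    rw [← hK]
    exact_mod_cast Iff.rfl
  have h2 : ∀ ρ ∈ K, ((Finset.univ.filter fun c : Pl → Fin w => Skewed J c A ρ i).card : ℝ) =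
      (Finset.univ.filter fun c : Pl → Fin w =>
        2 * w * ∑ x with c (J i x) = 0, v x < (K.card : ℝ)).card := fun ρ hρ => by
    congr 2
    ext c
    rw [Finset.mem_filter, Finset.mem_filter, ← h1 c, Skewed, Skewed, hcls ρ hρ]
  have h3 : ∀ ρ ∈ K, (Likely A q ρ i ↔ (K.card : ℝ) ≤ q * v (ρ i)) := fun ρ hρ => by
    have : valueClass A i ρ (ρ i) = valueClass A i π (ρ i) := by
      rw [valueClass, valueClass, hcls ρ hρ]
    rw [Likely, hcls ρ hρ, this]
    simp only [hv]
    exact_mod_cast Iff.rfl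
  rw [Finset.sum_congr rfl h2, Finset.sum_const, nsmul_eq_mul, ← Finset.mul_sum,
    Finset.sum_add_distrib, ← Finset.mul_sum, Finset.sum_boole, Finset.sum_const, nsmul_eq_mul,
    Finset.filter_congr h3, hvalues fun x => (K.card : ℝ) ≤ q * v x]
  exact hmain

/-- For random `π` and random colours, few coordinates are skewed given a short message `m π`. -/
theorem sum_card_skewed_le (J : ι → X → Pl) (hJ : ∀ i, Function.Injective (J i))
    (m : (ι → X) → M) {q τ : ℕ} (hq : 2 ≤ q) (hX : Fintype.card X = q ^ 2)
    (hτ : Fintype.card M * 2 ^ Fintype.card ι ≤ q ^ τ) :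
    ∑ π, ∑ c : Pl → Fin w,
        ((Finset.univ.filter fun i => Skewed J c (fiber m (m π)) π i).card : ℝ) ≤
      Fintype.card (ι → X) * Fintype.card (Pl → Fin w) *
        (4 * (τ + 1) + Fintype.card ι * (16 * w / q)) := by
  have h1 : ∀ i, ∑ π, ((Finset.univ.filter fun c : Pl → Fin w =>
      Skewed J c (fiber m (m π)) π i).card : ℝ) ≤
      ∑ π, (Fintype.card (Pl → Fin w) : ℝ) *
        (4 * (if Likely (fiber m (m π)) q π i then 1 else 0) + 16 * w / q) := by
    intro i
    rw [← Finset.sum_fiberwise_of_maps_to (s := Finset.univ) (g := m) (t := Finset.univ) (by simp),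
      ← Finset.sum_fiberwise_of_maps_to (s := Finset.univ) (g := m) (t := Finset.univ)
        (f := fun π => (Fintype.card (Pl → Fin w) : ℝ) *
          (4 * (if Likely (fiber m (m π)) q π i then 1 else 0) + 16 * w / q)) (by simp)]
    refine Finset.sum_le_sum fun μ _ => ?_
    have h2 := sum_card_skewed_coordinate_le (w := w) J (fiber m μ) i (hJ i) (q := q) (by omega)
    have h3 : ∀ π ∈ Finset.univ.filter (fun π => m π = μ), m π = μ := fun π hπ =>
      (Finset.mem_filter.1 hπ).2
    calc _ = ∑ π ∈ fiber m μ,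
          ((Finset.univ.filter fun c : Pl → Fin w => Skewed J c (fiber m μ) π i).card : ℝ) :=
          Finset.sum_congr rfl fun π hπ => by rw [h3 π hπ]
      _ ≤ _ := h2
      _ = _ := Finset.sum_congr rfl fun π hπ => by rw [h3 π hπ]
  have h4 : ∑ π, ∑ c : Pl → Fin w,
      ((Finset.univ.filter fun i => Skewed J c (fiber m (m π)) π i).card : ℝ) =
      ∑ i, ∑ π, ((Finset.univ.filter fun c : Pl → Fin w =>
        Skewed J c (fiber m (m π)) π i).card : ℝ) := by
    rw [Finset.sum_comm (s := (Finset.univ : Finset ι))]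
    refine Finset.sum_congr rfl fun π _ => ?_
    simp only [Finset.card_filter, Nat.cast_sum]
    rw [Finset.sum_comm]
  have h5 : ∑ π, ((Finset.univ.filter fun i => Likely (fiber m (m π)) q π i).card : ℝ) ≤
      Fintype.card (ι → X) * (τ + 1) := by
    exact_mod_cast sum_card_likely_le m hq hX hτ
  rw [h4]
  refine (Finset.sum_le_sum fun i _ => h1 i).trans ?_
  rw [Finset.sum_comm]
  have h6 : ∀ π : ι → X, ∑ i, (Fintype.card (Pl → Fin w) : ℝ) *
      (4 * (if Likely (fiber m (m π)) q π i then 1 else 0) + 16 * w / q) =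
      Fintype.card (Pl → Fin w) *
        (4 * ((Finset.univ.filter fun i => Likely (fiber m (m π)) q π i).card : ℝ) +
          Fintype.card ι * (16 * w / q)) := fun π => by
    rw [← Finset.mul_sum, Finset.sum_add_distrib, ← Finset.mul_sum, Finset.sum_boole]
    simp
  simp only [h6]
  rw [← Finset.mul_sum, Finset.sum_add_distrib, ← Finset.mul_sum, Finset.sum_const, nsmul_eq_mul,
    Finset.card_univ]
  have h7 : (0 : ℝ) ≤ Fintype.card (Pl → Fin w) := Nat.cast_nonneg _
  nlinarith [mul_le_mul_of_nonneg_left h5 h7]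

end Skew

/-! ### Counting the deletion patterns -/

section Counting

variable {Pl M : Type} [Fintype Pl] [DecidableEq Pl] [Fintype M] {ℓ s : ℕ}

/-- A deletion pattern selects in every row `r` one column, and one of the two edges of the gadget
there (the right one if the second component is `true`). -/
abbrev Pattern (ℓ s : ℕ) : Type := Fin ℓ → Fin s × Bool

/-- The gadget that the pattern `x` selects in row `r`. -/
def Pattern.gadget (x : Pattern ℓ s) (r : Fin ℓ) : Fin ℓ × Fin s := (r, (x r).1)

/-- If the deletion of the edge `b` of `g` is visible to the players in `vis g b`, then player `i`
cannot distinguish `x` from `x'`. -/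
def SameView (vis : Fin ℓ × Fin s → Bool → Finset Pl) (i : Pl) (x x' : Pattern ℓ s) : Prop :=
  ∀ g b, i ∈ vis g b → (x g.1 = (g.2, b) ↔ x' g.1 = (g.2, b))

/-- The rows in which `x` selects a gadget outside `Q` for which the prediction `ξ` is wrong. -/
def surprises (Q : Finset (Fin ℓ × Fin s)) (ξ : Pattern ℓ s → Fin ℓ × Fin s → Bool)
    (x : Pattern ℓ s) : Finset (Fin ℓ) :=
  {r | x.gadget r ∉ Q ∧ (x r).2 ≠ ξ x (x.gadget r)}

variable {vis : Fin ℓ × Fin s → Bool → Finset Pl} {S : Finset (Pattern ℓ s)}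
  {m : Pattern ℓ s → Pl → M} {ξ Z : Pattern ℓ s → Fin ℓ × Fin s → Bool}
  {Q : Finset (Fin ℓ × Fin s)} {𝒥 : Finset Pl}

theorem mem_surprises {x : Pattern ℓ s} {r : Fin ℓ} :
    r ∈ surprises Q ξ x ↔ x.gadget r ∉ Q ∧ (x r).2 ≠ ξ x (x.gadget r) := by
  simp [surprises]

/-- Patterns with few surprises are few: outside `Q` the columns alone determine what `𝒥` sees,
hence the predictions, hence the deleted edges up to the surprises. -/
theorem card_few_surprises_le
    (hξ : ∀ x ∈ S, ∀ x' ∈ S, (∀ i ∈ 𝒥, m x i = m x' i) → (∀ i ∈ 𝒥, SameView vis i x x') →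
      ξ x = ξ x')
    (hvis : ∀ g ∉ Q, ∀ b, Disjoint (vis g b) 𝒥) (d : ℕ) :
    (S.filter fun x => (surprises Q ξ x).card ≤ d).card ≤
      Fintype.card M ^ 𝒥.card *
        ((Finset.univ.filter fun V : Finset (Fin ℓ) => V.card ≤ d).card *
          ∏ r, (s + (Finset.univ.filter fun t => (r, t) ∈ Q).card)) := by
  classical
  let Y : Fin ℓ → Finset (Fin s × Bool) := fun r =>
    Finset.univ.filter fun y => (r, y.1) ∈ Q ∨ y.2 = false
  have hY : ∀ r, (Y r).card ≤ s + (Finset.univ.filter fun t => (r, t) ∈ Q).card := by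
    intro r
    have h1 : Y r ⊆ Finset.univ ×ˢ {false} ∪
        (Finset.univ.filter fun t => (r, t) ∈ Q) ×ˢ {true} := by
      rintro ⟨t, b⟩ h
      have h' : (r, t) ∈ Q ∨ b = false := (Finset.mem_filter.1 h).2
      simp only [Finset.mem_union, Finset.mem_product, Finset.mem_univ, Finset.mem_singleton,
        Finset.mem_filter, true_and]
      cases b <;> simp_all
    refine (Finset.card_le_card h1).trans ((Finset.card_union_le _ _).trans (le_of_eq ?_))
    simp
  -- the code of a pattern: the messages of `𝒥`, the surprises, the columns, and the edge in the rows
  -- that select a gadget in `Q`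
  let code : Pattern ℓ s → (𝒥 → M) × Finset (Fin ℓ) × Pattern ℓ s := fun x =>
    (fun i => m x i, surprises Q ξ x,
      fun r => ((x r).1, if x.gadget r ∈ Q then (x r).2 else false))
  have hcard := Finset.card_le_card_of_injOn (s := S.filter fun x => (surprises Q ξ x).card ≤ d)
    (t := Finset.univ ×ˢ (Finset.univ.filter fun V : Finset (Fin ℓ) => V.card ≤ d) ×ˢ
      Fintype.piFinset Y) code ?_ ?_
  · refine hcard.trans ?_
    rw [Finset.card_product, Finset.card_product, Fintype.card_piFinset, Finset.card_univ,
      Fintype.card_fun, Fintype.card_coe]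
    gcongr with r
    exact hY r
  · intro x hx
    simp only [Finset.coe_product, Set.mem_prod, Finset.mem_coe, Finset.mem_univ, true_and,
      Finset.mem_filter, Fintype.mem_piFinset, code, Y]
    refine ⟨(Finset.mem_filter.1 hx).2, fun r => ?_⟩
    by_cases h : x.gadget r ∈ Q
    · exact Or.inl h
    · exact Or.inr (if_neg h)
  · intro x hx x' hx' h
    simp only [code, Prod.mk.injEq] at h
    obtain ⟨h1, h2, h3⟩ := h
    have h4 : ∀ r, (x r).1 = (x' r).1 := fun r => (Prod.mk.inj (congrFun h3 r)).1
    have h5 : ∀ r, x.gadget r = x'.gadget r := fun r => by rw [Pattern.gadget, Pattern.gadget, h4]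
    have h6 : ∀ r, x.gadget r ∈ Q → x r = x' r := fun r hr => by
      have := (Prod.mk.inj (congrFun h3 r)).2
      simp only [← h5 r, if_pos hr] at this
      exact Prod.ext (h4 r) this
    have h7 : ξ x = ξ x' := by
      refine hξ x (Finset.mem_filter.1 hx).1 x' (Finset.mem_filter.1 hx').1
        (fun i hi => congrFun h1 ⟨i, hi⟩) fun i hi g b hg => ?_
      have hgQ : g ∈ Q := by
        by_contra hgQ
        exact Finset.disjoint_left.1 (hvis g hgQ b) hg hi
      constructor <;> intro h
      · rw [← h6 g.1 (by simpa [Pattern.gadget, h] using hgQ), h]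
      · rw [h6 g.1 (by rw [h5]; simpa [Pattern.gadget, h] using hgQ), h]
    funext r
    by_cases hr : x.gadget r ∈ Q
    · exact h6 r hr
    · refine Prod.ext (h4 r) ?_
      have h8 : r ∈ surprises Q ξ x ↔ r ∈ surprises Q ξ x' := by rw [h2]
      rw [mem_surprises, mem_surprises, ← h5, ← h7] at h8
      simp only [hr, not_false_eq_true, true_and] at h8
      revert h8
      cases (x r).2 <;> cases (x' r).2 <;> cases ξ x (x.gadget r) <;> simp

/-- The rows of `V` whose deletion is invisible to `W`, although a player in `W` that does not see
the deletion hosts a leaf of the gadget. -/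
def hiddenRows (vis : Fin ℓ × Fin s → Bool → Finset Pl) (un : Fin ℓ × Fin s → Bool → Pl)
    (V : Finset (Fin ℓ)) (W : Finset Pl) (x : Pattern ℓ s) : Finset (Fin ℓ) :=
  {r ∈ V | un (x.gadget r) (x r).2 ∈ W ∧ Disjoint (vis (x.gadget r) (x r).2) W}

/-- For a random group `W`, a row is hidden with probability at least `1 / 8`: one player has to be
in `W` and at most two others must not. -/
theorem exists_hiddenRows {un : Fin ℓ × Fin s → Bool → Pl} (V : Finset (Fin ℓ))
    (x : Pattern ℓ s) (hun : ∀ r ∈ V, un (x.gadget r) (x r).2 ∉ vis (x.gadget r) (x r).2)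
    (hvis : ∀ r ∈ V, (vis (x.gadget r) (x r).2).card ≤ 2) :
    ∃ W : Finset Pl, V.card ≤ 8 * (hiddenRows vis un V W x).card := by
  by_contra! h
  have h1 : ∀ r ∈ V, 2 ^ Fintype.card Pl ≤ 8 * (Finset.univ.filter fun W : Finset Pl =>
      un (x.gadget r) (x r).2 ∈ W ∧ Disjoint (vis (x.gadget r) (x r).2) W).card := by
    intro r hr
    have h2 : (Finset.univ.filter fun W : Finset Pl =>
        un (x.gadget r) (x r).2 ∈ W ∧ Disjoint (vis (x.gadget r) (x r).2) W) =
        Finset.Icc {un (x.gadget r) (x r).2} (vis (x.gadget r) (x r).2)ᶜ := by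
      ext W
      rw [Finset.mem_filter, Finset.mem_Icc]
      simp only [Finset.mem_univ, true_and, Finset.singleton_subset_iff]
      rw [Finset.subset_compl_comm, Finset.subset_compl_iff_disjoint_right]
    rw [h2, Finset.card_Icc_finset (by simpa using hun r hr), Finset.card_compl,
      Finset.card_singleton, show (8 : ℕ) = 2 ^ 3 by norm_num, ← pow_add]
    refine Nat.pow_le_pow_right (by norm_num) ?_
    have := hvis r hr
    omega
  have h3 : ∑ W : Finset Pl, 8 * (hiddenRows vis un V W x).card < ∑ _W : Finset Pl, V.card :=
    Finset.sum_lt_sum_of_nonempty ⟨∅, Finset.mem_univ _⟩ fun W _ => h W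
  have h4 : ∑ W : Finset Pl, (hiddenRows vis un V W x).card =
      ∑ r ∈ V, (Finset.univ.filter fun W : Finset Pl =>
        un (x.gadget r) (x r).2 ∈ W ∧ Disjoint (vis (x.gadget r) (x r).2) W).card := by
    simp only [hiddenRows, Finset.card_filter]
    exact Finset.sum_comm
  rw [← Finset.mul_sum, h4, Finset.mul_sum] at h3
  have h5 := Finset.sum_le_sum h1
  simp only [Finset.sum_const, Finset.card_univ, Fintype.card_finset, smul_eq_mul] at h3 h5
  rw [mul_comm] at h5
  omega

/-- A product of numbers with a given sum, bounded by means of `f / τ ≤ exp (f / τ)`. -/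
theorem prod_card_le_exp {ι : Type} (U : Finset ι) (f : ι → ℕ) {Θ τ : ℝ} (hτ : 0 < τ)
    (hΘ : ∑ r ∈ U, (f r : ℝ) ≤ Θ) :
    ∏ r ∈ U, (f r : ℝ) ≤ τ ^ U.card * Real.exp (Θ / τ) := by
  calc ∏ r ∈ U, (f r : ℝ) ≤ ∏ r ∈ U, (τ * Real.exp (f r / τ)) := by
        refine Finset.prod_le_prod (fun _ _ => Nat.cast_nonneg _) fun r _ => ?_
        have := Real.add_one_le_exp ((f r : ℝ) / τ)
        rw [← div_le_iff₀' hτ]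
        linarith
    _ = τ ^ U.card * Real.exp (∑ r ∈ U, (f r : ℝ) / τ) := by
        rw [Finset.prod_mul_distrib, Finset.prod_const, Real.exp_sum]
    _ ≤ _ := by
        rw [← Finset.sum_div]
        gcongr

/-- The patterns with given messages, hidden rows `U` and group `W`: what `W` and `𝒥` see is
determined by the rows outside `U`, so in the rows of `U` only the few mispredicted gadgets can be
selected. -/
theorem card_hidden_le {un : Fin ℓ × Fin s → Bool → Pl}
    (hZ : ∀ x ∈ S, ∀ r, Z x (x.gadget r) = (x r).2)
    (hdet : ∀ x ∈ S, ∀ x' ∈ S, ∀ g b, m x (un g b) = m x' (un g b) → SameView vis (un g b) x x' →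
      Z x g = Z x' g)
    (hξ : ∀ x ∈ S, ∀ x' ∈ S, (∀ i ∈ 𝒥, m x i = m x' i) → (∀ i ∈ 𝒥, SameView vis i x x') →
      ξ x = ξ x')
    (hvis : ∀ g ∉ Q, ∀ b, Disjoint (vis g b) 𝒥)
    {Θ τ : ℝ} (hτ : 0 < τ)
    (hΘ : ∀ x ∈ S, ((Finset.univ.filter fun g => g ∉ Q ∧ Z x g ≠ ξ x g).card : ℝ) ≤ Θ)
    (W : Finset Pl) (U : Finset (Fin ℓ)) (F : Finset (Pattern ℓ s)) (hF : F ⊆ S)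
    (hm : ∀ x ∈ F, ∀ x' ∈ F, m x = m x')
    (hU : ∀ x ∈ F, U = hiddenRows vis un (surprises Q ξ x) W x) :
    (F.card : ℝ) ≤ (2 * s) ^ (ℓ - U.card) * (τ ^ U.card * Real.exp (Θ / τ)) := by
  classical
  have hU' : ∀ x ∈ F, ∀ r ∈ U, (x.gadget r ∉ Q ∧ (x r).2 ≠ ξ x (x.gadget r)) ∧
      un (x.gadget r) (x r).2 ∈ W ∧ Disjoint (vis (x.gadget r) (x r).2) W := fun x hx r hr => by
    rw [hU x hx, hiddenRows, Finset.mem_filter, mem_surprises] at hr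
    exact hr
  let rest : Pattern ℓ s → ({r // r ∉ U} → Fin s × Bool) := fun x r => x r
  have hfib : ∀ y ∈ F.image rest, (((F.filter fun x => rest x = y).card : ℕ) : ℝ) ≤
      τ ^ U.card * Real.exp (Θ / τ) := by
    intro y hy
    obtain ⟨x₀, hx₀, rfl⟩ := Finset.mem_image.1 hy
    let T : Fin ℓ → Finset (Fin s) := fun r =>
      Finset.univ.filter fun t => (r, t) ∉ Q ∧ Z x₀ (r, t) ≠ ξ x₀ (r, t)
    have hT : ∑ r ∈ U, ((T r).card : ℝ) ≤ Θ := by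
      refine le_trans ?_ (hΘ x₀ (hF hx₀))
      rw [← Nat.cast_sum, Nat.cast_le, ← Finset.card_sigma]
      refine Finset.card_le_card_of_injOn (fun p => (p.1, p.2)) ?_ ?_
      · rintro ⟨r, t⟩ h
        have h' := (Finset.mem_sigma.1 (Finset.mem_coe.1 h)).2
        have h'' := (Finset.mem_filter.1 h').2
        exact Finset.mem_coe.2 (Finset.mem_filter.2 ⟨Finset.mem_univ _, h''⟩)
      · rintro ⟨r, t⟩ _ ⟨r', t'⟩ _ h
        simp only [Prod.mk.injEq] at h
        obtain ⟨rfl, rfl⟩ := h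
        rfl
    -- members of the fibre agree outside `U`, and there lies all that `W` and `𝒥` can see
    have hrow : ∀ x ∈ F.filter fun x => rest x = rest x₀, ∀ r ∉ U, x r = x₀ r := fun x hx r hr =>
      congrFun (Finset.mem_filter.1 hx).2 ⟨r, hr⟩
    have hview : ∀ x ∈ F.filter fun x => rest x = rest x₀, ∀ i, i ∈ W ∨ i ∈ 𝒥 →
        SameView vis i x x₀ := by
      intro x hx i hi g b hg
      have hxF := (Finset.mem_filter.1 hx).1
      have key : ∀ x' ∈ F, x' g.1 = (g.2, b) → g.1 ∉ U := by
        intro x' hx' h hgU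
        obtain ⟨⟨k1, -⟩, -, k2⟩ := hU' x' hx' g.1 hgU
        have h1 : x'.gadget g.1 = g := by rw [Pattern.gadget, h]
        rw [h1] at k1 k2
        rw [h] at k2
        rcases hi with hi | hi
        · exact Finset.disjoint_left.1 k2 hg hi
        · exact Finset.disjoint_left.1 (hvis g k1 b) hg hi
      constructor <;> intro h
      · rw [← hrow x hx g.1 (key x hxF h), h]
      · rw [hrow x hx g.1 (key x₀ hx₀ h), h]
    have hval : ∀ x ∈ F.filter fun x => rest x = rest x₀, ∀ r ∈ U,
        (x r).1 ∈ T r ∧ (x r).2 = Z x₀ (r, (x r).1) := by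
      intro x hx r hr
      have hxF := (Finset.mem_filter.1 hx).1
      obtain ⟨⟨k1, k2⟩, k3, -⟩ := hU' x hxF r hr
      have e1 : ξ x = ξ x₀ := hξ x (hF hxF) x₀ (hF hx₀) (fun i _ => by rw [hm x hxF x₀ hx₀])
        fun i hi => hview x hx i (Or.inr hi)
      have e2 : Z x (x.gadget r) = Z x₀ (x.gadget r) :=
        hdet x (hF hxF) x₀ (hF hx₀) _ (x r).2 (by rw [hm x hxF x₀ hx₀]) (hview x hx _ (Or.inl k3))
      rw [← hZ x (hF hxF) r, e1, e2] at k2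
      refine ⟨Finset.mem_filter.2 ⟨Finset.mem_univ _, k1, k2⟩, ?_⟩
      rw [← hZ x (hF hxF) r, e2, Pattern.gadget]
    refine le_trans ?_ (prod_card_le_exp U (fun r => (T r).card) hτ hT)
    rw [← Nat.cast_prod, Nat.cast_le, ← Finset.card_pi]
    refine Finset.card_le_card_of_injOn (fun x r _ => (x r).1) ?_ ?_
    · intro x hx
      exact Finset.mem_coe.2 (Finset.mem_pi.2 fun r hr => (hval x hx r hr).1)
    · intro x hx x' hx' h
      funext r
      by_cases hr : r ∈ U
      · have h1 : (x r).1 = (x' r).1 := congrFun (congrFun h r) hr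
        exact Prod.ext h1 (by rw [(hval x hx r hr).2, (hval x' hx' r hr).2, h1])
      · rw [hrow x hx r hr, hrow x' hx' r hr]
  have himg : ((F.image rest).card : ℝ) ≤ (2 * s) ^ (ℓ - U.card) := by
    have h1 : (F.image rest).card ≤ Fintype.card ({r // r ∉ U} → Fin s × Bool) :=
      Finset.card_le_univ _
    have h2 : Fintype.card ({r // r ∉ U} → Fin s × Bool) = (2 * s) ^ (ℓ - U.card) := by
      rw [Fintype.card_fun, Fintype.card_prod, Fintype.card_fin, Fintype.card_bool, mul_comm]
      congr 1
      rw [Fintype.card_subtype_compl, Fintype.card_fin, Fintype.card_coe]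
    rw [h2] at h1
    exact_mod_cast h1
  rw [Finset.card_eq_sum_card_image rest F]
  push_cast
  refine (Finset.sum_le_sum hfib).trans ?_
  rw [Finset.sum_const, nsmul_eq_mul]
  exact mul_le_mul_of_nonneg_right himg (by positivity)

/-- Patterns with many surprises are few: for a suitable group `W` of players, an eighth of the
surprises happens in rows where `W` learns the output but sees nothing of the deletion. -/
theorem card_many_surprises_le {un : Fin ℓ × Fin s → Bool → Pl}
    (hZ : ∀ x ∈ S, ∀ r, Z x (x.gadget r) = (x r).2)
    (hdet : ∀ x ∈ S, ∀ x' ∈ S, ∀ g b, m x (un g b) = m x' (un g b) → SameView vis (un g b) x x' →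
      Z x g = Z x' g)
    (hξ : ∀ x ∈ S, ∀ x' ∈ S, (∀ i ∈ 𝒥, m x i = m x' i) → (∀ i ∈ 𝒥, SameView vis i x x') →
      ξ x = ξ x')
    (hvis : ∀ g ∉ Q, ∀ b, Disjoint (vis g b) 𝒥) (hvis2 : ∀ g b, (vis g b).card ≤ 2)
    (hun : ∀ g ∉ Q, ∀ b, un g b ∉ vis g b)
    {Θ τ : ℝ} (hτ : 0 < τ) (hτs : τ ≤ 2 * s)
    (hΘ : ∀ x ∈ S, ((Finset.univ.filter fun g => g ∉ Q ∧ Z x g ≠ ξ x g).card : ℝ) ≤ Θ)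
    (d : ℕ) :
    ((S.filter fun x => 8 * d < (surprises Q ξ x).card).card : ℝ) ≤
      2 ^ Fintype.card Pl * 2 ^ ℓ * Fintype.card M ^ Fintype.card Pl *
        ((2 * s) ^ ℓ * (τ / (2 * s)) ^ d * Real.exp (Θ / τ)) := by
  classical
  have hs : (0 : ℝ) < 2 * s := hτ.trans_le hτs
  set S' := S.filter fun x => 8 * d < (surprises Q ξ x).card with hS'
  have hW : ∀ x, ∃ W : Finset Pl, (surprises Q ξ x).card ≤
      8 * (hiddenRows vis un (surprises Q ξ x) W x).card := fun x =>
    exists_hiddenRows _ x (fun r hr => hun _ (mem_surprises.1 hr).1 _) fun r _ => hvis2 _ _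
  choose W hW using hW
  let code : Pattern ℓ s → Finset Pl × Finset (Fin ℓ) × (Pl → M) := fun x =>
    (W x, hiddenRows vis un (surprises Q ξ x) (W x) x, m x)
  have hfib : ∀ a ∈ S'.image code, (((S'.filter fun x => code x = a).card : ℕ) : ℝ) ≤
      (2 * s) ^ ℓ * (τ / (2 * s)) ^ d * Real.exp (Θ / τ) := by
    intro a ha
    obtain ⟨x₀, hx₀, rfl⟩ := Finset.mem_image.1 ha
    set U := hiddenRows vis un (surprises Q ξ x₀) (W x₀) x₀ with hU
    have hcode : ∀ x ∈ S'.filter fun x => code x = code x₀, W x = W x₀ ∧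
        hiddenRows vis un (surprises Q ξ x) (W x) x = U ∧ m x = m x₀ := fun x hx => by
      have := (Finset.mem_filter.1 hx).2
      simpa only [code, Prod.mk.injEq] using this
    have h1 := card_hidden_le hZ hdet hξ hvis hτ hΘ (W x₀) U
      (S'.filter fun x => code x = code x₀)
      (fun x hx => (Finset.mem_filter.1 (Finset.mem_filter.1 hx).1).1)
      (fun x hx x' hx' => (hcode x hx).2.2.trans (hcode x' hx').2.2.symm)
      (fun x hx => by rw [← (hcode x hx).2.1, (hcode x hx).1])
    refine h1.trans ?_
    have h2 : d ≤ U.card := by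
      have h3 := (Finset.mem_filter.1 hx₀).2
      have h4 := hW x₀
      rw [← hU] at h4
      omega
    have h3 : U.card ≤ ℓ := by simpa using Finset.card_le_univ U
    have h4 : ((2 * s : ℝ)) ^ (ℓ - U.card) * τ ^ U.card = (2 * s) ^ ℓ * (τ / (2 * s)) ^ U.card := by
      rw [div_pow, mul_div_assoc', eq_div_iff (by positivity), mul_right_comm, ← pow_add,
        Nat.sub_add_cancel h3]
    rw [← mul_assoc, h4]
    gcongr (2 * s : ℝ) ^ ℓ * ?_ * Real.exp (Θ / τ)
    exact pow_le_pow_of_le_one (by positivity) ((div_le_one hs).2 hτs) h2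
  rw [Finset.card_eq_sum_card_image code S']
  push_cast
  refine (Finset.sum_le_sum hfib).trans ?_
  rw [Finset.sum_const, nsmul_eq_mul]
  refine mul_le_mul_of_nonneg_right ?_ (by positivity)
  have h1 : (S'.image code).card ≤ Fintype.card (Finset Pl × Finset (Fin ℓ) × (Pl → M)) :=
    Finset.card_le_univ _
  rw [Fintype.card_prod, Fintype.card_prod, Fintype.card_finset, Fintype.card_finset,
    Fintype.card_fun, Fintype.card_fin, ← mul_assoc] at h1
  exact_mod_cast h1

end Counting

/-! ### Derandomized executions on gadgets -/

/-- A gadget is indexed by its row and its column. -/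
abbrev Slot (ℓ s : ℕ) : Type := Fin ℓ × Fin s

/-- The players that host the vertices of the gadgets. -/
structure Hosts (Pl X : Type) (ℓ s : ℕ) where
  /-- the host of the left leaf -/
  left : Slot ℓ s → Pl
  /-- the host of the centre -/
  center : Slot ℓ s → Pl
  /-- the hosts of the potential right leaves -/
  right : Slot ℓ s → X → Pl

namespace Hosts

variable {Pl X : Type} {ℓ s : ℕ} (h : Hosts Pl X ℓ s)

/-- All vertices of the gadget are hosted by different players. -/
def Good (g : Slot ℓ s) : Prop :=
  h.left g ≠ h.center g ∧ (∀ x, h.right g x ≠ h.left g ∧ h.right g x ≠ h.center g) ∧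
    Function.Injective (h.right g)

/-- The players that see the deletion of the left (`b = false`) or right (`b = true`) edge. -/
def visible [DecidableEq Pl] (π : Slot ℓ s → X) (g : Slot ℓ s) (b : Bool) : Finset Pl :=
  if b then {h.center g, h.right g (π g)} else {h.left g, h.center g}

/-- The host of the leaf that is not an endpoint of the deleted edge. -/
def unaware (π : Slot ℓ s → X) (g : Slot ℓ s) (b : Bool) : Pl :=
  if b then h.left g else h.right g (π g)

section Visible

variable [DecidableEq Pl]

theorem card_visible_le (π : Slot ℓ s → X) (g : Slot ℓ s) (b : Bool) :
    (h.visible π g b).card ≤ 2 := by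
  unfold visible
  split_ifs <;> exact Finset.card_le_two

theorem unaware_notMem {g : Slot ℓ s} (hg : h.Good g) (π : Slot ℓ s → X) (b : Bool) :
    h.unaware π g b ∉ h.visible π g b := by
  obtain ⟨h1, h2, -⟩ := hg
  cases b
  · simp [unaware, visible, (h2 (π g)).1, (h2 (π g)).2]
  · simp [unaware, visible, h1, (h2 (π g)).1.symm]

end Visible

/-- The good gadgets whose left leaf is hosted by `i`. This player sees nothing of the choice of
their right leaves. -/
structure Own (i : Pl) where
  /-- the position of the gadget -/
  slot : Slot ℓ s
  good : h.Good slot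
  left_eq : h.left slot = i

theorem Own.slot_injective {i : Pl} : Function.Injective (Own.slot : h.Own i → Slot ℓ s) := by
  rintro ⟨g, _, _⟩ ⟨g', _, _⟩ rfl
  rfl

noncomputable instance (i : Pl) : Fintype (h.Own i) :=
  Fintype.ofInjective Own.slot (Own.slot_injective h)

noncomputable instance (i : Pl) : LinearOrder (h.Own i) :=
  LinearOrder.lift' (fun g : h.Own i => toLex g.slot)
    (toLex.injective.comp (Own.slot_injective h))

/-- The other gadgets. -/
abbrev Other (i : Pl) : Type := {g : Slot ℓ s // ¬(h.Good g ∧ h.left g = i)}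

noncomputable instance (i : Pl) : Fintype (h.Other i) := by
  classical infer_instance

variable {i : Pl}

/-- The choices for the own gadgets of a player. -/
def own (i : Pl) (π : Slot ℓ s → X) : h.Own i → X := fun g => π g.slot

/-- The choices for the other gadgets. -/
def other (i : Pl) (π : Slot ℓ s → X) : h.Other i → X := fun g => π g.1

open Classical in
/-- Combines choices for the other and for the own gadgets of a player. -/
noncomputable def join (ρ : h.Other i → X) (σ : h.Own i → X) : Slot ℓ s → X := fun g =>
  if hg : h.Good g ∧ h.left g = i then σ ⟨g, hg.1, hg.2⟩ else ρ ⟨g, hg⟩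

theorem join_other_own (π : Slot ℓ s → X) : h.join (h.other i π) (h.own i π) = π := by
  funext g
  unfold join
  split_ifs <;> rfl

theorem own_join (ρ : h.Other i → X) (σ : h.Own i → X) : h.own i (h.join ρ σ) = σ := by
  funext g
  exact dif_pos ⟨g.good, g.left_eq⟩

theorem other_join (ρ : h.Other i → X) (σ : h.Own i → X) : h.other i (h.join ρ σ) = ρ := by
  funext g
  exact dif_neg g.2

theorem join_eq_of_not_own (ρ : h.Other i → X) (σ σ' : h.Own i → X) {g : Slot ℓ s}
    (hg : ¬(h.Good g ∧ h.left g = i)) : h.join ρ σ g = h.join ρ σ' g := by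
  rw [join, join, dif_neg hg, dif_neg hg]

theorem sum_other_own [Fintype X] {R : Type} [AddCommMonoid R]
    (F : (h.Other i → X) → (h.Own i → X) → R) :
    ∑ π : Slot ℓ s → X, F (h.other i π) (h.own i π) = ∑ ρ, ∑ σ, F ρ σ := by
  classical
  let e : (Slot ℓ s → X) ≃ (h.Other i → X) × (h.Own i → X) :=
    { toFun := fun π => (h.other i π, h.own i π)
      invFun := fun a => h.join a.1 a.2
      left_inv := fun π => h.join_other_own π
      right_inv := fun a => Prod.ext (h.other_join _ _) (h.own_join _ _) }
  rw [← Fintype.sum_prod_type' F, ← Equiv.sum_comp e]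
  rfl

theorem card_other_own [Fintype X] : Fintype.card (h.Other i → X) * Fintype.card (h.Own i → X) =
    Fintype.card (Slot ℓ s → X) := by
  have := h.sum_other_own (i := i) (R := ℕ) fun _ _ => 1
  simpa using this.symm

theorem sum_card_own_le [Fintype Pl] : ∑ i, Fintype.card (h.Own i) ≤ ℓ * s := by
  classical
  have h1 : Fintype.card (Σ i, h.Own i) ≤ Fintype.card (Slot ℓ s) := by
    refine Fintype.card_le_of_injective (fun g => g.2.slot) ?_
    rintro ⟨i, g, hg, rfl⟩ ⟨i', g', hg', rfl⟩ hgg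
    obtain rfl : g = g' := hgg
    rfl
  simpa using h1

theorem mem_visible_join [DecidableEq Pl] (ρ : h.Other i → X) (σ σ' : h.Own i → X) (g : Slot ℓ s)
    (b : Bool) : i ∈ h.visible (h.join ρ σ) g b ↔ i ∈ h.visible (h.join ρ σ') g b := by
  cases b
  · rfl
  · by_cases hg : h.Good g ∧ h.left g = i
    · obtain ⟨⟨h1, h2, -⟩, rfl⟩ := hg
      simp [visible, h1, (h2 _).1.symm]
    · simp only [visible, h.join_eq_of_not_own ρ σ σ' hg]

end Hosts

/-- A deterministic algorithm on the gadgets, after the choice of the right leaves has been revealed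
column by column, and one edge per row has been deleted. -/
structure Execution (Pl M₁ M₂ X : Type) [DecidableEq Pl] (ℓ s : ℕ) extends Hosts Pl X ℓ s where
  /-- the messages that a player receives before the deletions -/
  early : (Slot ℓ s → X) → Pl → M₁
  /-- the messages that a player receives after the deletions -/
  late : (Slot ℓ s → X) → Pattern ℓ s → Pl → M₂
  /-- whether the host of the left leaf outputs the left edge -/
  leftOut : (Slot ℓ s → X) → Pattern ℓ s → Slot ℓ s → Bool
  /-- whether the host of the right leaf outputs the right edge -/
  rightOut : (Slot ℓ s → X) → Pattern ℓ s → Slot ℓ s → Bool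
  /-- the patterns for which the output is correct -/
  success : (Slot ℓ s → X) → Finset (Pattern ℓ s)
  /-- a correct output matches exactly one of the two leaves -/
  rightOut_eq : ∀ π, ∀ x ∈ success π, ∀ g, rightOut π x g = !leftOut π x g
  /-- a correct output does not contain the deleted edge -/
  leftOut_gadget : ∀ π, ∀ x ∈ success π, ∀ r, leftOut π x (x.gadget r) = (x r).2
  /-- the output of the host of a left leaf is determined by its messages and its local inputs -/
  leftOut_congr : ∀ π π' x x' g, early π (left g) = early π' (left g) →
    late π x (left g) = late π' x' (left g) →
    (∀ g', center g' = left g ∨ right g' (π g') = left g ∨ right g' (π' g') = left g →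
      π g' = π' g') →
    SameView (toHosts.visible π) (left g) x x' → leftOut π x g = leftOut π' x' g
  /-- the same for the host of a right leaf, once all right leaves are known -/
  rightOut_congr : ∀ π x x' g, late π x (right g (π g)) = late π x' (right g (π g)) →
    SameView (toHosts.visible π) (right g (π g)) x x' → rightOut π x g = rightOut π x' g

namespace Execution

variable {Pl M₁ M₂ X : Type} [Fintype Pl] [DecidableEq Pl] [Fintype M₁] [DecidableEq M₁]
  [Fintype M₂] [DecidableEq M₂] [Fintype X] [DecidableEq X] {ℓ s w : ℕ} [NeZero w]
  (E : Execution Pl M₁ M₂ X ℓ s)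

/-- The deletions in the pattern `x` that player `i` sees. -/
def view (i : Pl) (π : Slot ℓ s → X) (x : Pattern ℓ s) : Finset (Slot ℓ s × Bool) :=
  {a | i ∈ E.visible π a.1 a.2 ∧ x a.1.1 = (a.1.2, a.2)}

open Classical in
/-- The deletions that player `i` may see. These do not depend on the right leaves of its own
gadgets, see `mem_viewable`, so that they can serve to define the prior below. -/
noncomputable def viewable (i : Pl) (ρ : E.Other i → X) : Finset (Slot ℓ s × Bool) :=
  {a | ∃ σ, i ∈ E.visible (E.join ρ σ) a.1 a.2}

/-- The early messages of player `i` as a function of the choices for its own gadgets. -/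
noncomputable def ownEarly (i : Pl) (ρ : E.Other i → X) (σ : E.Own i → X) : M₁ :=
  E.early (E.join ρ σ) i

open Classical in
/-- The outputs of player `i` for its own gadgets as a function of its early messages, its late
messages, and the deletions it sees. -/
noncomputable def ownOut (i : Pl) (ρ : E.Other i → X) (μ : M₁)
    (a : M₂ × Finset (Slot ℓ s × Bool)) (g : E.Own i) : Bool :=
  decide (∃ σ x, E.early (E.join ρ σ) i = μ ∧ E.late (E.join ρ σ) x i = a.1 ∧
    E.view i (E.join ρ σ) x = a.2 ∧ E.leftOut (E.join ρ σ) x g.slot = true)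

open Classical in
/-- The prior weight of the late messages and of the view of player `i`: uniform messages, and
every viewable deletion independently with odds `1 / (2 * s)`. -/
noncomputable def prior (i : Pl) (ρ : E.Other i → X) (a : M₂ × Finset (Slot ℓ s × Bool)) : ℝ :=
  if a.2 ⊆ E.viewable i ρ then
    1 / Fintype.card M₂ * ((1 / (2 * s)) ^ a.2.card / (1 / (2 * s) + 1) ^ (E.viewable i ρ).card)
  else 0

theorem prior_nonneg (i : Pl) (ρ : E.Other i → X) (a : M₂ × Finset (Slot ℓ s × Bool)) :
    0 ≤ E.prior i ρ a := by
  unfold prior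
  split_ifs <;> positivity

theorem sum_prior_le (i : Pl) (ρ : E.Other i → X) : ∑ a, E.prior i ρ a ≤ 1 := by
  classical
  have h0 : (0 : ℝ) < (1 / (2 * s) + 1) ^ (E.viewable i ρ).card := by positivity
  have h1 : ∀ m : M₂, ∑ v, E.prior i ρ (m, v) = 1 / Fintype.card M₂ := by
    intro m
    have h2 := Finset.sum_pow_mul_eq_add_pow (1 / (2 * s) : ℝ) 1 (E.viewable i ρ)
    simp only [one_pow, mul_one] at h2
    simp only [prior]
    rw [← Finset.sum_filter, ← Finset.mul_sum, ← Finset.sum_div]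
    have h3 : (Finset.univ.filter fun v => v ⊆ E.viewable i ρ) = (E.viewable i ρ).powerset := by
      ext v
      simp
    rw [h3, h2, div_self h0.ne', mul_one]
  rw [Fintype.sum_prod_type]
  simp only [h1, Finset.sum_const, Finset.card_univ, nsmul_eq_mul, mul_one_div]
  exact div_self_le_one _

/-- The potential of the predictor of player `i`. -/
noncomputable def ownPotential (i : Pl) (c : Pl → Fin w) (π : Slot ℓ s → X) : ℝ :=
  potential (fun g : E.Own i => E.right g.slot) (E.ownEarly i (E.other i π)) (E.prior i (E.other i π))
    (E.ownOut i (E.other i π)) c (E.own i π)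

theorem ownPotential_nonneg (i : Pl) (c : Pl → Fin w) (π : Slot ℓ s → X) :
    0 ≤ E.ownPotential i c π := potential_nonneg (E.prior_nonneg i _) _

theorem sum_ownPotential_le (i : Pl) (c : Pl → Fin w) :
    ∑ π, E.ownPotential i c π ≤ Fintype.card (Slot ℓ s → X) := by
  unfold ownPotential
  rw [E.sum_other_own (i := i) fun ρ σ =>
    potential (fun g : E.Own i => E.right g.slot) (E.ownEarly i ρ) (E.prior i ρ) (E.ownOut i ρ) c σ]
  refine (Finset.sum_le_sum fun ρ _ =>
    sum_potential_le (E.prior_nonneg i ρ) (E.sum_prior_le i ρ)).trans ?_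
  rw [Finset.sum_const, nsmul_eq_mul, Finset.card_univ, ← Nat.cast_mul, E.card_other_own]

/-- The coordinate of the own gadget `g` of player `i` is skewed. -/
def OwnSkewed (i : Pl) (c : Pl → Fin w) (π : Slot ℓ s → X) (g : E.Own i) : Prop :=
  Skewed (fun g : E.Own i => E.right g.slot) c
    (fiber (E.ownEarly i (E.other i π)) (E.ownEarly i (E.other i π) (E.own i π))) (E.own i π) g

noncomputable instance (i : Pl) (c : Pl → Fin w) (π : Slot ℓ s → X) (g : E.Own i) :
    Decidable (E.OwnSkewed i c π g) := inferInstanceAs (Decidable (Skewed _ _ _ _ _))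

theorem sum_card_ownSkewed_le (i : Pl) {q τ : ℕ} (hq : 2 ≤ q) (hX : Fintype.card X = q ^ 2)
    (hτ : Fintype.card M₁ * 2 ^ Fintype.card (E.Own i) ≤ q ^ τ) :
    ∑ π, ∑ c : Pl → Fin w, ((Finset.univ.filter fun g => E.OwnSkewed i c π g).card : ℝ) ≤
      Fintype.card (Slot ℓ s → X) * Fintype.card (Pl → Fin w) *
        (4 * (τ + 1) + Fintype.card (E.Own i) * (16 * w / q)) := by
  unfold OwnSkewed
  have h1 := E.sum_other_own (i := i) fun ρ σ => ∑ c : Pl → Fin w,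
    ((Finset.univ.filter fun g => Skewed (fun g : E.Own i => E.right g.slot) c
      (fiber (E.ownEarly i ρ) (E.ownEarly i ρ σ)) σ g).card : ℝ)
  refine (le_of_eq h1).trans ((Finset.sum_le_sum fun ρ _ => sum_card_skewed_le _
    (fun g => g.good.2.2) (E.ownEarly i ρ) hq hX hτ).trans ?_)
  rw [Finset.sum_const, nsmul_eq_mul, Finset.card_univ, ← E.card_other_own (i := i)]
  push_cast
  rw [mul_assoc, mul_assoc, mul_assoc]

open Classical in
/-- The gadgets about which nothing is predicted: those that are not good, those whose coordinate
is skewed, and those of which a player of colour `0` hosts a vertex. -/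
noncomputable def excluded (c : Pl → Fin w) (π : Slot ℓ s → X) : Finset (Slot ℓ s) :=
  {g | ¬E.Good g ∨ (∃ hg : E.Good g, E.OwnSkewed (E.left g) c π ⟨g, hg, rfl⟩) ∨
    c (E.left g) = 0 ∨ c (E.center g) = 0 ∨ c (E.right g (π g)) = 0}

theorem notMem_excluded {c : Pl → Fin w} {π : Slot ℓ s → X} {g : Slot ℓ s}
    (hg : g ∉ E.excluded c π) :
    ∃ h : E.Good g, ¬E.OwnSkewed (E.left g) c π ⟨g, h, rfl⟩ ∧
      c (E.left g) ≠ 0 ∧ c (E.center g) ≠ 0 ∧ c (E.right g (π g)) ≠ 0 := by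
  classical
  simp only [excluded, Finset.mem_filter, Finset.mem_univ, true_and] at hg
  push Not at hg
  obtain ⟨h1, h2, h3⟩ := hg
  exact ⟨h1, h2 h1, h3⟩

/-- The prediction of the outputs of player `i`, from those for its own gadgets whose right leaf is
hosted by a player of colour `0`. -/
noncomputable def ownGuess (i : Pl) (c : Pl → Fin w) (π : Slot ℓ s → X) (x : Pattern ℓ s)
    (g : E.Own i) : Bool :=
  predict (fun g : E.Own i => E.right g.slot) c (E.prior i (E.other i π))
    (E.ownOut i (E.other i π) (E.ownEarly i (E.other i π) (E.own i π)))
    (fun g' => E.leftOut π x g'.slot) (E.own i π) g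

open Classical in
/-- The prediction of the output for a good gadget by the host of its left leaf. -/
noncomputable def guess (c : Pl → Fin w) (π : Slot ℓ s → X) (x : Pattern ℓ s) (g : Slot ℓ s) :
    Bool :=
  if hg : E.Good g then E.ownGuess (E.left g) c π x ⟨g, hg, rfl⟩ else false

theorem mem_viewable (i : Pl) (π : Slot ℓ s → X) (g : Slot ℓ s) (b : Bool) :
    (g, b) ∈ E.viewable i (E.other i π) ↔ i ∈ E.visible π g b := by
  classical
  simp only [viewable, Finset.mem_filter, Finset.mem_univ, true_and]
  constructor
  · rintro ⟨σ, hσ⟩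
    rw [E.mem_visible_join _ σ (E.own i π), E.join_other_own] at hσ
    exact hσ
  · intro h
    exact ⟨E.own i π, by rwa [E.join_other_own]⟩

/-- The own outputs of a player are determined by what it has learnt. -/
theorem ownOut_eq (i : Pl) (π : Slot ℓ s → X) (x : Pattern ℓ s) (g : E.Own i) :
    E.ownOut i (E.other i π) (E.ownEarly i (E.other i π) (E.own i π)) (E.late π x i, E.view i π x) g =
      E.leftOut π x g.slot := by
  classical
  have key : ∀ σ x', E.early (E.join (E.other i π) σ) i = E.early π i →
      E.late (E.join (E.other i π) σ) x' i = E.late π x i →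
      E.view i (E.join (E.other i π) σ) x' = E.view i π x →
      E.leftOut (E.join (E.other i π) σ) x' g.slot = E.leftOut π x g.slot := by
    intro σ x' h1 h2 h3
    obtain ⟨g, hg, rfl⟩ := g
    have hvis : ∀ g' b, E.left g ∈ E.visible (E.join (E.other (E.left g) π) σ) g' b ↔
        E.left g ∈ E.visible π g' b := fun g' b => by
      rw [E.mem_visible_join _ σ (E.own _ π), E.join_other_own]
    refine E.leftOut_congr _ _ _ _ _ h1 h2 (fun g' hg' => ?_) fun g' b hg' => ?_
    · by_cases ho : E.Good g' ∧ E.left g' = E.left g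
      · exfalso
        obtain ⟨⟨k1, k2, -⟩, k3⟩ := ho
        rcases hg' with h | h | h
        · exact k1 (k3.trans h.symm)
        · exact (k2 _).1 (h.trans k3.symm)
        · exact (k2 _).1 (h.trans k3.symm)
      · exact dif_neg ho
    · have := Finset.ext_iff.1 h3 (g', b)
      simp only [view, Finset.mem_filter, Finset.mem_univ, true_and, hg', (hvis g' b).1 hg'] at this
      exact this
  unfold ownOut ownEarly
  rw [E.join_other_own, Bool.eq_iff_iff, decide_eq_true_iff]
  refine ⟨?_, fun h => ?_⟩
  · rintro ⟨σ, x', h1, h2, h3, h4⟩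
    rw [← key σ x' h1 h2 h3]
    exact h4
  · exact ⟨E.own i π, x, by rw [E.join_other_own], by rw [E.join_other_own],
      by rw [E.join_other_own], by rw [E.join_other_own]; exact h⟩

/-! ### What the players of colour `0` and the unaware players know -/

/-- In a correct output, the host of the leaf that is not affected by a deletion determines the output
for the gadget, whether its leaf is the left or the right one. -/
theorem leftOut_eq_of_unaware {π : Slot ℓ s → X} {x x' : Pattern ℓ s} (hx : x ∈ E.success π)
    (hx' : x' ∈ E.success π) (g : Slot ℓ s) (b : Bool)
    (hm : E.late π x (E.unaware π g b) = E.late π x' (E.unaware π g b))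
    (hv : SameView (E.visible π) (E.unaware π g b) x x') :
    E.leftOut π x g = E.leftOut π x' g := by
  cases b
  · have := E.rightOut_congr π x x' g hm hv
    rw [E.rightOut_eq π x hx, E.rightOut_eq π x' hx'] at this
    simpa using this
  · exact E.leftOut_congr π π x x' g rfl hm (fun _ _ => rfl) hv

/-- The predictions are a function of what the players of colour `0` learn. -/
theorem guess_congr (c : Pl → Fin w) {π : Slot ℓ s → X} {x x' : Pattern ℓ s}
    (hx : x ∈ E.success π) (hx' : x' ∈ E.success π)
    (hm : ∀ i ∈ Finset.univ.filter fun i => c i = 0, E.late π x i = E.late π x' i)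
    (hv : ∀ i ∈ Finset.univ.filter fun i => c i = 0, SameView (E.visible π) i x x') :
    E.guess c π x = E.guess c π x' := by
  funext g
  unfold guess ownGuess
  split_ifs with hg
  · refine predict_congr (fun _ _ => Iff.rfl) fun g' _ hr => ?_
    have h0 : E.unaware π g'.slot false ∈ Finset.univ.filter fun i => c i = 0 :=
      Finset.mem_filter.2 ⟨Finset.mem_univ _, hr⟩
    exact E.leftOut_eq_of_unaware hx hx' g'.slot false (hm _ h0) (hv _ h0)
  · rfl

/-- Outside the excluded gadgets, the players of colour `0` see no deletion. -/
theorem disjoint_visible {c : Pl → Fin w} {π : Slot ℓ s → X} {g : Slot ℓ s}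
    (hg : g ∉ E.excluded c π) (b : Bool) :
    Disjoint (E.visible π g b) (Finset.univ.filter fun i => c i = 0) := by
  obtain ⟨-, -, h1, h2, h3⟩ := E.notMem_excluded hg
  rw [Finset.disjoint_left]
  intro i hi
  cases b <;> simp only [Hosts.visible, Bool.false_eq_true, if_false, if_true, Finset.mem_insert,
    Finset.mem_singleton] at hi <;> rcases hi with rfl | rfl <;> simp [h1, h2, h3]

/-! ### The number of wrong predictions -/

open Classical in
/-- The own gadgets of player `i` that are neither revealed nor skewed, and for which the prediction
is wrong. -/
noncomputable def mistakes (i : Pl) (c : Pl → Fin w) (π : Slot ℓ s → X) (x : Pattern ℓ s) :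
    Finset (E.Own i) :=
  {g | ¬Revealed (fun g : E.Own i => E.right g.slot) c (E.own i π) g ∧
    ¬E.OwnSkewed i c π g ∧ E.leftOut π x g.slot ≠ E.ownGuess i c π x g}

/-- The number of mistakes is bounded by the logarithm of the inverse prior weight of what player `i`
has learnt after the deletions, and by the potential. -/
theorem card_mistakes_le (hs : 0 < s) (i : Pl) (c : Pl → Fin w) (π : Slot ℓ s → X)
    (x : Pattern ℓ s) :
    ((E.mistakes i c π x).card : ℝ) ≤ 8 * w * (E.ownPotential i c π +
      2 * (Real.log (Fintype.card M₂) + (E.view i π x).card * Real.log (2 * s) +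
        (E.viewable i (E.other i π)).card / (2 * s))) := by
  classical
  have hw : (0 : ℝ) < w := by exact_mod_cast Nat.pos_of_ne_zero (NeZero.ne w)
  have hw1 : (1 : ℝ) ≤ w := by exact_mod_cast Nat.pos_of_ne_zero (NeZero.ne w)
  have hs' : (0 : ℝ) < s := by exact_mod_cast hs
  have : Nonempty M₂ := ⟨E.late π x i⟩
  have hM : (0 : ℝ) < Fintype.card M₂ := by exact_mod_cast Fintype.card_pos
  set a : M₂ × Finset (Slot ℓ s × Bool) := (E.late π x i, E.view i π x) with ha
  have hsub : E.view i π x ⊆ E.viewable i (E.other i π) := by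
    rintro ⟨g, b⟩ h
    exact (E.mem_viewable i π g b).2 (Finset.mem_filter.1 h).2.1
  have hζ : E.ownOut i (E.other i π) (E.ownEarly i (E.other i π) (E.own i π)) a =
      fun g => E.leftOut π x g.slot := funext fun g => E.ownOut_eq i π x g
  have hpot := pow_mistakes_le_potential (J := fun g : E.Own i => E.right g.slot)
    (m := E.ownEarly i (E.other i π)) (ζ := E.ownOut i (E.other i π)) (c := c)
    (E.prior_nonneg i (E.other i π)) (E.sum_prior_le i (E.other i π)) (E.own i π) a
  rw [hζ] at hpot
  have hset : (Finset.univ.filter fun g : E.Own i =>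
      ¬Revealed (fun g : E.Own i => E.right g.slot) c (E.own i π) g ∧
      ¬Skewed (fun g : E.Own i => E.right g.slot) c
        (fiber (E.ownEarly i (E.other i π)) (E.ownEarly i (E.other i π) (E.own i π)))
        (E.own i π) g ∧
      E.leftOut π x g.slot ≠ predict (fun g : E.Own i => E.right g.slot) c
        (E.prior i (E.other i π))
        (E.ownOut i (E.other i π) (E.ownEarly i (E.other i π) (E.own i π)))
        (fun g' => E.leftOut π x g'.slot) (E.own i π) g) = E.mistakes i c π x := by
    ext g
    simp only [mistakes, Finset.mem_filter, Finset.mem_univ, true_and]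
    rfl
  rw [hset] at hpot
  change _ ≤ E.ownPotential i c π at hpot
  set U := E.ownPotential i c π
  set N := (E.mistakes i c π x).card
  have hprior : E.prior i (E.other i π) a = 1 / Fintype.card M₂ *
      ((1 / (2 * s)) ^ (E.view i π x).card /
        (1 / (2 * s) + 1) ^ (E.viewable i (E.other i π)).card) := if_pos hsub
  have hp0 : 0 < E.prior i (E.other i π) a := by
    rw [hprior]
    positivity
  have hU : 0 < U := lt_of_lt_of_le (by positivity) hpot
  have hlog := Real.log_le_log (by positivity) hpot
  rw [Real.log_mul (by positivity) (by positivity), Real.log_pow, Real.log_pow] at hlog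
  have h1 : Real.log U ≤ U := (Real.log_le_sub_one_of_pos hU).trans (by linarith)
  have h2 : 1 / (8 * (w : ℝ)) ≤ Real.log (1 + 1 / (4 * w)) := by
    have h3 := Real.one_sub_inv_le_log_of_pos (x := 1 + 1 / (4 * (w : ℝ))) (by positivity)
    refine le_trans ?_ h3
    have h4 : 1 - (1 + 1 / (4 * (w : ℝ)))⁻¹ = 1 / (4 * w + 1) := by
      field_simp
      ring
    rw [h4]
    exact one_div_le_one_div_of_le (by positivity) (by linarith)
  have h3 : Real.log (E.prior i (E.other i π) a) = -(Real.log (Fintype.card M₂) +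
      (E.view i π x).card * Real.log (2 * s) +
      (E.viewable i (E.other i π)).card * Real.log (1 / (2 * s) + 1)) := by
    have e1 : Real.log (1 / Fintype.card M₂) = -Real.log (Fintype.card M₂) := by
      rw [one_div, Real.log_inv]
    have e2 : Real.log (1 / (2 * s)) = -Real.log (2 * s) := by rw [one_div, Real.log_inv]
    rw [hprior, Real.log_mul (by positivity) (by positivity), e1,
      Real.log_div (by positivity) (by positivity), Real.log_pow, Real.log_pow, e2]
    ring
  have h4 : Real.log (1 / (2 * s) + 1) ≤ 1 / (2 * (s : ℝ)) := by
    have := Real.log_le_sub_one_of_pos (x := 1 / (2 * (s : ℝ)) + 1) (by positivity)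
    linarith
  have h5 : ((E.viewable i (E.other i π)).card : ℝ) * Real.log (1 / (2 * s) + 1) ≤
      (E.viewable i (E.other i π)).card / (2 * s) :=
    (mul_le_mul_of_nonneg_left h4 (Nat.cast_nonneg _)).trans (le_of_eq (mul_one_div _ _))
  have h6 : (N : ℝ) * (1 / (8 * w)) ≤ N * Real.log (1 + 1 / (4 * w)) := by gcongr
  have h7 : (N : ℝ) * (1 / (8 * w)) ≤ U + 2 * (Real.log (Fintype.card M₂) +
      (E.view i π x).card * Real.log (2 * s) + (E.viewable i (E.other i π)).card / (2 * s)) := by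
    rw [h3] at hlog
    push_cast at hlog
    linarith
  rw [mul_one_div, div_le_iff₀ (by positivity)] at h7
  linarith

/-- Every deletion is seen by at most two players. -/
theorem sum_card_view_le (π : Slot ℓ s → X) (x : Pattern ℓ s) :
    ∑ i, (E.view i π x).card ≤ 2 * ℓ := by
  have h1 : ∑ i, (E.view i π x).card =
      ∑ a ∈ Finset.univ.filter fun a : Slot ℓ s × Bool => x a.1.1 = (a.1.2, a.2),
        (E.visible π a.1 a.2).card := by
    simp only [view, Finset.card_filter]
    rw [Finset.sum_comm, Finset.sum_filter]
    refine Finset.sum_congr rfl fun a _ => ?_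
    split_ifs with h
    · simp [h]
    · simp [h]
  have h2 : (Finset.univ.filter fun a : Slot ℓ s × Bool => x a.1.1 = (a.1.2, a.2)).card ≤ ℓ := by
    refine (Finset.card_le_card_of_injOn (t := (Finset.univ : Finset (Fin ℓ))) (fun a => a.1.1)
      (fun _ _ => Finset.mem_coe.2 (Finset.mem_univ _)) ?_).trans (by simp)
    rintro ⟨⟨r, t⟩, b⟩ h ⟨⟨r', t'⟩, b'⟩ h' hr
    obtain rfl : r = r' := hr
    have e1 : x r = (t, b) := (Finset.mem_filter.1 h).2
    have e2 : x r = (t', b') := (Finset.mem_filter.1 h').2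
    obtain ⟨rfl, rfl⟩ := Prod.mk.inj (e1.symm.trans e2)
    rfl
  rw [h1]
  refine (Finset.sum_le_sum fun a _ => E.card_visible_le π a.1 a.2).trans ?_
  rw [Finset.sum_const, smul_eq_mul]
  omega

theorem sum_card_viewable_le (π : Slot ℓ s → X) :
    ∑ i, (E.viewable i (E.other i π)).card ≤ 4 * (ℓ * s) := by
  classical
  have h1 : ∀ i, (E.viewable i (E.other i π)).card =
      (Finset.univ.filter fun a : Slot ℓ s × Bool => i ∈ E.visible π a.1 a.2).card := fun i => by
    congr 1
    ext ⟨g, b⟩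
    rw [E.mem_viewable]
    simp
  have h2 : ∑ i, (E.viewable i (E.other i π)).card =
      ∑ a : Slot ℓ s × Bool, (E.visible π a.1 a.2).card := by
    simp only [h1, Finset.card_filter]
    rw [Finset.sum_comm]
    refine Finset.sum_congr rfl fun a _ => ?_
    simp
  rw [h2]
  refine (Finset.sum_le_sum fun a _ => E.card_visible_le π a.1 a.2).trans ?_
  rw [Finset.sum_const, smul_eq_mul, Finset.card_univ]
  simp only [Fintype.card_prod, Fintype.card_fin, Fintype.card_bool]
  omega

open Classical in
/-- Outside the excluded gadgets, few predictions are wrong. -/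
theorem card_wrong_guesses_le (hs : 0 < s) (c : Pl → Fin w) (π : Slot ℓ s → X)
    (x : Pattern ℓ s) :
    ((Finset.univ.filter fun g => g ∉ E.excluded c π ∧
      E.leftOut π x g ≠ E.guess c π x g).card : ℝ) ≤
      8 * w * (∑ i, E.ownPotential i c π + 2 * (Fintype.card Pl * Real.log (Fintype.card M₂) +
        2 * ℓ * Real.log (2 * s) + 2 * ℓ)) := by
  have hs' : (0 : ℝ) < s := by exact_mod_cast hs
  have h1 : (Finset.univ.filter fun g => g ∉ E.excluded c π ∧
      E.leftOut π x g ≠ E.guess c π x g).card ≤ ∑ i, (E.mistakes i c π x).card := by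
    rw [← Finset.card_sigma]
    refine le_trans (Finset.card_le_card ?_)
      (Finset.card_image_le (f := fun p : Σ i, E.Own i => p.2.slot))
    intro g hg
    obtain ⟨h1, h2⟩ := (Finset.mem_filter.1 hg).2
    obtain ⟨hgood, h3, -, -, h4⟩ := E.notMem_excluded h1
    refine Finset.mem_image.2 ⟨⟨E.left g, ⟨g, hgood, rfl⟩⟩, Finset.mem_sigma.2
      ⟨Finset.mem_univ _, Finset.mem_filter.2 ⟨Finset.mem_univ _, h4, h3, ?_⟩⟩, rfl⟩
    rwa [guess, dif_pos hgood] at h2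
  have h2 : ((∑ i, (E.mistakes i c π x).card : ℕ) : ℝ) ≤ ∑ i, 8 * w * (E.ownPotential i c π +
      2 * (Real.log (Fintype.card M₂) + (E.view i π x).card * Real.log (2 * s) +
        (E.viewable i (E.other i π)).card / (2 * s))) := by
    push_cast
    exact Finset.sum_le_sum fun i _ => E.card_mistakes_le hs i c π x
  have h3 : ∑ i, ((E.view i π x).card : ℝ) ≤ 2 * ℓ := by exact_mod_cast E.sum_card_view_le π x
  have h4 : ∑ i, ((E.viewable i (E.other i π)).card : ℝ) ≤ 4 * (ℓ * s) := by
    exact_mod_cast E.sum_card_viewable_le π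
  have h5 : 0 ≤ Real.log (2 * s) := by
    refine Real.log_nonneg ?_
    have : (1 : ℝ) ≤ s := by exact_mod_cast hs
    linarith
  calc _ ≤ ((∑ i, (E.mistakes i c π x).card : ℕ) : ℝ) := by exact_mod_cast h1
    _ ≤ _ := h2
    _ = 8 * w * (∑ i, E.ownPotential i c π + 2 * (Fintype.card Pl * Real.log (Fintype.card M₂) +
        (∑ i, ((E.view i π x).card : ℝ)) * Real.log (2 * s) +
        (∑ i, ((E.viewable i (E.other i π)).card : ℝ)) / (2 * s))) := by
      rw [← Finset.mul_sum, Finset.sum_add_distrib, ← Finset.mul_sum, Finset.sum_add_distrib,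
        Finset.sum_add_distrib, Finset.sum_mul, Finset.sum_div, Finset.sum_const, nsmul_eq_mul,
        Finset.card_univ]
    _ ≤ _ := by
      have h6 : (∑ i, ((E.viewable i (E.other i π)).card : ℝ)) / (2 * s) ≤ 2 * ℓ := by
        rw [div_le_iff₀ (by positivity)]
        linarith
      gcongr

/-! ### The number of excluded gadgets -/

/-- A player has the colour `0` with probability `1 / w`. -/
theorem mul_card_colour_zero (i : Pl) :
    w * (Finset.univ.filter fun c : Pl → Fin w => c i = 0).card = Fintype.card (Pl → Fin w) := by
  have h := card_mul_sum_colour (w := w) i (fun d => if d = 0 then 1 else 0) (fun _ => 1)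
    fun _ _ => rfl
  simp only [mul_one, Finset.sum_boole, Finset.sum_const, Finset.card_univ, nsmul_eq_mul,
    Finset.filter_eq', Finset.mem_univ, if_true, Finset.card_singleton, Nat.cast_one,
    one_mul] at h
  exact_mod_cast h

open Classical in
/-- The mean number of excluded gadgets. The exponents `τ i` measure what player `i` has learnt before
the deletions. -/
theorem sum_card_excluded_le {q : ℕ} (τ : Pl → ℕ) (hq : 2 ≤ q) (hX : Fintype.card X = q ^ 2)
    (hτ : ∀ i, Fintype.card M₁ * 2 ^ Fintype.card (E.Own i) ≤ q ^ τ i) :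
    ∑ π, ∑ c : Pl → Fin w, ((E.excluded c π).card : ℝ) ≤
      Fintype.card (Slot ℓ s → X) * Fintype.card (Pl → Fin w) *
        ((Finset.univ.filter fun g => ¬E.Good g).card +
          (∑ i, 4 * ((τ i : ℝ) + 1) + ℓ * s * (16 * w / q)) + ℓ * s * (3 / w)) := by
  have hw : (0 : ℝ) < w := by exact_mod_cast Nat.pos_of_ne_zero (NeZero.ne w)
  have h1 : ∀ π, ∀ c : Pl → Fin w, ((E.excluded c π).card : ℝ) ≤
      (Finset.univ.filter fun g => ¬E.Good g).card +
      ∑ i, ((Finset.univ.filter fun g => E.OwnSkewed i c π g).card : ℝ) +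
      ∑ g, ((if c (E.left g) = 0 then 1 else 0) + (if c (E.center g) = 0 then 1 else 0) +
        (if c (E.right g (π g)) = 0 then 1 else 0) : ℝ) := by
    intro π c
    have h2 : E.excluded c π ⊆ (Finset.univ.filter fun g => ¬E.Good g) ∪
        ((Finset.univ.sigma fun i => Finset.univ.filter fun g => E.OwnSkewed i c π g).image
          fun p : Σ i, E.Own i => p.2.slot) ∪
        (Finset.univ.filter fun g => c (E.left g) = 0 ∨ c (E.center g) = 0 ∨
          c (E.right g (π g)) = 0) := by
      intro g hg
      rcases (Finset.mem_filter.1 hg).2 with h | ⟨h, h'⟩ | h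
      · exact Finset.mem_union_left _ (Finset.mem_union_left _ (by simpa using h))
      · refine Finset.mem_union_left _ (Finset.mem_union_right _ (Finset.mem_image.2
          ⟨⟨E.left g, ⟨g, h, rfl⟩⟩, Finset.mem_sigma.2 ⟨Finset.mem_univ _, ?_⟩, rfl⟩))
        exact Finset.mem_filter.2 ⟨Finset.mem_univ _, h'⟩
      · exact Finset.mem_union_right _ (by simpa using h)
    have h3 : ((Finset.univ.filter fun g => c (E.left g) = 0 ∨ c (E.center g) = 0 ∨
        c (E.right g (π g)) = 0).card : ℝ) ≤
        ∑ g, ((if c (E.left g) = 0 then 1 else 0) + (if c (E.center g) = 0 then 1 else 0) +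
          (if c (E.right g (π g)) = 0 then 1 else 0) : ℝ) := by
      rw [Finset.card_filter]
      push_cast
      refine Finset.sum_le_sum fun g _ => ?_
      by_cases k1 : c (E.left g) = 0 <;> by_cases k2 : c (E.center g) = 0 <;>
        by_cases k3 : c (E.right g (π g)) = 0 <;> norm_num [k1, k2, k3]
    have h4 := (Finset.card_le_card h2).trans ((Finset.card_union_le _ _).trans
      (Nat.add_le_add_right ((Finset.card_union_le _ _).trans
        (Nat.add_le_add_left Finset.card_image_le _)) _))
    rw [Finset.card_sigma] at h4
    have h5 : ((E.excluded c π).card : ℝ) ≤ (Finset.univ.filter fun g => ¬E.Good g).card +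
        ∑ i, ((Finset.univ.filter fun g => E.OwnSkewed i c π g).card : ℝ) +
        (Finset.univ.filter fun g => c (E.left g) = 0 ∨ c (E.center g) = 0 ∨
          c (E.right g (π g)) = 0).card := by
      exact_mod_cast h4
    linarith
  refine (Finset.sum_le_sum fun π _ => Finset.sum_le_sum fun c _ => h1 π c).trans ?_
  simp only [Finset.sum_add_distrib, Finset.sum_const, nsmul_eq_mul, Finset.card_univ]
  have hskew : ∑ π, ∑ c : Pl → Fin w, ∑ i,
      ((Finset.univ.filter fun g => E.OwnSkewed i c π g).card : ℝ) ≤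
      Fintype.card (Slot ℓ s → X) * Fintype.card (Pl → Fin w) *
        (∑ i, 4 * ((τ i : ℝ) + 1) + ℓ * s * (16 * w / q)) := by
    have h2 : ∑ π, ∑ c : Pl → Fin w, ∑ i,
        ((Finset.univ.filter fun g => E.OwnSkewed i c π g).card : ℝ) =
        ∑ i, ∑ π, ∑ c : Pl → Fin w,
          ((Finset.univ.filter fun g => E.OwnSkewed i c π g).card : ℝ) := by
      rw [Finset.sum_comm (s := (Finset.univ : Finset Pl))]
      exact Finset.sum_congr rfl fun π _ => Finset.sum_comm
    rw [h2]
    refine (Finset.sum_le_sum fun i _ => E.sum_card_ownSkewed_le i hq hX (hτ i)).trans ?_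
    rw [← Finset.mul_sum, Finset.sum_add_distrib, ← Finset.sum_mul]
    have h3 : (∑ i, (Fintype.card (E.Own i) : ℝ)) ≤ ℓ * s := by
      exact_mod_cast E.toHosts.sum_card_own_le
    gcongr
  have hcol : ∀ i : Pl, ∑ c : Pl → Fin w, (if c i = 0 then 1 else 0 : ℝ) =
      Fintype.card (Pl → Fin w) / w := fun i => by
    rw [Finset.sum_boole, eq_div_iff hw.ne', mul_comm]
    exact_mod_cast mul_card_colour_zero i
  have hcol' : ∀ f : Slot ℓ s → Pl, ∑ c : Pl → Fin w, ∑ g, (if c (f g) = 0 then 1 else 0 : ℝ) =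
      ℓ * s * (Fintype.card (Pl → Fin w) / w) := fun f => by
    rw [Finset.sum_comm]
    simp only [hcol, Finset.sum_const, nsmul_eq_mul, Finset.card_univ, Fintype.card_prod,
      Fintype.card_fin]
    push_cast
    ring
  rw [hcol' E.left, hcol' E.center]
  have hright : ∑ π : Slot ℓ s → X, ∑ c : Pl → Fin w, ∑ g,
      (if c (E.right g (π g)) = 0 then 1 else 0 : ℝ) =
      Fintype.card (Slot ℓ s → X) * (ℓ * s * (Fintype.card (Pl → Fin w) / w)) := by
    rw [Finset.sum_congr rfl fun π _ => hcol' fun g => E.right g (π g), Finset.sum_const,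
      nsmul_eq_mul, Finset.card_univ]
  rw [hright]
  have h6 : (Fintype.card (Slot ℓ s → X) : ℝ) * Fintype.card (Pl → Fin w) * (ℓ * s * (3 / w)) =
      3 * (Fintype.card (Slot ℓ s → X) * (ℓ * s * (Fintype.card (Pl → Fin w) / w))) := by
    ring
  rw [mul_add, mul_add, h6]
  linarith

end Execution

/-! ### Executions with short messages fail often -/

/-- If four nonnegative quantities have small means, then at some point all four are small. -/
theorem exists_le_of_means {Y : Type} [Fintype Y] [Nonempty Y] {f₁ f₂ f₃ f₄ : Y → ℝ}
    {a₁ a₂ a₃ a₄ : ℝ} (h₁ : ∀ y, 0 ≤ f₁ y) (h₂ : ∀ y, 0 ≤ f₂ y) (h₃ : ∀ y, 0 ≤ f₃ y)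
    (h₄ : ∀ y, 0 ≤ f₄ y) (ha₁ : 0 < a₁) (ha₂ : 0 < a₂) (ha₃ : 0 < a₃) (ha₄ : 0 < a₄)
    (hf₁ : ∑ y, f₁ y ≤ Fintype.card Y * (a₁ / 5)) (hf₂ : ∑ y, f₂ y ≤ Fintype.card Y * (a₂ / 5))
    (hf₃ : ∑ y, f₃ y ≤ Fintype.card Y * (a₃ / 5)) (hf₄ : ∑ y, f₄ y ≤ Fintype.card Y * (a₄ / 5)) :
    ∃ y, f₁ y ≤ a₁ ∧ f₂ y ≤ a₂ ∧ f₃ y ≤ a₃ ∧ f₄ y ≤ a₄ := by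
  have hY : (0 : ℝ) < Fintype.card Y := by exact_mod_cast Fintype.card_pos
  have hdiv : ∀ (f : Y → ℝ) (a : ℝ), 0 < a → ∑ y, f y ≤ Fintype.card Y * (a / 5) →
      ∑ y, f y / a ≤ Fintype.card Y / 5 := fun f a ha h => by
    rw [← Finset.sum_div, div_le_iff₀ ha]
    linarith
  by_contra! h
  have key : ∀ y, 1 ≤ f₁ y / a₁ + f₂ y / a₂ + f₃ y / a₃ + f₄ y / a₄ := by
    intro y
    have p1 := div_nonneg (h₁ y) ha₁.le
    have p2 := div_nonneg (h₂ y) ha₂.le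
    have p3 := div_nonneg (h₃ y) ha₃.le
    have p4 := div_nonneg (h₄ y) ha₄.le
    by_cases k1 : f₁ y ≤ a₁
    · by_cases k2 : f₂ y ≤ a₂
      · by_cases k3 : f₃ y ≤ a₃
        · have := (one_lt_div ha₄).2 (h y k1 k2 k3)
          linarith
        · have := (one_lt_div ha₃).2 (not_le.1 k3)
          linarith
      · have := (one_lt_div ha₂).2 (not_le.1 k2)
        linarith
    · have := (one_lt_div ha₁).2 (not_le.1 k1)
      linarith
  have hsum := Finset.sum_le_sum fun y (_ : y ∈ Finset.univ) => key y
  simp only [Finset.sum_add_distrib, Finset.sum_const, Finset.card_univ, nsmul_eq_mul,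
    mul_one] at hsum
  have := hdiv _ _ ha₁ hf₁
  have := hdiv _ _ ha₂ hf₂
  have := hdiv _ _ ha₃ hf₃
  have := hdiv _ _ ha₄ hf₄
  linarith

theorem card_small_subsets_le (ℓ d : ℕ) :
    ((Finset.univ.filter fun V : Finset (Fin ℓ) => V.card ≤ d).card : ℝ) ≤
      8 ^ d * (9 / 8) ^ ℓ := by
  have h1 := Fintype.sum_pow_mul_eq_add_pow (Fin ℓ) (1 / 8 : ℝ) 1
  simp only [one_pow, mul_one, Fintype.card_fin] at h1
  rw [show (9 / 8 : ℝ) = 1 / 8 + 1 by norm_num, ← h1, Finset.card_filter, Finset.mul_sum]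
  push_cast
  refine Finset.sum_le_sum fun V _ => ?_
  split_ifs with h
  · obtain ⟨e, rfl⟩ := Nat.exists_eq_add_of_le h
    rw [pow_add, mul_right_comm, ← mul_pow]
    norm_num
    exact one_le_pow₀ (by norm_num)
  · positivity

theorem prod_add_le_exp {ℓ s N : ℕ} (hs : 0 < s) (f : Fin ℓ → ℕ) (hf : ∑ r, f r = N) :
    ∏ r, ((s : ℝ) + f r) ≤ s ^ ℓ * Real.exp (N / s) := by
  have hs' : (0 : ℝ) < s := by exact_mod_cast hs
  calc ∏ r, ((s : ℝ) + f r) ≤ ∏ r, (s * Real.exp (f r / s)) := by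
        refine Finset.prod_le_prod (fun _ _ => by positivity) fun r _ => ?_
        have := Real.add_one_le_exp ((f r : ℝ) / s)
        calc (s : ℝ) + f r = s * (f r / s + 1) := by field_simp; ring
          _ ≤ _ := by gcongr
    _ = s ^ ℓ * Real.exp (N / s) := by
        rw [Finset.prod_mul_distrib, Finset.prod_const, Finset.card_univ, Fintype.card_fin,
          ← Real.exp_sum, ← Finset.sum_div, ← hf]
        push_cast
        rfl

theorem two_pow_le_exp (n : ℕ) : (2 : ℝ) ^ n ≤ Real.exp n := by
  rw [← mul_one (n : ℝ), Real.exp_nat_mul]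
  refine pow_le_pow_left₀ (by norm_num) ?_ n
  have := Real.add_one_le_exp (1 : ℝ)
  linarith

theorem two_pow_eq_exp (n : ℕ) : (2 : ℝ) ^ n = Real.exp (n * Real.log 2) := by
  rw [Real.exp_nat_mul, Real.exp_log (by norm_num)]

theorem exp_neg_two_le : Real.exp (-2) ≤ 1 / 4 := by
  rw [Real.exp_neg, ← one_div]
  refine one_div_le_one_div_of_le (by norm_num) ?_
  have h := Real.add_one_le_exp (1 : ℝ)
  have : Real.exp 2 = Real.exp 1 * Real.exp 1 := by rw [← Real.exp_add]; norm_num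
  nlinarith

/-- The size of the code for the patterns with few surprises. All exponents together are less than
`ℓ * log 2 - 2`. -/
theorem few_surprises_numeric {ℓ s M J N d : ℕ} (hℓ : 256 ≤ ℓ) (hs : 0 < s) (f : Fin ℓ → ℕ)
    (hf : ∑ r, f r = N) (hN : 64 * N ≤ ℓ * s) (hM : (M : ℝ) ^ J ≤ Real.exp (ℓ / 100))
    (hd : 128 * d ≤ ℓ) :
    (M : ℝ) ^ J * ((Finset.univ.filter fun V : Finset (Fin ℓ) => V.card ≤ 8 * d).card *
      ∏ r, ((s : ℝ) + f r)) ≤ (2 * s) ^ ℓ / 4 := by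
  have hs' : (0 : ℝ) < s := by exact_mod_cast hs
  have hℓ' : (256 : ℝ) ≤ ℓ := by exact_mod_cast hℓ
  have hlog1 := Real.log_two_gt_d9
  have hlog2 := Real.log_two_lt_d9
  have h1 : ((Finset.univ.filter fun V : Finset (Fin ℓ) => V.card ≤ 8 * d).card : ℝ) ≤
      Real.exp (13 / 100 * ℓ) * Real.exp (ℓ / 8) := by
    refine (card_small_subsets_le ℓ (8 * d)).trans (mul_le_mul ?_ ?_ (by positivity)
      (by positivity))
    · rw [show (8 : ℝ) = 2 ^ 3 by norm_num, ← pow_mul, two_pow_eq_exp, Real.exp_le_exp]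
      have h2 : ((3 * (8 * d) : ℕ) : ℝ) ≤ 24 / 128 * ℓ := by
        have : (128 * d : ℝ) ≤ ℓ := by exact_mod_cast hd
        push_cast
        linarith
      nlinarith
    · rw [show (ℓ : ℝ) / 8 = ℓ * (1 / 8) by ring, Real.exp_nat_mul]
      refine pow_le_pow_left₀ (by norm_num) ?_ ℓ
      have := Real.add_one_le_exp (1 / 8 : ℝ)
      linarith
  have h2 : ∏ r, ((s : ℝ) + f r) ≤ s ^ ℓ * Real.exp (ℓ / 64) := by
    refine (prod_add_le_exp hs f hf).trans ?_
    have h3 : (N : ℝ) / s ≤ ℓ / 64 := by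
      rw [div_le_iff₀ hs']
      have : (64 * N : ℝ) ≤ ℓ * s := by exact_mod_cast hN
      linarith
    gcongr
  have h3 : (M : ℝ) ^ J * ((Finset.univ.filter fun V : Finset (Fin ℓ) => V.card ≤ 8 * d).card *
      ∏ r, ((s : ℝ) + f r)) ≤ Real.exp (ℓ / 100) * ((Real.exp (13 / 100 * ℓ) * Real.exp (ℓ / 8)) *
        (s ^ ℓ * Real.exp (ℓ / 64))) := by
    have : 0 ≤ ∏ r, ((s : ℝ) + f r) := Finset.prod_nonneg fun r _ => by positivity
    gcongr
  refine h3.trans ?_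
  have h4 : Real.exp (ℓ / 100) * ((Real.exp (13 / 100 * ℓ) * Real.exp (ℓ / 8)) *
        (s ^ ℓ * Real.exp (ℓ / 64))) =
      s ^ ℓ * Real.exp (ℓ / 100 + 13 / 100 * ℓ + ℓ / 8 + ℓ / 64) := by
    simp only [Real.exp_add]
    ring
  rw [h4, mul_pow, mul_comm ((2 : ℝ) ^ ℓ), mul_div_assoc]
  gcongr
  calc Real.exp (ℓ / 100 + 13 / 100 * ℓ + ℓ / 8 + ℓ / 64) ≤ Real.exp (ℓ * Real.log 2 + -2) := by
        rw [Real.exp_le_exp]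
        nlinarith
    _ = 2 ^ ℓ * Real.exp (-2) := by rw [Real.exp_add, two_pow_eq_exp]
    _ ≤ _ := by
        have := exp_neg_two_le
        have h5 : (0 : ℝ) < 2 ^ ℓ := by positivity
        nlinarith

/-- The size of the code for the patterns with many surprises. The factor `exp (-l)` that is saved in
each of `d ≥ ℓ / 256` rows outweighs all other factors as `l` is large. -/
theorem many_surprises_numeric {ℓ k l s M d : ℕ} (hℓ : 256 ≤ ℓ) (hl : 100000 ≤ l) (hk : k ≤ ℓ)
    (hs : s = 2 ^ (4 * l)) (hM : (M : ℝ) ^ k ≤ Real.exp (l * ℓ / 10000)) (hd : ℓ ≤ 256 * d) :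
    (2 : ℝ) ^ k * 2 ^ ℓ * (M : ℝ) ^ k *
      ((2 * s) ^ ℓ * (336 * 2 ^ l * l / (2 * s)) ^ d * Real.exp ℓ) ≤ (2 * s) ^ ℓ / 4 := by
  have hs' : (0 : ℝ) < s := by rw [hs]; positivity
  have hℓ' : (256 : ℝ) ≤ ℓ := by exact_mod_cast hℓ
  have hl' : (100000 : ℝ) ≤ l := by exact_mod_cast hl
  have hd' : (ℓ : ℝ) ≤ 256 * d := by exact_mod_cast hd
  have hk' : (k : ℝ) ≤ ℓ := by exact_mod_cast hk
  have hratio : 336 * 2 ^ l * (l : ℝ) / (2 * s) ≤ Real.exp (-l) := by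
    have h1 : (168 * l : ℝ) ≤ 2 ^ l := by
      have h2 : 168 * l ≤ 2 ^ l := by
        obtain ⟨e, rfl⟩ := Nat.exists_eq_add_of_le (show 100 ≤ l by omega)
        have h3 : e < 2 ^ e := Nat.lt_two_pow_self
        rw [pow_add]
        have h4 : 2 ^ e ≥ 1 := Nat.one_le_two_pow
        nlinarith
      exact_mod_cast h2
    rw [Real.exp_neg, div_le_iff₀ (by positivity), hs]
    push_cast
    have h3 : (1 : ℝ) ≤ (Real.exp l)⁻¹ * (2 ^ l * 2 ^ l) := by
      rw [← div_eq_inv_mul, one_le_div (Real.exp_pos _), ← mul_pow, ← mul_one (l : ℝ),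
        Real.exp_nat_mul]
      refine pow_le_pow_left₀ (Real.exp_pos _).le ?_ l
      have := Real.exp_one_lt_d9
      linarith
    calc 336 * 2 ^ l * (l : ℝ) = 2 * 2 ^ l * (168 * l) := by ring
      _ ≤ 2 * 2 ^ l * 2 ^ l := by gcongr
      _ = 1 * (2 * 2 ^ l * 2 ^ l) := by ring
      _ ≤ ((Real.exp l)⁻¹ * (2 ^ l * 2 ^ l)) * (2 * 2 ^ l * 2 ^ l) := by gcongr
      _ = _ := by rw [mul_comm 4 l, pow_mul]; ring
  have h1 : (336 * 2 ^ l * (l : ℝ) / (2 * s)) ^ d ≤ Real.exp (-(l * d)) := by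
    calc _ ≤ Real.exp (-l) ^ d := pow_le_pow_left₀ (by positivity) hratio d
      _ = _ := by rw [← Real.exp_nat_mul]; congr 1; ring
  calc (2 : ℝ) ^ k * 2 ^ ℓ * (M : ℝ) ^ k *
      ((2 * s) ^ ℓ * (336 * 2 ^ l * l / (2 * s)) ^ d * Real.exp ℓ)
      ≤ Real.exp k * Real.exp ℓ * Real.exp (l * ℓ / 10000) *
        ((2 * s) ^ ℓ * Real.exp (-(l * d)) * Real.exp ℓ) := by
        have := two_pow_le_exp k
        have := two_pow_le_exp ℓ
        gcongr
    _ = (2 * s) ^ ℓ * Real.exp (k + ℓ + l * ℓ / 10000 + -(l * d) + ℓ) := by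
        simp only [Real.exp_add]
        ring
    _ ≤ (2 * s) ^ ℓ * (1 / 4) := by
        gcongr
        refine le_trans ?_ exp_neg_two_le
        rw [Real.exp_le_exp]
        nlinarith
    _ = _ := by ring

namespace Execution

variable {Pl M₁ M₂ X : Type} [Fintype Pl] [DecidableEq Pl] [Fintype M₁] [DecidableEq M₁]
  [Fintype M₂] [DecidableEq M₂] [Fintype X] [DecidableEq X] {ℓ s : ℕ}
  (E : Execution Pl M₁ M₂ X ℓ s)

/-- For choices and colours that are not exceptional, at least half of the patterns go wrong. -/
theorem card_success_le_half {l b : ℕ} (hl : 100000 ≤ l) (hℓ : 256 ≤ ℓ) (hs : s = 2 ^ (4 * l))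
    (hM₂ : Fintype.card M₂ ≤ 2 ^ b) (hb : 10000 * (b * Fintype.card Pl) ≤ l * ℓ)
    (hk : Fintype.card Pl ≤ ℓ) (c : Pl → Fin (2 ^ l)) (π : Slot ℓ s → X)
    (hQ : 64 * (E.excluded c π).card ≤ ℓ * s)
    (hJ : 2 ^ l * (Finset.univ.filter fun i => c i = 0).card ≤ 5 * Fintype.card Pl)
    (hU : ∑ i, E.ownPotential i c π ≤ 5 * Fintype.card Pl) :
    ((E.success π).card : ℝ) ≤ (2 * s) ^ ℓ / 2 := by
  classical
  have hs0 : 0 < s := by rw [hs]; positivity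
  have hs' : (0 : ℝ) < s := by exact_mod_cast hs0
  have hl' : (100000 : ℝ) ≤ l := by exact_mod_cast hl
  have hℓ' : (256 : ℝ) ≤ ℓ := by exact_mod_cast hℓ
  have hk' : (Fintype.card Pl : ℝ) ≤ ℓ := by exact_mod_cast hk
  have hb' : 10000 * ((b : ℝ) * Fintype.card Pl) ≤ l * ℓ := by exact_mod_cast hb
  have hMpow : ∀ j : ℕ, (Fintype.card M₂ : ℝ) ^ j ≤ Real.exp (b * j) := fun j => by
    have h1 : (Fintype.card M₂ : ℝ) ≤ 2 ^ b := by exact_mod_cast hM₂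
    calc (Fintype.card M₂ : ℝ) ^ j ≤ (2 ^ b) ^ j := by gcongr
      _ = 2 ^ (b * j) := by rw [← pow_mul]
      _ ≤ Real.exp ((b * j : ℕ) : ℝ) := two_pow_le_exp _
      _ = _ := by push_cast; rfl
  have hlpow : l ≤ 2 ^ l := Nat.lt_two_pow_self.le
  set d := ℓ / 128 with hd
  have hd1 : 128 * d ≤ ℓ := Nat.mul_div_le ℓ 128
  have hd2 : ℓ ≤ 256 * d := by omega
  set 𝒥 := Finset.univ.filter fun i => c i = 0 with h𝒥
  have hξ : ∀ x ∈ E.success π, ∀ x' ∈ E.success π, (∀ i ∈ 𝒥, E.late π x i = E.late π x' i) →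
      (∀ i ∈ 𝒥, SameView (E.visible π) i x x') → E.guess c π x = E.guess c π x' :=
    fun x hx x' hx' h1 h2 => E.guess_congr c hx hx' h1 h2
  have hvis : ∀ g ∉ E.excluded c π, ∀ b, Disjoint (E.visible π g b) 𝒥 := fun g hg b =>
    E.disjoint_visible hg b
  -- all late messages of the players of colour `0` have at most `ℓ / 100` bits
  have hfew : (((E.success π).filter fun x =>
      (surprises (E.excluded c π) (E.guess c π) x).card ≤ 8 * d).card : ℝ) ≤ (2 * s) ^ ℓ / 4 := by
    have h1 := card_few_surprises_le (M := M₂) (m := E.late π) hξ hvis (8 * d)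
    have hf : ∑ r, (Finset.univ.filter fun t => (r, t) ∈ E.excluded c π).card =
        (E.excluded c π).card := by
      rw [← Finset.card_sigma]
      refine Finset.card_bij (fun p _ => (p.1, p.2)) ?_ ?_ ?_
      · intro p hp
        simpa using hp
      · rintro ⟨r, t⟩ _ ⟨r', t'⟩ _ h
        simp only [Prod.mk.injEq] at h
        obtain ⟨rfl, rfl⟩ := h
        rfl
      · rintro ⟨r, t⟩ h
        exact ⟨⟨r, t⟩, by simpa using h, rfl⟩
    refine le_trans (by exact_mod_cast h1) (few_surprises_numeric hℓ hs0
      (fun r => (Finset.univ.filter fun t => (r, t) ∈ E.excluded c π).card) hf hQ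
      ((hMpow _).trans (Real.exp_le_exp.2 ?_)) hd1)
    have h2 : 2 ^ l * (100 * (b * 𝒥.card)) ≤ 2 ^ l * ℓ := by
      calc 2 ^ l * (100 * (b * 𝒥.card)) = 100 * b * (2 ^ l * 𝒥.card) := by ring
        _ ≤ 100 * b * (5 * Fintype.card Pl) := by gcongr
        _ ≤ l * ℓ := by nlinarith
        _ ≤ 2 ^ l * ℓ := by gcongr
    have h3 : 100 * (b * 𝒥.card) ≤ ℓ := Nat.le_of_mul_le_mul_left h2 (by positivity)
    have h4 : 100 * ((b : ℝ) * 𝒥.card) ≤ ℓ := by exact_mod_cast h3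
    linarith
  have hmany : (((E.success π).filter fun x =>
      8 * d < (surprises (E.excluded c π) (E.guess c π) x).card).card : ℝ) ≤
        (2 * s) ^ ℓ / 4 := by
    have hτ : (0 : ℝ) < 336 * 2 ^ l * l := by
      have : (0 : ℝ) < l := by linarith
      positivity
    have hτs : 336 * 2 ^ l * (l : ℝ) ≤ 2 * s := by
      have h3 : 168 * l ≤ 2 ^ l := by
        obtain ⟨e, rfl⟩ := Nat.exists_eq_add_of_le (show 100 ≤ l by omega)
        have h3 : e < 2 ^ e := Nat.lt_two_pow_self
        rw [pow_add]
        nlinarith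
      have h4 : 336 * 2 ^ l * l ≤ 2 * s := by
        rw [hs]
        calc 336 * 2 ^ l * l = 2 * 2 ^ l * (168 * l) := by ring
          _ ≤ 2 * 2 ^ l * 2 ^ l := by gcongr
          _ = 2 * 2 ^ (2 * l) := by ring
          _ ≤ 2 * 2 ^ (4 * l) := by gcongr <;> omega
      exact_mod_cast h4
    have hΘ : ∀ x ∈ E.success π, ((Finset.univ.filter fun g => g ∉ E.excluded c π ∧
        E.leftOut π x g ≠ E.guess c π x g).card : ℝ) ≤ 336 * 2 ^ l * l * ℓ := by
      intro x _
      have h1 := E.card_wrong_guesses_le hs0 c π x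
      have h2 : Fintype.card Pl * Real.log (Fintype.card M₂) ≤ l * ℓ := by
        have : Nonempty M₂ := by
          by_contra hne
          rw [not_nonempty_iff] at hne
          have hPl : IsEmpty Pl := ⟨fun i => hne.elim (E.late π x i)⟩
          have hℓ0 : 0 < ℓ := by omega
          exact hPl.elim (E.left (⟨0, hℓ0⟩, ⟨0, hs0⟩))
        have hM0 : (0 : ℝ) < Fintype.card M₂ := by exact_mod_cast Fintype.card_pos
        have h3 : Real.log (Fintype.card M₂) ≤ b := by
          rw [Real.log_le_iff_le_exp hM0]
          simpa using hMpow 1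
        have h5 : (Fintype.card Pl : ℝ) * Real.log (Fintype.card M₂) ≤ Fintype.card Pl * b := by
          gcongr
        have h6 : (0 : ℝ) ≤ l * ℓ := by positivity
        linarith
      have h3 : Real.log (2 * s) ≤ 5 * l := by
        rw [Real.log_le_iff_le_exp (by positivity), hs]
        push_cast
        rw [← pow_succ']
        refine (two_pow_le_exp _).trans (Real.exp_le_exp.2 ?_)
        push_cast
        linarith
      push_cast at h1
      refine h1.trans ?_
      have h4 : ∑ i, E.ownPotential i c π + 2 * (Fintype.card Pl * Real.log (Fintype.card M₂) +
          2 * ℓ * Real.log (2 * s) + 2 * ℓ) ≤ 42 * (l * ℓ) := by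
        have h5 : 2 * (ℓ : ℝ) * Real.log (2 * s) ≤ 2 * ℓ * (5 * l) := by gcongr
        nlinarith
      calc 8 * (2 : ℝ) ^ l * (∑ i, E.ownPotential i c π +
          2 * (Fintype.card Pl * Real.log (Fintype.card M₂) +
          2 * ℓ * Real.log (2 * s) + 2 * ℓ)) ≤ 8 * 2 ^ l * (42 * (l * ℓ)) := by gcongr
        _ = _ := by ring
    have h1 := card_many_surprises_le (M := M₂) (m := E.late π) (un := E.unaware π)
      (Z := E.leftOut π)
      (E.leftOut_gadget π) (fun x hx x' hx' g b => E.leftOut_eq_of_unaware hx hx' g b) hξ hvis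
      (E.card_visible_le π) (fun g hg b => by
        obtain ⟨hgood, -⟩ := E.notMem_excluded hg
        exact E.unaware_notMem hgood π b) hτ hτs hΘ d
    rw [mul_div_cancel_left₀ _ hτ.ne'] at h1
    refine h1.trans (many_surprises_numeric hℓ hl hk hs
      ((hMpow _).trans (Real.exp_le_exp.2 ?_)) hd2)
    linarith
  have hsplit := Finset.card_filter_add_card_filter_not (s := E.success π)
    (fun x => (surprises (E.excluded c π) (E.guess c π) x).card ≤ 8 * d)
  simp only [not_le] at hsplit
  rw [← hsplit]
  push_cast
  linarith

/-- If the messages are short and most gadgets are good, then a random choice of the right leaves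
and a random pattern lead to an error with probability more than `1 / 20`. -/
theorem sum_card_success_lt {l b : ℕ} (hl : 100000 ≤ l) (hℓ : 256 ≤ ℓ) (hs : s = 2 ^ (4 * l))
    (hX : Fintype.card X = (2 ^ (2 * l)) ^ 2)
    (hM₁ : Fintype.card M₁ ≤ 2 ^ (b * s)) (hM₂ : Fintype.card M₂ ≤ 2 ^ b)
    (hb : 10000 * (b * Fintype.card Pl) ≤ l * ℓ) (hk0 : 0 < Fintype.card Pl)
    (hk : Fintype.card Pl ≤ ℓ)
    (hbad : 1000 * {g | ¬E.Good g}.ncard ≤ ℓ * s) :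
    ∑ π, ((E.success π).card : ℝ) < 19 / 20 * (Fintype.card (Slot ℓ s → X) * (2 * s) ^ ℓ) := by
  classical
  by_contra! hcon
  have hs0 : 0 < s := by rw [hs]; positivity
  have hs' : (0 : ℝ) < s := by exact_mod_cast hs0
  have hℓ' : (256 : ℝ) ≤ ℓ := by exact_mod_cast hℓ
  have hl' : (100000 : ℝ) ≤ l := by exact_mod_cast hl
  have hk' : (Fintype.card Pl : ℝ) ≤ ℓ := by exact_mod_cast hk
  have hk0' : (0 : ℝ) < Fintype.card Pl := by exact_mod_cast hk0
  have hb' : 10000 * ((b : ℝ) * Fintype.card Pl) ≤ l * ℓ := by exact_mod_cast hb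
  have hXne : Nonempty X := Fintype.card_pos_iff.1 (by rw [hX]; positivity)
  have hw : (0 : ℝ) < (2 : ℝ) ^ l := by positivity
  have hlw : (l : ℝ) ≤ 2 ^ l := by exact_mod_cast Nat.lt_two_pow_self.le
  have hws : (2 : ℝ) ^ l ≤ s := by
    rw [hs]
    push_cast
    exact pow_le_pow_right₀ (by norm_num) (by omega)
  have hY : (Fintype.card ((Slot ℓ s → X) × (Pl → Fin (2 ^ l))) : ℝ) =
      Fintype.card (Slot ℓ s → X) * Fintype.card (Pl → Fin (2 ^ l)) := by
    rw [Fintype.card_prod]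
    push_cast
    rfl
  have hC0 : (0 : ℝ) ≤ Fintype.card (Pl → Fin (2 ^ l)) := Nat.cast_nonneg _
  have hP0 : (0 : ℝ) ≤ Fintype.card (Slot ℓ s → X) := Nat.cast_nonneg _
  have hpat : ∀ S : Finset (Pattern ℓ s), (S.card : ℝ) ≤ (2 * s) ^ ℓ := fun S => by
    have h1 : S.card ≤ (2 * s) ^ ℓ := (Finset.card_le_univ S).trans (le_of_eq (by
      simp [mul_comm]))
    exact_mod_cast h1
  -- if the success probability were `19 / 20`, some choice would have success probability `3 / 4`
  -- and, for some colouring, none of the exceptional properties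
  obtain ⟨⟨π, c⟩, h1, h2, h3, h4⟩ : ∃ y : (Slot ℓ s → X) × (Pl → Fin (2 ^ l)),
      (2 * (s : ℝ)) ^ ℓ - (E.success y.1).card ≤ (2 * s) ^ ℓ / 4 ∧
      ((E.excluded y.2 y.1).card : ℝ) ≤ ℓ * s / 64 ∧
      ((Finset.univ.filter fun i => y.2 i = 0).card : ℝ) ≤ 5 * Fintype.card Pl / 2 ^ l ∧
      ∑ i, E.ownPotential i y.2 y.1 ≤ 5 * Fintype.card Pl := by
    refine exists_le_of_means
      (Y := (Slot ℓ s → X) × (Pl → Fin (2 ^ l)))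
      (f₁ := fun y => (2 * (s : ℝ)) ^ ℓ - (E.success y.1).card)
      (f₂ := fun y => ((E.excluded y.2 y.1).card : ℝ))
      (f₃ := fun y => ((Finset.univ.filter fun i => y.2 i = 0).card : ℝ))
      (f₄ := fun y => ∑ i, E.ownPotential i y.2 y.1)
      (a₁ := (2 * s) ^ ℓ / 4) (a₂ := ℓ * s / 64) (a₃ := 5 * Fintype.card Pl / 2 ^ l)
      (a₄ := 5 * Fintype.card Pl)
      (fun y => sub_nonneg.2 (hpat _)) (fun _ => Nat.cast_nonneg _) (fun _ => Nat.cast_nonneg _)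
      (fun y => Finset.sum_nonneg fun i _ => E.ownPotential_nonneg i _ _)
      (by positivity) (by positivity) (by positivity) (by positivity) ?_ ?_ ?_ ?_
    · rw [hY, Fintype.sum_prod_type]
      simp only [Finset.sum_const, Finset.card_univ, nsmul_eq_mul]
      rw [← Finset.mul_sum, Finset.sum_sub_distrib, Finset.sum_const, nsmul_eq_mul, Finset.card_univ]
      nlinarith
    · rw [hY, Fintype.sum_prod_type]
      let τ : Pl → ℕ := fun i => (b * s + Fintype.card (E.Own i)) / (2 * l) + 1
      have hτ : ∀ i, Fintype.card M₁ * 2 ^ Fintype.card (E.Own i) ≤ (2 ^ (2 * l)) ^ τ i := by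
        intro i
        calc Fintype.card M₁ * 2 ^ Fintype.card (E.Own i)
            ≤ 2 ^ (b * s) * 2 ^ Fintype.card (E.Own i) := by gcongr
          _ = 2 ^ (b * s + Fintype.card (E.Own i)) := by rw [pow_add]
          _ ≤ 2 ^ (2 * l * τ i) := by
              gcongr
              · norm_num
              · exact (Nat.lt_mul_div_succ _ (by omega)).le
          _ = _ := by rw [pow_mul]
      have h1 := E.sum_card_excluded_le (w := 2 ^ l) τ (q := 2 ^ (2 * l))
        (Nat.le_self_pow (by omega) 2) hX hτ
      refine h1.trans (mul_le_mul_of_nonneg_left ?_ (by positivity))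
      have h2 : ∑ i, 4 * ((τ i : ℝ) + 1) ≤
          4 * ((Fintype.card Pl * (b * s) + ℓ * s) / (2 * l) + 2 * Fintype.card Pl) := by
        have h3 : ∀ i, 4 * ((τ i : ℝ) + 1) ≤
            4 * (((b * s : ℝ) + Fintype.card (E.Own i)) / (2 * l) + 2) := fun i => by
          have h5 : (((b * s + Fintype.card (E.Own i)) / (2 * l) : ℕ) : ℝ) ≤
              ((b * s : ℝ) + Fintype.card (E.Own i)) / (2 * l) := by
            refine Nat.cast_div_le.trans (le_of_eq ?_)
            push_cast
            rfl
          simp only [τ]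
          push_cast at h5 ⊢
          linarith
        have h4 : (∑ i, (Fintype.card (E.Own i) : ℝ)) ≤ ℓ * s := by
          exact_mod_cast E.toHosts.sum_card_own_le
        refine (Finset.sum_le_sum fun i _ => h3 i).trans ?_
        rw [← Finset.mul_sum, Finset.sum_add_distrib, ← Finset.sum_div, Finset.sum_add_distrib,
          Finset.sum_const, Finset.sum_const, nsmul_eq_mul, nsmul_eq_mul, Finset.card_univ,
          mul_comm (Fintype.card Pl : ℝ) 2]
        gcongr
      have h3 : ((Finset.univ.filter fun g => ¬E.Good g).card : ℝ) ≤ ℓ * s / 1000 := by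
        have h5 : {g | ¬E.Good g}.ncard = (Finset.univ.filter fun g => ¬E.Good g).card := by
          rw [Set.ncard_eq_toFinset_card']
          congr 1
          ext g
          simp
        rw [h5] at hbad
        have h6 : 1000 * ((Finset.univ.filter fun g => ¬E.Good g).card : ℝ) ≤ ℓ * s := by
          exact_mod_cast hbad
        linarith
      have hℓs : (0 : ℝ) < ℓ * s := by positivity
      have h4 : (Fintype.card Pl * (b * s) + ℓ * s : ℝ) / (2 * l) ≤ ℓ * s / 20000 + ℓ * s / 200000 := by
        rw [div_le_iff₀ (by positivity)]
        have h5 : (Fintype.card Pl * (b * s) : ℝ) ≤ l * ℓ * s / 10000 := by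
          have := mul_le_mul_of_nonneg_right hb' hs'.le
          linarith
        have h6 : (ℓ * s : ℝ) * 100000 ≤ ℓ * s * l := by gcongr
        linarith
      have h5 : (8 * Fintype.card Pl : ℝ) ≤ ℓ * s / 10000 := by
        have h6 : (100000 : ℝ) ≤ s := hl'.trans (hlw.trans hws)
        nlinarith
      have h6 : (16 * ((2 ^ l : ℕ) : ℝ) / ((2 ^ (2 * l) : ℕ) : ℝ)) ≤ 16 / 100000 := by
        push_cast
        rw [div_le_div_iff₀ (by positivity) (by norm_num), two_mul, pow_add]
        nlinarith
      have h7 : (3 / ((2 ^ l : ℕ) : ℝ)) ≤ 3 / 100000 := by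
        push_cast
        gcongr
        exact hl'.trans hlw
      have h8 : (ℓ * s : ℝ) * (16 * ((2 ^ l : ℕ) : ℝ) / ((2 ^ (2 * l) : ℕ) : ℝ)) ≤
          ℓ * s * (16 / 100000) := by gcongr
      have h9 : (ℓ * s : ℝ) * (3 / ((2 ^ l : ℕ) : ℝ)) ≤ ℓ * s * (3 / 100000) := by gcongr
      linarith
    · rw [hY, Fintype.sum_prod_type]
      simp only [Finset.sum_const, Finset.card_univ, nsmul_eq_mul]
      rw [mul_assoc]
      refine mul_le_mul_of_nonneg_left (le_of_eq ?_) hP0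
      have h1 : ∀ i : Pl, ((Finset.univ.filter fun c : Pl → Fin (2 ^ l) => c i = 0).card : ℝ) =
          Fintype.card (Pl → Fin (2 ^ l)) / 2 ^ l := fun i => by
        rw [eq_div_iff hw.ne', mul_comm]
        exact_mod_cast mul_card_colour_zero (w := 2 ^ l) i
      have h2 : ∑ c : Pl → Fin (2 ^ l), ((Finset.univ.filter fun i => c i = 0).card : ℝ) =
          ∑ i, ((Finset.univ.filter fun c : Pl → Fin (2 ^ l) => c i = 0).card : ℝ) := by
        simp only [Finset.card_filter, Nat.cast_sum]
        exact Finset.sum_comm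
      rw [h2, Finset.sum_congr rfl fun i _ => h1 i, Finset.sum_const, nsmul_eq_mul, Finset.card_univ]
      field_simp
    · rw [hY, Fintype.sum_prod_type, Finset.sum_comm]
      have h1 : ∀ c : Pl → Fin (2 ^ l), ∑ π, ∑ i, E.ownPotential i c π ≤
          Fintype.card Pl * Fintype.card (Slot ℓ s → X) := fun c => by
        rw [Finset.sum_comm]
        refine (Finset.sum_le_sum fun i _ => E.sum_ownPotential_le i c).trans ?_
        rw [Finset.sum_const, nsmul_eq_mul, Finset.card_univ]
      refine (Finset.sum_le_sum fun c _ => h1 c).trans (le_of_eq ?_)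
      rw [Finset.sum_const, nsmul_eq_mul, Finset.card_univ]
      ring
  have h5 := E.card_success_le_half hl hℓ hs hM₂ hb hk c π ?_ ?_ h4
  · have h6 : (0 : ℝ) < (2 * s) ^ ℓ := by positivity
    simp only at h1
    linarith
  · have h6 : 64 * ((E.excluded c π).card : ℝ) ≤ ℓ * s := by
      simp only at h2
      linarith
    exact_mod_cast h6
  · simp only at h3
    rw [le_div_iff₀ hw] at h3
    have h6 : (2 : ℝ) ^ l * (Finset.univ.filter fun i => c i = 0).card ≤
        5 * Fintype.card Pl := by linarith
    exact_mod_cast h6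

end Execution

/-! ### From algorithms to executions -/

namespace GadgetVertices

variable {n k ℓ s : ℕ} {X : Type} (e : GadgetVertices n (Slot ℓ s) X)

/-- The sequence of graphs for the right leaves `ω.1` and the deletion pattern `ω.2`. Initially all
left edges are present. Batch `t < s` inserts the right edges in column `t`, and batch `s`
performs the deletions. -/
def sequence (ω : (Slot ℓ s → X) × Pattern ℓ s) (t : ℕ) : SimpleGraph (Fin n) :=
  e.graph (fun g => s < t → ω.2 g.1 ≠ (g.2, false))
    (fun g y => y = ω.1 g ∧ (g.2 : ℕ) < t ∧ (s < t → ω.2 g.1 ≠ (g.2, true)))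

/-- The hosts of the gadgets under a vertex partition. -/
def hosts (P : Partition n k) : Hosts (Fin k) X ℓ s where
  left g := P (e.left g)
  center g := P (e.center g)
  right g x := P (e.right g x)

variable {e}

theorem sequence_zero (ω : (Slot ℓ s → X) × Pattern ℓ s) :
    e.sequence ω 0 = e.graph (fun _ => True) fun _ _ => False := by
  simp [sequence]

theorem sequence_eq_of_le {π : Slot ℓ s → X} (x x' : Pattern ℓ s) {t : ℕ} (ht : t ≤ s) :
    e.sequence (π, x) t = e.sequence (π, x') t := by
  simp [sequence, not_lt.2 ht]

theorem isBatch_sequence (ω : (Slot ℓ s → X) × Pattern ℓ s) (t : ℕ) :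
    IsBatch ℓ (e.sequence ω t) (e.sequence ω (t + 1)) := by
  rcases lt_trichotomy t s with ht | rfl | ht
  · refine isBatch_graph (fun r => s(e.center (r, ⟨t, ht⟩), e.right (r, ⟨t, ht⟩) (ω.1 (r, ⟨t, ht⟩))))
      (fun g hg => absurd ?_ hg) fun g y hg => ⟨g.1, ?_⟩
    · simp [not_lt.2 ht.le, not_lt.2 (Nat.succ_le_of_lt ht)]
    · simp only [not_lt.2 ht.le, not_lt.2 (Nat.succ_le_of_lt ht), false_imp_iff, and_true] at hg
      have h1 : (g.2 : ℕ) = t := by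
        by_contra h
        refine hg (and_congr_right fun _ => ?_)
        omega
      have h2 : y = ω.1 g := by
        by_contra h
        exact hg (by simp [h])
      have h3 : g = (g.1, ⟨t, ht⟩) := Prod.ext rfl (Fin.ext h1)
      rw [← h3, h2]
  · refine isBatch_graph (fun r => if (ω.2 r).2 then
        s(e.center (r, (ω.2 r).1), e.right (r, (ω.2 r).1) (ω.1 (r, (ω.2 r).1))) else
        s(e.left (r, (ω.2 r).1), e.center (r, (ω.2 r).1)))
      (fun g hg => ⟨g.1, ?_⟩) fun g y hg => ⟨g.1, ?_⟩
    · have h1 : ω.2 g.1 = (g.2, false) := by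
        by_contra h
        exact hg (by simp [h])
      simp [h1]
    · have h1 : ω.2 g.1 = (g.2, true) := by
        by_contra h
        refine hg (and_congr_right fun _ => ?_)
        have := g.2.2
        simp only [h, ne_eq, not_false_eq_true, implies_true, and_true]
        omega
      have h2 : y = ω.1 g := by
        by_contra h
        exact hg (by simp [h])
      simp [h1, h2]
  · refine isBatch_graph (fun r => s(e.left (r, (ω.2 r).1), e.left (r, (ω.2 r).1)))
      (fun g hg => absurd ?_ hg) fun g y hg => absurd ?_ hg
    · simp [ht, ht.trans (Nat.lt_succ_self t)]
    · have := g.2.2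
      simp only [ht, ht.trans (Nat.lt_succ_self t), this.trans ht,
        (this.trans ht).trans (Nat.lt_succ_self t)]

/-- The local inputs of a player are the same if it sees the same right leaves and deletions. -/
theorem localInput_sequence_eq [DecidableEq X] {P : Partition n k} {i : Fin k}
    {π π' : Slot ℓ s → X} {x x' : Pattern ℓ s}
    (hπ : ∀ g, (e.hosts P).center g = i ∨ (e.hosts P).right g (π g) = i ∨
      (e.hosts P).right g (π' g) = i → π g = π' g)
    (hx : SameView ((e.hosts P).visible π) i x x') (t : ℕ) :
    localInput (e.sequence (π, x) t) P i = localInput (e.sequence (π', x') t) P i := by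
  refine localInput_graph_eq (fun g hg => ?_) fun g y hg => ?_
  · have := hx g false (by
      simp only [Hosts.visible, Bool.false_eq_true, if_false, Finset.mem_insert,
        Finset.mem_singleton]
      exact hg.imp Eq.symm Eq.symm)
    simp only [ne_eq, this]
  · by_cases hy : y = π g ∨ y = π' g
    · have h1 : π g = π' g := hπ g (by
        rcases hg with hg | hg
        · exact Or.inl hg
        · rcases hy with rfl | rfl
          · exact Or.inr (Or.inl hg)
          · exact Or.inr (Or.inr hg))
      have h2 : y = π g := by rcases hy with rfl | rfl <;> simp [h1]
      have := hx g true (by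
        simp only [Hosts.visible, if_true, Finset.mem_insert, Finset.mem_singleton]
        rw [← h2]
        exact hg.imp Eq.symm Eq.symm)
      simp only [ne_eq, this, h1]
    · rw [not_or] at hy
      simp [hy.1, hy.2]

end GadgetVertices

namespace Algorithm

variable {n k B ℓ s : ℕ} {X : Type} (A : Algorithm n k B)

theorem exists_transcript_code (k B T : ℕ) (i : Fin k) :
    ∃ f : Transcript k B T i → Fin (2 ^ ((B + 1) * (k - 1) * T)), Function.Injective f := by
  have h := card_transcript_le k B T i
  exact ⟨fun m => Fin.castLE h (Finite.equivFin _ m),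
    (Fin.castLE_injective h).comp (Finite.equivFin _).injective⟩

/-- After its coins have been fixed, an algorithm yields an execution on the gadgets. -/
theorem exists_execution [Fintype X] [DecidableEq X] (T : ℕ) (P : Partition n k)
    (e : GadgetVertices n (Slot ℓ s) X) (hs : 0 < s) :
    ∃ E : Execution (Fin k) (Fin s → Fin (2 ^ ((B + 1) * (k - 1) * T)))
        (Fin (2 ^ ((B + 1) * (k - 1) * T))) X ℓ s,
      E.toHosts = e.hosts P ∧
      ∑ ω, A.successProb T P (e.sequence ω) (s + 1) ≤
        ((∑ π, (E.success π).card : ℕ) : ENNReal) := by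
  classical
  obtain ⟨c, m, hc, hm, hS⟩ := A.exists_fixed_success T P e.sequence _
    (fun ω => GadgetVertices.sequence_zero ω) (s + 1)
  choose code hcode using exists_transcript_code k B T
  -- the messages before the deletions do not depend on the pattern, so `x₀` can stand for any
  let x₀ : Pattern ℓ s := fun _ => (⟨0, hs⟩, false)
  have hearly : ∀ π x, ∀ t < s, m (π, x) t = m (π, x₀) t := fun π x t ht =>
    hm _ _ t (by omega) fun t' ht' => GadgetVertices.sequence_eq_of_le x x₀ (by omega)
  have hconf : ∀ π π' x x' i, (fun t : Fin s => code i (m (π, x₀) t i)) =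
      (fun t : Fin s => code i (m (π', x₀) t i)) →
      code i (m (π, x) s i) = code i (m (π', x') s i) →
      (∀ g, (e.hosts P).center g = i ∨ (e.hosts P).right g (π g) = i ∨
        (e.hosts P).right g (π' g) = i → π g = π' g) →
      SameView ((e.hosts P).visible π) i x x' → c (π, x) i = c (π', x') i := by
    intro π π' x x' i h1 h2 h3 h4
    refine hc i _ _ (fun t _ => GadgetVertices.localInput_sequence_eq h3 h4 _) fun t ht => ?_
    rcases Nat.lt_succ_iff_lt_or_eq.1 ht with ht | rfl
    · rw [hearly π x t ht, hearly π' x' t ht]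
      exact hcode i (congrFun h1 ⟨t, ht⟩)
    · exact hcode i h2
  have hgadget : ∀ π x, OutputsMaximalMatching (e.sequence (π, x) (s + 1)) P
      (fun i => A.output i (c (π, x) i)) → ∀ g,
      (s(e.left g, e.center g) ∈ A.output (P (e.left g)) (c (π, x) (P (e.left g))) ↔
        ¬s(e.center g, e.right g (π g)) ∈
          A.output (P (e.right g (π g))) (c (π, x) (P (e.right g (π g))))) ∧
      (s(e.left g, e.center g) ∈ A.output (P (e.left g)) (c (π, x) (P (e.left g))) →
        x g.1 ≠ (g.2, false)) ∧
      (s(e.center g, e.right g (π g)) ∈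
          A.output (P (e.right g (π g))) (c (π, x) (P (e.right g (π g)))) →
        x g.1 ≠ (g.2, true)) := by
    intro π x h g
    have hg : (g.2 : ℕ) < s + 1 := g.2.2.trans (Nat.lt_succ_self s)
    have := OutputsMaximalMatching.gadget h (g := g) (x := π g) (fun _ hy => hy.1) (by
      by_cases h1 : x g.1 = (g.2, false)
      · right
        simp [h1, hg]
      · left
        simp [h1])
    refine ⟨this.1, fun h1 => this.2.1 h1 (Nat.lt_succ_self s), fun h1 => ?_⟩
    exact (this.2.2 h1).2.2 (Nat.lt_succ_self s)
  refine ⟨{ e.hosts P with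
    early := fun π i t => code i (m (π, x₀) t i)
    late := fun π x i => code i (m (π, x) s i)
    leftOut := fun π x g => decide
      (s(e.left g, e.center g) ∈ A.output (P (e.left g)) (c (π, x) (P (e.left g))))
    rightOut := fun π x g => decide (s(e.center g, e.right g (π g)) ∈
      A.output (P (e.right g (π g))) (c (π, x) (P (e.right g (π g)))))
    success := fun π => {x | OutputsMaximalMatching (e.sequence (π, x) (s + 1)) P
      fun i => A.output i (c (π, x) i)}
    rightOut_eq := ?_
    leftOut_gadget := ?_
    leftOut_congr := ?_
    rightOut_congr := ?_ }, rfl, ?_⟩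
  · intro π x hx g
    have := (hgadget π x (Finset.mem_filter.1 hx).2 g).1
    simp [this]
  · intro π x hx r
    have h1 := hgadget π x (Finset.mem_filter.1 hx).2 (x.gadget r)
    rcases hb : (x r).2 with _ | _
    · exact decide_eq_false fun h => h1.2.1 h (Prod.ext rfl hb)
    · exact decide_eq_true (h1.1.2 fun h => h1.2.2 h (Prod.ext rfl hb))
  · intro π π' x x' g h1 h2 h3 h4
    have : c (π, x) (P (e.left g)) = c (π', x') (P (e.left g)) := hconf π π' x x' _ h1 h2 h3 h4
    simp only [this]
  · intro π x x' g h2 h4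
    have : c (π, x) (P (e.right g (π g))) = c (π, x') (P (e.right g (π g))) :=
      hconf π π x x' _ rfl h2 (fun _ _ => rfl) h4
    simp only [this]
  · refine hS.trans (le_of_eq (congrArg _ ?_))
    simp only [Finset.card_filter]
    rw [Fintype.sum_prod_type]

end Algorithm

/-! ### Random vertex partitions -/

/-- The mean of a function that is at most `a` outside a set `D` of density `δ`, and at most `b`
everywhere. -/
theorem ev_uniformOfFintype_le {α : Type} [Fintype α] [Nonempty α] {f : α → ℝ≥0∞} {D : Finset α}
    {a b δ : ℝ} (ha : 0 ≤ a) (hb : 0 ≤ b) (hf : ∀ x ∉ D, f x ≤ ENNReal.ofReal a)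
    (hf' : ∀ x, f x ≤ ENNReal.ofReal b) (hD : (D.card : ℝ) ≤ δ * Fintype.card α) :
    ev (PMF.uniformOfFintype α) f ≤ ENNReal.ofReal (a + δ * b) := by
  classical
  have hα : (0 : ℝ) < Fintype.card α := by exact_mod_cast Fintype.card_pos
  have h1 : ∀ x, PMF.uniformOfFintype α x * f x ≤
      ENNReal.ofReal ((Fintype.card α : ℝ)⁻¹ * (a + if x ∈ D then b else 0)) := by
    intro x
    rw [PMF.uniformOfFintype_apply, ENNReal.ofReal_mul (by positivity),
      ENNReal.ofReal_inv_of_pos hα, ENNReal.ofReal_natCast]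
    refine mul_le_mul' le_rfl ?_
    split_ifs with hx
    · exact (hf' x).trans (ENNReal.ofReal_le_ofReal (by linarith))
    · rw [add_zero]
      exact hf x hx
  calc ev (PMF.uniformOfFintype α) f
      ≤ ∑' x, ENNReal.ofReal ((Fintype.card α : ℝ)⁻¹ * (a + if x ∈ D then b else 0)) :=
        ENNReal.tsum_le_tsum h1
    _ = ENNReal.ofReal (∑ x, (Fintype.card α : ℝ)⁻¹ * (a + if x ∈ D then b else 0)) := by
        rw [tsum_fintype, ENNReal.ofReal_sum_of_nonneg]
        intro x _
        split_ifs <;> positivity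
    _ ≤ _ := by
        refine ENNReal.ofReal_le_ofReal ?_
        rw [← Finset.mul_sum, Finset.sum_add_distrib, Finset.sum_ite_mem, Finset.univ_inter,
          Finset.sum_const, Finset.sum_const, nsmul_eq_mul, nsmul_eq_mul, Finset.card_univ,
          inv_mul_le_iff₀ hα]
        nlinarith

/-- Two vertices have the same host with probability at most `1 / k`. -/
theorem mul_card_same_host_le {n k : ℕ} [NeZero k] {v v' : Fin n} (h : v ≠ v') :
    k * (Finset.univ.filter fun P : Partition n k => P v = P v').card ≤
      Fintype.card (Partition n k) := by
  suffices h' : ((Finset.univ : Finset (Fin k)) ×ˢ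
      (Finset.univ.filter fun P : Partition n k => P v = P v')).card ≤
      (Finset.univ : Finset (Partition n k)).card by
    rwa [Finset.card_product, Finset.card_univ, Finset.card_univ, Fintype.card_fin] at h'
  refine Finset.card_le_card_of_injOn (fun a => Function.update a.2 v a.1)
    (fun _ _ => Finset.mem_coe.2 (Finset.mem_univ _)) ?_
  rintro ⟨j, P⟩ hP ⟨j', P'⟩ hP' hu
  have e1 : P v = P v' := by simpa using hP
  have e2 : P' v = P' v' := by simpa using hP'
  have hu' : ∀ u, Function.update P v j u = Function.update P' v j' u := fun u => congrFun hu u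
  have h1 : j = j' := by simpa using hu' v
  have h2 : ∀ u, u ≠ v → P u = P' u := fun u hu => by simpa [hu] using hu' u
  refine Prod.ext h1 (funext fun u => ?_)
  by_cases hu : u = v
  · subst hu
    change P u = P' u
    rw [e1, e2, h2 _ h.symm]
  · exact h2 u hu

open Classical in
/-- A union bound for the event that two of the vertices `f i` have the same host. -/
theorem mul_card_not_injective_le {n k : ℕ} [NeZero k] {ι : Type} [Fintype ι] (f : ι ↪ Fin n) :
    k * (Finset.univ.filter fun P : Partition n k => ¬Function.Injective fun i => P (f i)).card ≤
      Fintype.card ι ^ 2 * Fintype.card (Partition n k) := by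
  have h1 : (Finset.univ.filter fun P : Partition n k => ¬Function.Injective fun i => P (f i)) ⊆
      (Finset.univ.filter fun a : ι × ι => a.1 ≠ a.2).biUnion fun a =>
        Finset.univ.filter fun P : Partition n k => P (f a.1) = P (f a.2) := by
    intro P hP
    have hP' := (Finset.mem_filter.1 hP).2
    simp only [Function.Injective, not_forall] at hP'
    obtain ⟨i, i', h, hne⟩ := hP'
    exact Finset.mem_biUnion.2 ⟨(i, i'), by simpa using hne, by simpa using h⟩
  calc _ ≤ k * ∑ a : ι × ι with a.1 ≠ a.2,
        (Finset.univ.filter fun P : Partition n k => P (f a.1) = P (f a.2)).card :=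
        Nat.mul_le_mul_left _ ((Finset.card_le_card h1).trans Finset.card_biUnion_le)
    _ = ∑ a : ι × ι with a.1 ≠ a.2,
        k * (Finset.univ.filter fun P : Partition n k => P (f a.1) = P (f a.2)).card := by
        rw [Finset.mul_sum]
    _ ≤ ∑ a : ι × ι with a.1 ≠ a.2, Fintype.card (Partition n k) :=
        Finset.sum_le_sum fun a ha => mul_card_same_host_le fun h =>
          (Finset.mem_filter.1 ha).2 (f.injective h)
    _ ≤ _ := by
        rw [Finset.sum_const, smul_eq_mul]
        refine Nat.mul_le_mul_right _ ((Finset.card_le_univ _).trans (le_of_eq ?_))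
        rw [Fintype.card_prod, sq]

namespace GadgetVertices

variable {n k ℓ s : ℕ} {X : Type} (e : GadgetVertices n (Slot ℓ s) X)

theorem good_hosts_of_injective {P : Partition n k} {g : Slot ℓ s}
    (h : Function.Injective fun y => P (e (g, y))) : (e.hosts P).Good g := by
  refine ⟨fun h1 => ?_, fun x => ⟨fun h1 => ?_, fun h1 => ?_⟩, fun x x' h1 => ?_⟩
  · simpa using h (a₁ := none) (a₂ := some none) h1
  · simpa using h (a₁ := some (some x)) (a₂ := none) h1
  · simpa using h (a₁ := some (some x)) (a₂ := some none) h1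
  · simpa using h (a₁ := some (some x)) (a₂ := some (some x')) h1

/-- Under most vertex partitions, most gadgets are good. -/
theorem mul_card_bad_partitions_le [NeZero k] [Fintype X] {a : ℕ} (ha : 0 < ℓ * s) :
    k * (Finset.univ.filter fun P : Partition n k =>
      ℓ * s < a * {g | ¬(e.hosts P).Good g}.ncard).card ≤
      a * (Fintype.card X + 2) ^ 2 * Fintype.card (Partition n k) := by
  classical
  set D := Finset.univ.filter fun P : Partition n k => ℓ * s < a * {g | ¬(e.hosts P).Good g}.ncard
    with hD
  have hle : ∀ P : Partition n k, {g | ¬(e.hosts P).Good g}.ncard ≤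
      (Finset.univ.filter fun g => ¬Function.Injective fun y => P (e (g, y))).card := fun P => by
    rw [← Set.ncard_coe_finset]
    refine Set.ncard_le_ncard (fun g hg => ?_) (Set.toFinite _)
    simp only [Finset.coe_filter, Finset.mem_univ, true_and, Set.mem_ofPred_eq] at hg ⊢
    exact fun h => hg (e.good_hosts_of_injective h)
  have h1 : D.card * (ℓ * s) ≤ a * ∑ P : Partition n k,
      (Finset.univ.filter fun g => ¬Function.Injective fun y => P (e (g, y))).card := by
    rw [← smul_eq_mul, ← Finset.sum_const, Finset.mul_sum]
    refine (Finset.sum_le_sum fun P hP => ?_).trans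
      (Finset.sum_le_sum_of_subset (Finset.subset_univ D))
    exact (Finset.mem_filter.1 hP).2.le.trans (Nat.mul_le_mul_left _ (hle P))
  have h2 : ∑ P : Partition n k,
      (Finset.univ.filter fun g => ¬Function.Injective fun y => P (e (g, y))).card =
      ∑ g, (Finset.univ.filter fun P : Partition n k =>
        ¬Function.Injective fun y => P (e (g, y))).card := by
    simp only [Finset.card_filter]
    exact Finset.sum_comm
  have h3 : k * ∑ g, (Finset.univ.filter fun P : Partition n k =>
      ¬Function.Injective fun y => P (e (g, y))).card ≤
      ℓ * s * ((Fintype.card X + 2) ^ 2 * Fintype.card (Partition n k)) := by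
    rw [Finset.mul_sum]
    refine (Finset.sum_le_sum fun g _ => ?_).trans (le_of_eq (?_ :
      ∑ _g : Slot ℓ s, (Fintype.card X + 2) ^ 2 * Fintype.card (Partition n k) = _))
    · have := mul_card_not_injective_le (k := k)
        ((⟨fun y => (g, y), fun y y' h => (Prod.mk.inj h).2⟩ : _ ↪ _).trans e)
      rwa [show Fintype.card (Option (Option X)) = Fintype.card X + 2 by simp] at this
    · simp
  have h4 : (ℓ * s) * (k * D.card) ≤
      (ℓ * s) * (a * (Fintype.card X + 2) ^ 2 * Fintype.card (Partition n k)) := by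
    calc (ℓ * s) * (k * D.card) = k * (D.card * (ℓ * s)) := by ring
      _ ≤ k * (a * ∑ P : Partition n k, (Finset.univ.filter fun g =>
          ¬Function.Injective fun y => P (e (g, y))).card) := Nat.mul_le_mul_left _ h1
      _ = a * (k * ∑ g, (Finset.univ.filter fun P : Partition n k =>
          ¬Function.Injective fun y => P (e (g, y))).card) := by rw [h2]; ring
      _ ≤ a * (ℓ * s * ((Fintype.card X + 2) ^ 2 * Fintype.card (Partition n k))) :=
          Nat.mul_le_mul_left _ h3
      _ = _ := by ring
  exact Nat.le_of_mul_le_mul_left h4 ha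

end GadgetVertices

/-! ### The lower bound against the oblivious adversary -/

namespace Algorithm

variable {n k B : ℕ} (A : Algorithm n k B)

/-- If the expected number of correct outputs is small for most vertex partitions, then the
algorithm does not cope with the oblivious adversary. -/
theorem UpdatesOblivious.le_of_sum_successProb [NeZero k] {Ω : Type} [Fintype Ω] [Nonempty Ω]
    {T ℓ : ℕ} {ε : ℝ} (hA : A.UpdatesOblivious T ℓ ε) (hε : ε ≤ 1) (G : Ω → ℕ → SimpleGraph (Fin n))
    (hG : ∀ ω t, IsBatch ℓ (G ω t) (G ω (t + 1))) (t : ℕ) {a δ : ℝ} (ha : 0 ≤ a)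
    (hδ : 0 ≤ δ) (D : Finset (Partition n k))
    (hD : (D.card : ℝ) ≤ δ * Fintype.card (Partition n k))
    (hS : ∀ P ∉ D, ∑ ω, A.successProb T P (G ω) t ≤ ENNReal.ofReal (a * Fintype.card Ω)) :
    1 - (t + 1) * ε ≤ a + δ := by
  have hΩ : (0 : ℝ) < Fintype.card Ω := by exact_mod_cast Fintype.card_pos
  have h1 : ∑ _ω : Ω, ENNReal.ofReal (1 - (t + 1) * ε) ≤
      ev (PMF.uniformOfFintype (Partition n k)) fun P => ∑ ω, A.successProb T P (G ω) t := by
    rw [ev_sum]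
    exact Finset.sum_le_sum fun ω _ => A.ev_successProb_ge hε (hA (G ω) (hG ω)) t
  have h2 := h1.trans (ev_uniformOfFintype_le (D := D) (a := a * Fintype.card Ω)
    (b := Fintype.card Ω) (δ := δ) (by positivity) (by positivity) hS (fun P => by
      rw [ENNReal.ofReal_natCast]
      refine (Finset.sum_le_sum fun ω _ => A.successProb_le_one T P (G ω) t).trans ?_
      simp) hD)
  rw [Finset.sum_const, Finset.card_univ, nsmul_eq_mul, ← ENNReal.ofReal_natCast,
    ← ENNReal.ofReal_mul hΩ.le, ENNReal.ofReal_le_ofReal_iff (by positivity)] at h2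
  have h3 : Fintype.card Ω * (1 - (t + 1) * ε) ≤ Fintype.card Ω * (a + δ) := by linarith
  exact le_of_mul_le_mul_left h3 hΩ

/-- Without communication, no algorithm copes with a single deletion. -/
theorem UpdatesOblivious.ne_zero [NeZero k] {T ℓ : ℕ} {ε : ℝ} (hA : A.UpdatesOblivious T ℓ ε)
    (hε : ε ≤ 1 / 20) (hn : 3 ≤ n) (hk : 1000 ≤ k) (hℓ : 1 ≤ ℓ) : T ≠ 0 := by
  classical
  rintro rfl
  have hcard : Fintype.card (Fin 1 × Option (Option Unit)) ≤ Fintype.card (Fin n) := by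
    simpa using hn
  obtain ⟨e⟩ : Nonempty (GadgetVertices n (Fin 1) Unit) :=
    Function.Embedding.nonempty_of_card_le hcard
  have hkD := mul_card_not_injective_le (k := k) e
  set D := Finset.univ.filter fun P : Partition n k => ¬Function.Injective fun i => P (e i) with hD
  have hk' : (1000 : ℝ) ≤ k := by exact_mod_cast hk
  have hDcard : (D.card : ℝ) ≤ 9 / 1000 * Fintype.card (Partition n k) := by
    have h1 : (k : ℝ) * D.card ≤ 9 * Fintype.card (Partition n k) := by
      have h2 : Fintype.card (Fin 1 × Option (Option Unit)) = 3 := by simp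
      rw [h2] at hkD
      exact_mod_cast hkD
    have h2 : (1000 : ℝ) * D.card ≤ k * D.card := by gcongr
    linarith
  have := hA.le_of_sum_successProb A (by linarith) (fun ω => e.deletion ω)
    (fun ω t => (e.isBatch_deletion ω t).mono hℓ) 1 (a := 2 / 3) (δ := 9 / 1000) (by norm_num)
    (by norm_num) D hDcard fun P hP => by
      have hinj : Function.Injective fun i => P (e i) := by
        by_contra h
        exact hP (Finset.mem_filter.2 ⟨Finset.mem_univ _, h⟩)
      have hg : ∀ g : Fin 1, g = 0 := fun g => Subsingleton.elim _ _
      have hne : ∀ y y' : Fin 1 × Option (Option Unit), y ≠ y' → P (e y) ≠ P (e y') :=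
        fun y y' h h' => h (hinj h')
      refine (A.sum_successProb_zero_le P e (i₁ := P (e.left 0)) (i₂ := P (e.right 0 ()))
        (hne _ _ (by simp)) (fun g => by rw [hg g]) (fun g => by rw [hg g])
        (fun g => by rw [hg g]; exact ⟨hne _ _ (by simp), hne _ _ (by simp)⟩)).trans (le_of_eq ?_)
      simp
  norm_num at this
  linarith

/-- The volume of communication that the gadgets force. On `2 ^ (4 * l)` columns of gadgets, the
`(B + 1) * (k - 1) * T` bits that a player can receive during one update have to provide a constant
fraction of `l` bits for each of the `ℓ / k` rows that a player accounts for on average. -/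
theorem UpdatesOblivious.lt_bits [NeZero k] {T ℓ l : ℕ} {ε : ℝ} (hA : A.UpdatesOblivious T ℓ ε)
    (hl : 100000 ≤ l) (hlk : 2 ^ (12 * l) ≤ k) (hk : k ≤ ℓ)
    (hn : ℓ * 2 ^ (4 * l) * (2 ^ (4 * l) + 2) ≤ n)
    (hε : ((2 ^ (4 * l) + 2 : ℕ) : ℝ) * ε ≤ 1 / 50) (hε1 : ε ≤ 1) :
    l * ℓ < 10000 * ((B + 1) * (k - 1) * T * k) := by
  classical
  by_contra! hb
  set s := 2 ^ (4 * l) with hs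
  have hl1 : l < 2 ^ l := Nat.lt_two_pow_self
  have hs1 : 2 ^ l ≤ s := Nat.pow_le_pow_right (by norm_num) (by omega)
  have hsk : s * (s * s) ≤ k := by
    refine le_trans (le_of_eq ?_) hlk
    rw [hs, ← pow_add, ← pow_add]
    congr 1
    omega
  have hs0 : 0 < s := by positivity
  have hk256 : 256 ≤ k := by nlinarith
  have hcard : Fintype.card (Slot ℓ s × Option (Option (Fin s))) ≤ Fintype.card (Fin n) := by
    simpa using hn
  obtain ⟨e⟩ : Nonempty (GadgetVertices n (Slot ℓ s) (Fin s)) :=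
    Function.Embedding.nonempty_of_card_le hcard
  have hkD := e.mul_card_bad_partitions_le (k := k) (a := 1000) (Nat.mul_pos (by omega) hs0)
  set D := Finset.univ.filter fun P : Partition n k =>
    ℓ * s < 1000 * {g | ¬(e.hosts P).Good g}.ncard with hD
  have hDcard : (D.card : ℝ) ≤ 1 / 50 * Fintype.card (Partition n k) := by
    rw [Fintype.card_fin] at hkD
    have h1 : 50000 * (s + 2) ^ 2 ≤ k := by
      have h2 : 100000 ≤ s := by omega
      have h3 : 50000 * (s + 2) ^ 2 ≤ s * (s * s) := by nlinarith
      omega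
    have h2 : (50 * D.card) * (1000 * (s + 2) ^ 2) ≤
        Fintype.card (Partition n k) * (1000 * (s + 2) ^ 2) := by
      calc (50 * D.card) * (1000 * (s + 2) ^ 2) = (50000 * (s + 2) ^ 2) * D.card := by ring
        _ ≤ k * D.card := Nat.mul_le_mul_right _ h1
        _ ≤ _ := hkD
        _ = _ := by ring
    have h3 : 50 * D.card ≤ Fintype.card (Partition n k) :=
      Nat.le_of_mul_le_mul_right h2 (by positivity)
    have h4 : 50 * (D.card : ℝ) ≤ Fintype.card (Partition n k) := by exact_mod_cast h3
    linarith
  have : Nonempty (Fin s) := ⟨⟨0, hs0⟩⟩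
  have := hA.le_of_sum_successProb A hε1 e.sequence GadgetVertices.isBatch_sequence (s + 1)
    (a := 19 / 20) (δ := 1 / 50) (by norm_num) (by norm_num) D hDcard fun P hP => by
      obtain ⟨E, hE, hS⟩ := A.exists_execution T P e hs0
      refine hS.trans ?_
      rw [← ENNReal.ofReal_natCast]
      refine ENNReal.ofReal_le_ofReal ?_
      push_cast
      have hbad : 1000 * {g | ¬E.Good g}.ncard ≤ ℓ * s := by
        rw [hE]
        by_contra! h
        exact hP (Finset.mem_filter.2 ⟨Finset.mem_univ _, h⟩)
      have h1 := E.sum_card_success_lt (b := (B + 1) * (k - 1) * T) hl (by omega) hs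
        (by rw [Fintype.card_fin, hs, ← pow_mul]; congr 1; omega)
        (by rw [Fintype.card_fun, Fintype.card_fin, Fintype.card_fin, ← pow_mul])
        (by rw [Fintype.card_fin]) (by rw [Fintype.card_fin]; exact hb)
        (by rw [Fintype.card_fin]; omega) (by rw [Fintype.card_fin]; exact hk) hbad
      refine h1.le.trans (le_of_eq ?_)
      have h2 : Fintype.card ((Slot ℓ s → Fin s) × Pattern ℓ s) =
          Fintype.card (Slot ℓ s → Fin s) * (2 * s) ^ ℓ := by
        rw [Fintype.card_prod]
        congr 1
        simp [mul_comm]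
      rw [h2]
      push_cast
      rfl
  push_cast at this hε
  linarith

end Algorithm

/-- With `l` proportional to `log k`, the number `2 ^ (4 * l)` of columns is so small a power of `k` that
the error probabilities `n ^ (-γ)` of all `2 ^ (4 * l) + 1` updates sum up to little, and that
`2 ^ (12 * l) ≤ k`, by which most gadgets are good. -/
theorem exists_oblivious_bound (C γ κ : ℝ) (hC : 0 < C) (hγ : 0 < γ) (hκ : 0 < κ) :
    ∃ c : ℝ, 0 < c ∧ ∃ n₀ : ℕ, ∀ n : ℕ, n₀ ≤ n → ∀ (k : ℕ) [NeZero k] (β ℓ T : ℕ),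
      Admissible κ n k β ℓ →
      ∀ A : Algorithm n k ⌊C * β * Real.log n⌋₊,
        A.UpdatesOblivious T ℓ ((n : ℝ) ^ (-γ)) →
        c * ((ℓ * Real.log k) / (β * (k : ℝ) ^ 2 * Real.log n)) ≤ (T : ℝ) := by
  set η : ℝ := min (1 / 12) (γ / 8) with hη
  have hη0 : 0 < η := lt_min (by norm_num) (by positivity)
  have hη1 : η ≤ 1 / 12 := min_le_left _ _
  have hη2 : η ≤ γ / 8 := min_le_right _ _
  have hlog : Tendsto (fun n : ℕ => Real.log n) atTop atTop :=
    Real.tendsto_log_atTop.comp tendsto_natCast_atTop_atTop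
  have hε : ∀ᶠ n : ℕ in atTop, (n : ℝ) ^ (-(γ / 2)) ≤ 1 / 150 :=
    ((tendsto_rpow_neg_atTop (half_pos hγ)).comp
      tendsto_natCast_atTop_atTop).eventually_le_const (by norm_num)
  -- `k` exceeds every constant, so that `l` below does
  have h1 : ∀ᶠ n : ℕ in atTop, max 1 ((Real.exp (200002 / η) + 1000) / κ) ≤ Real.log n :=
    hlog.eventually_ge_atTop _
  obtain ⟨n₀, hn₀⟩ := eventually_atTop.1 (hε.and (h1.and (eventually_ge_atTop 3)))
  refine ⟨η / (20000 * (C + 1)), by positivity, n₀, fun n hn k _ β ℓ T hadm => ?_⟩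
  obtain ⟨hε, h1, hn3⟩ := hn₀ n hn
  obtain ⟨hβ, hk, hk', hℓ⟩ := hadm
  have hL1 : 1 ≤ Real.log n := (le_max_left _ _).trans h1
  have hL2 : (Real.exp (200002 / η) + 1000) / κ ≤ Real.log n := (le_max_right _ _).trans h1
  have hkbig : Real.exp (200002 / η) + 1000 ≤ k := by
    have h4 : Real.log n ≤ Real.log n ^ 4 := le_self_pow₀ hL1 (by norm_num)
    rw [div_le_iff₀' hκ] at hL2
    nlinarith
  have hexp := Real.exp_pos (200002 / η)
  have hk1000 : (1000 : ℝ) ≤ k := by linarith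
  have hk1000' : 1000 ≤ k := by exact_mod_cast hk1000
  have hk0 : (0 : ℝ) < k := by linarith
  have hn1 : (1 : ℝ) ≤ n := by exact_mod_cast (by omega : 1 ≤ n)
  have hn0 : (0 : ℝ) < n := by linarith
  have hβ0 : (0 : ℝ) < β := by exact_mod_cast hβ
  have hkn : (k : ℝ) ≤ n := by
    refine hk'.trans ((div_le_self (Real.sqrt_nonneg _) hL1).trans ?_)
    rw [Real.sqrt_le_iff]
    exact ⟨by linarith, by nlinarith⟩
  have hlogk : 200002 / η ≤ Real.log k := by
    rw [Real.le_log_iff_exp_le hk0]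
    linarith
  have hlogk0 : 0 < Real.log k := lt_of_lt_of_le (by positivity) hlogk
  have hlogkn : Real.log k ≤ Real.log n := Real.log_le_log hk0 hkn
  set l := ⌊η * Real.log k⌋₊ with hl
  have hl1 : (l : ℝ) ≤ η * Real.log k := Nat.floor_le (by positivity)
  have hl2 : η * Real.log k < l + 1 := Nat.lt_floor_add_one _
  have hl3 : 200002 ≤ η * Real.log k := by rwa [div_le_iff₀' hη0] at hlogk
  have hl4 : 100000 ≤ l := by
    have : (100000 : ℝ) ≤ l := by linarith
    exact_mod_cast this
  have hl5 : η / 2 * Real.log k ≤ l := by linarith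
  have hlk : 2 ^ (12 * l) ≤ k := by
    have h2 : (2 : ℝ) ^ (12 * l) ≤ k := by
      refine (two_pow_le_exp _).trans ?_
      rw [← Real.le_log_iff_exp_le hk0]
      push_cast
      nlinarith
    exact_mod_cast h2
  have hε1 : (n : ℝ) ^ (-γ) ≤ 1 / 150 := by
    refine le_trans ?_ hε
    exact Real.rpow_le_rpow_of_exponent_le hn1 (by linarith)
  have hεs : ((2 ^ (4 * l) + 2 : ℕ) : ℝ) * (n : ℝ) ^ (-γ) ≤ 1 / 50 := by
    have h2 : (2 : ℝ) ^ (4 * l) ≤ (n : ℝ) ^ (γ / 2) := by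
      refine (two_pow_le_exp _).trans ?_
      rw [Real.rpow_def_of_pos hn0, Real.exp_le_exp]
      push_cast
      nlinarith
    have h3 : (1 : ℝ) ≤ (n : ℝ) ^ (γ / 2) := Real.one_le_rpow hn1 (by positivity)
    have h4 : (n : ℝ) ^ (γ / 2) * (n : ℝ) ^ (-γ) = (n : ℝ) ^ (-(γ / 2)) := by
      rw [← Real.rpow_add hn0]
      congr 1
      ring
    push_cast
    calc ((2 : ℝ) ^ (4 * l) + 2) * (n : ℝ) ^ (-γ) ≤ (3 * (n : ℝ) ^ (γ / 2)) * (n : ℝ) ^ (-γ) := by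
          gcongr
          linarith
      _ = 3 * (n : ℝ) ^ (-(γ / 2)) := by rw [mul_assoc, h4]
      _ ≤ 1 / 50 := by linarith
  have hsn : ℓ * 2 ^ (4 * l) * (2 ^ (4 * l) + 2) ≤ n := by
    have h2 : 2 ^ (4 * l) * (2 ^ (4 * l) + 2) ≤ 2 * k := by
      have h3 : 2 ≤ 2 ^ (4 * l) := Nat.le_self_pow (by omega) 2
      calc 2 ^ (4 * l) * (2 ^ (4 * l) + 2) ≤ 2 ^ (4 * l) * (2 ^ (4 * l) * 2) := by
            gcongr
            omega
        _ = 2 * 2 ^ (8 * l) := by rw [show 8 * l = 4 * l + 4 * l by ring, pow_add]; ring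
        _ ≤ 2 * 2 ^ (12 * l) := by gcongr <;> omega
        _ ≤ 2 * k := by omega
    rw [le_div_iff₀ (by positivity)] at hℓ
    have h4 : ℓ * (2 * k) ≤ n := by exact_mod_cast hℓ
    rw [mul_assoc]
    exact (Nat.mul_le_mul_left _ h2).trans h4
  generalize hB : ⌊C * β * Real.log n⌋₊ = B
  intro A hA
  rcases Nat.eq_zero_or_pos ℓ with rfl | hℓ0
  · simp
  have hT : 0 < T := Nat.pos_of_ne_zero
    (hA.ne_zero A (by linarith) hn3 hk1000' hℓ0)
  have hbits : (l : ℝ) * ℓ ≤ 10000 * (((C + 1) * β * Real.log n) * k ^ 2 * T) := by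
    have hBreal := message_bits_le hC hβ hL1
    rw [hB] at hBreal
    rcases le_or_gt k ℓ with hkℓ | hkℓ
    · have h2 := hA.lt_bits A hl4 hlk hkℓ hsn hεs (by linarith)
      have h3 : (l : ℝ) * ℓ ≤ 10000 * (((B : ℝ) + 1) * ((k - 1 : ℕ) : ℝ) * T * k) := by
        exact_mod_cast h2.le
      have h4 : ((k - 1 : ℕ) : ℝ) ≤ k := by exact_mod_cast Nat.sub_le k 1
      calc (l : ℝ) * ℓ ≤ _ := h3
        _ ≤ 10000 * (((C + 1) * β * Real.log n) * k * T * k) := by gcongr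
        _ = _ := by ring
    · -- a batch smaller than `k` is covered by `1 ≤ T`
      have h2 : (l : ℝ) ≤ k := by
        have : l ≤ 2 ^ (12 * l) := (Nat.lt_two_pow_self (n := l)).le.trans
          (Nat.pow_le_pow_right (by norm_num) (by omega))
        exact_mod_cast this.trans hlk
      have h3 : (ℓ : ℝ) ≤ k := by exact_mod_cast hkℓ.le
      have h4 : (1 : ℝ) ≤ T := by exact_mod_cast hT
      have h5 : 1 ≤ (C + 1) * β * Real.log n := le_trans (by
        have : (0 : ℝ) ≤ B := Nat.cast_nonneg B
        linarith) hBreal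
      calc (l : ℝ) * ℓ ≤ k * k := by gcongr
        _ = 1 * k ^ 2 * 1 := by ring
        _ ≤ ((C + 1) * β * Real.log n) * k ^ 2 * T := by gcongr
        _ ≤ _ := by
          have : 0 ≤ ((C + 1) * β * Real.log n) * k ^ 2 * T := by positivity
          linarith
  have h2 : η / 2 * Real.log k * ℓ ≤ 10000 * (((C + 1) * β * Real.log n) * k ^ 2 * T) :=
    le_trans (by gcongr) hbits
  rw [div_mul_div_comm, div_le_iff₀ (by positivity)]
  linarith

end KClique

theorem theorem1 (C γ κ : ℝ) (hC : 0 < C) (hγ : 0 < γ) (hκ : 0 < κ) :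
    (∃ c : ℝ, 0 < c ∧ ∃ n₀ : ℕ, ∀ n : ℕ, n₀ ≤ n → ∀ (k : ℕ) [NeZero k] (β ℓ T : ℕ),
      KClique.Admissible κ n k β ℓ →
      ∀ A : KClique.Algorithm n k ⌊C * β * Real.log n⌋₊,
        A.UpdatesOblivious T ℓ ((n : ℝ) ^ (-γ)) →
        c * ((ℓ * Real.log k) / (β * (k : ℝ) ^ 2 * Real.log n)) ≤ (T : ℝ)) ∧
    (∀ lo hi : ℝ, 0 < lo → lo < 1 → 0 < hi →
      ∃ c : ℝ, 0 < c ∧ ∃ n₀ : ℕ, ∀ n : ℕ, n₀ ≤ n → ∀ (k : ℕ) [NeZero k] (β ℓ T : ℕ),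
      KClique.Admissible κ n k β ℓ →
      ∀ A : KClique.Algorithm n k ⌊C * β * Real.log n⌋₊,
        A.UpdatesAdaptive T ℓ ((n : ℝ) ^ (-γ)) lo hi →
        c * (ℓ / (β * (k : ℝ) * Real.log n)) ≤ (T : ℝ)) :=
  ⟨KClique.exists_oblivious_bound C γ κ hC hγ hκ, fun lo hi _ hlo hhi =>
    KClique.exists_adaptive_bound C γ κ lo hi hC hγ hκ hlo hhi⟩
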